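/- **Setting.** Let $f,g:\mathbb R^d\times\mathbb R^{d'}\to\mathbb R$, let $\mathcal Y\subseteq\mathbb R^{d'}$ be closed and convex, let $y^*(x)=\arg\min_{y\in\mathcal Y}g(x,y)$, and $F(x)=f(x,y^*(x))$. Assume that $f$ is differentiable, $g$ is differentiable in $y$ and $\nabla_y g$ is differentiable in $(x,y)$, and that, with constants $\lambda,C_{gyy}>0$ and $L_{fx},L_{fy},L_{gy},L_{gxy},L_{gyy},C_{fy},C_{gxy},\sigma\ge 0$: * $g(x,\cdot)$ is $\lambda$-strongly convex for every $x$, and $\nabla_y g(x,y^*(x))=0$ for every $x$ (automatic if $\mathcal Y=\mathbb R^{d'}$); * $\nabla_x f,\nabla_y f,\nabla_y g,\nabla^2_{xy}g,\nabla^2_{yy}g$ are Lipschitz continuous in $(x,y)$ with constants $L_{fx},L_{fy},L_{gy},L_{gxy},L_{gyy}$ (spectral norm for matrices); * $\mathcal O_{fx},\mathcal O_{fy},\mathcal O_{gy},\mathcal O_{gxy},\mathcal O_{gyy}$ are unbiased stochastic oracles for these five maps, of variance at most $\sigma^2$, and $0\preceq\mathcal O_{gyy}(x,y)\preceq C_{gyy}I$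 almost surely; different oracle calls use independent samples; * $\|\nabla_y f(x,y)\|\le C_{fy}$ and $\|\nabla^2_{xy}g(x,y)\|\le C_{gxy}$; * $F$ is bounded below and $F(x_0)-\inf F\le\Delta_F$. **Algorithm (SMB).** Given $x_0,y_0$, $\gamma=1-\beta$, step sizes $\eta_x,\eta_y$ and numbers $k_t$, set $h_0=\frac{k_0}{C_{gyy}}\prod_{i=1}^{p}\big(I-\frac1{C_{gyy}}\mathcal O_{gyy,i}(x_0,y_0)\big)$ with $p$ uniform on $\{0,\dots,k_0-1\}$, and $z_0=\mathcal O_{fx}(x_0,y_0)-\mathcal O_{gxy}(x_0,y_0)h_0\mathcal O_{fy}(x_0,y_0)$. For $t=0,\dots,T$, with fresh samples and a fresh $p$ uniform on $\{0,\dots,k_t-1\}$, independent of everything else, $$h_{t+1}=\tfrac{k_t}{C_{gyy}}\prod_{i=1}^{p}\big(I-\tfrac1{C_{gyy}}\mathcal O_{gyy,i}(x_t,y_t)\big),\qquad z_{t+1}=(1-\gamma)z_t+\gamma\big(\mathcal O_{fx}(x_t,y_t)-\mathcal O_{gxy}(x_t,y_t)h_{t+1}\mathcal O_{fy}(x_t,y_t)\big),$$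 $$x_{t+1}=x_t-\eta_xz_{t+1},\qquad y_{t+1}=\Pi_{\mathcal Y}[y_t-\eta_y\mathcal O_{gy}(x_t,y_t)].$$ Let $\Delta_t=\|z_{t+1}-\nabla F(x_t)\|^2$, $\delta_{y,0}=\|y_0-y^*(x_0)\|^2$, $L_y=C_{gxy}/\lambda$, $$C_0=2L_{fx}^2+\tfrac{6C_{fy}^2L_{gxy}^2}{\lambda^2}+\tfrac{6C_{fy}^2C_{gxy}^2L_{gyy}^2}{\lambda^4}+\tfrac{6L_{fy}^2C_{gxy}^2}{\lambda^2},\qquad L_F=\sqrt{C_0(1+L_y^2)},$$ $$C_1(k)=2\sigma^2+6\sigma^2\tfrac{k^2}{C_{gyy}^2}(C_{fy}^2+\sigma^2)+24C_{gxy}^2\tfrac{k^2}{C_{gyy}^2}(C_{fy}^2+\sigma^2)+6C_{gxy}^2\tfrac{k^2}{C_{gyy}^2}\sigma^2 .$$ **Theorem.** $F$ is differentiable and the following hold. (1) Let $\epsilon>0$, $\eta_x,\eta_y>0$, and suppose that for all $t\le T$ $$0<\gamma\le\min\Big(1,\frac{\epsilon^2}{20C_1(k_t)}\Big),\quad \eta_x\le\min\Big(\frac{\eta_y\lambda}{32\sqrt{C_0}L_y},\frac{\gamma}{8L_F}\Big),\quad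 \eta_y\le\min\Big(\frac{\lambda\epsilon^2}{640C_0\sigma^2},\frac{\lambda}{L_{gy}^2}\Big),$$ $$k_t\ge\max\Big(1,\frac{C_{gyy}}{2\lambda}\ln\frac{64C_{gxy}^2C_{fy}^2}{\lambda^2\epsilon^2}\Big),\qquad T\ge\max\Big(\frac{20\Delta_F}{\eta_x\epsilon^2},\frac{20\,\mathrm E[\Delta_0]}{\gamma\epsilon^2},\frac{320\,C_0\,\delta_{y,0}}{\eta_y\lambda\epsilon^2}\Big)$$ (a bound with a zero denominator is void, and $\ln 0=-\infty$). Then $$\mathrm E\Big[\frac1{T+1}\sum_{t=0}^T\|\nabla F(x_t)\|^2\Big]\le\epsilon^2,\qquad \mathrm E\Big[\frac1{T+1}\sum_{t=0}^T\Delta_t\Big]\le5\epsilon^2 .$$ (2) For every $D$ there are constants $A,m$, depending only on $D$, $\Delta_F$ and the constants in the assumptions, such that for every $\epsilon\in(0,\frac12]$ there are $\gamma,\eta_x,\eta_y,(k_t),T$, depending only on $\epsilon$, $D$, $\Delta_F$ and these constants, with $k_t\le A\ln(1/\epsilon)$, that satisfy the conditions in (1), and hence give its conclusion, for all problems and initial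 points as above with $\delta_{y,0}\le D$; and both $\sum_{t=0}^Tk_t$ and, almost surely, the total number of oracle calls made by the algorithm are at most $A\ln(1/\epsilon)^m/\epsilon^4=\widetilde O(1/\epsilon^4)$. -/

import Mathlib

open MeasureTheory ProbabilityTheory

universe u v

noncomputable section

/-- `ℝⁿ` with the Euclidean norm. -/
abbrev Vec (n : ℕ) := EuclideanSpace ℝ (Fin n)

/-! ### Partial derivatives -/

section Derivatives

variable {d d' : ℕ}

/-- `∇ₓ f(x, y)`. -/
def gradX (f : Vec d → Vec d' → ℝ) (x : Vec d) (y : Vec d') : Vec d :=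
  gradient (fun x' => f x' y) x

/-- `∇_y f(x, y)`. -/
def gradY (f : Vec d → Vec d' → ℝ) (x : Vec d) (y : Vec d') : Vec d' :=
  gradient (fun y' => f x y') y

/-- `∇²_{yy} g(x, y)`, a `d' × d'` matrix seen as an operator. -/
def hessYY (g : Vec d → Vec d' → ℝ) (x : Vec d) (y : Vec d') : Vec d' →L[ℝ] Vec d' :=
  fderiv ℝ (fun y' => gradY g x y') y

/-- `∇²_{xy} g(x, y)`, the `d × d'` matrix with entries `∂/∂xᵢ (∂g/∂yⱼ)`, seen as an operator
`ℝ^{d'} → ℝ^d`: the adjoint of the Jacobian in `x` of `∇_y g`. -/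
def hessXY (g : Vec d → Vec d' → ℝ) (x : Vec d) (y : Vec d') : Vec d' →L[ℝ] Vec d :=
  ContinuousLinearMap.adjoint (fderiv ℝ (fun x' => gradY g x' y) x)

/-- `L`-Lipschitz continuity in `(x, y)`, for the Euclidean norm of the pair. -/
def JointLipschitz {V : Type*} [NormedAddCommGroup V] (L : ℝ) (G : Vec d → Vec d' → V) : Prop :=
  ∀ x y x' y', ‖G x y - G x' y'‖ ≤ L * √(‖x - x'‖ ^ 2 + ‖y - y'‖ ^ 2)

end Derivatives

/-- A point of `K` nearest to `y`; for a nonempty closed convex `K` it is unique and this is the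
Euclidean projection of `y` onto `K`. -/
def euclProj {n : ℕ} (K : Set (Vec n)) (y : Vec n) : Vec n :=
  Classical.epsilon fun v => v ∈ K ∧ ∀ w ∈ K, ‖y - v‖ ≤ ‖y - w‖

/-! ### The constants of the problem class -/

/-- The constants of the problem class: strong convexity modulus `lam`, Lipschitz constants `L…`,
bounds `C…`, and the bound `sigma ^ 2` on the variances. -/
structure BilevelConst where
  lam : ℝ
  Lfx : ℝ
  Lfy : ℝ
  Lgy : ℝ
  Lgxy : ℝ
  Lgyy : ℝ
  Cfy : ℝ
  Cgxy : ℝ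
  Cgyy : ℝ
  sigma : ℝ

namespace BilevelConst

/-- The sign conditions on the constants. -/
structure Valid (c : BilevelConst) : Prop where
  lam_pos : 0 < c.lam
  Cgyy_pos : 0 < c.Cgyy
  Lfx_nonneg : 0 ≤ c.Lfx
  Lfy_nonneg : 0 ≤ c.Lfy
  Lgy_nonneg : 0 ≤ c.Lgy
  Lgxy_nonneg : 0 ≤ c.Lgxy
  Lgyy_nonneg : 0 ≤ c.Lgyy
  Cfy_nonneg : 0 ≤ c.Cfy
  Cgxy_nonneg : 0 ≤ c.Cgxy
  sigma_nonneg : 0 ≤ c.sigma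

/-- The Lipschitz constant of the lower-level solution map. -/
def Ly (c : BilevelConst) : ℝ := c.Cgxy / c.lam

def C0 (c : BilevelConst) : ℝ :=
  2 * c.Lfx ^ 2 + 6 * c.Cfy ^ 2 * c.Lgxy ^ 2 / c.lam ^ 2
    + 6 * c.Cfy ^ 2 * c.Cgxy ^ 2 * c.Lgyy ^ 2 / c.lam ^ 4
    + 6 * c.Lfy ^ 2 * c.Cgxy ^ 2 / c.lam ^ 2

/-- The Lipschitz constant of the hypergradient. -/
def LF (c : BilevelConst) : ℝ := √(c.C0 * (1 + c.Ly ^ 2))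

/-- The constant `C₁` for `k` samples in the Neumann series. -/
def C1 (c : BilevelConst) (k : ℕ) : ℝ :=
  2 * c.sigma ^ 2
    + 6 * c.sigma ^ 2 * ((k : ℝ) ^ 2 / c.Cgyy ^ 2) * (c.Cfy ^ 2 + c.sigma ^ 2)
    + 24 * c.Cgxy ^ 2 * ((k : ℝ) ^ 2 / c.Cgyy ^ 2) * (c.Cfy ^ 2 + c.sigma ^ 2)
    + 6 * c.Cgxy ^ 2 * ((k : ℝ) ^ 2 / c.Cgyy ^ 2) * c.sigma ^ 2

end BilevelConst

/-! ### The stochastic bilevel problem -/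

/-- The data of a stochastic bilevel problem: objectives `f`, `g`, the set `𝒴` (`Yset`), the
lower-level solution map `y*` (`yStar`), and the five stochastic oracles, each of which answers a
query at `(x, y)` by a function of `(x, y)` and of a random sample in `Ξ`. -/
structure BilevelProblem (d d' : ℕ) (Ξ : Type u) where
  f : Vec d → Vec d' → ℝ
  g : Vec d → Vec d' → ℝ
  Yset : Set (Vec d')
  yStar : Vec d → Vec d'
  Ofx : Vec d → Vec d' → Ξ → Vec d
  Ofy : Vec d → Vec d' → Ξ → Vec d'
  Ogy : Vec d → Vec d' → Ξ → Vec d'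
  Ogxy : Vec d → Vec d' → Ξ → (Vec d' →L[ℝ] Vec d)
  Ogyy : Vec d → Vec d' → Ξ → (Vec d' →L[ℝ] Vec d')

/-- `O` is an unbiased stochastic oracle of `G` with variance at most `sigma ^ 2`, when its sample
has law `P`. -/
structure IsUnbiasedOracle {d d' : ℕ} {Ξ : Type u} [MeasurableSpace Ξ] {V : Type*}
    [NormedAddCommGroup V] [NormedSpace ℝ V] [MeasurableSpace V] (P : Measure Ξ)
    (O : Vec d → Vec d' → Ξ → V) (G : Vec d → Vec d' → V) (sigma : ℝ) : Prop where
  measurable : Measurable fun q : Vec d × Vec d' × Ξ => O q.1 q.2.1 q.2.2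
  memLp : ∀ x y, MemLp (O x y) 2 P
  mean : ∀ x y, ∫ s, O x y s ∂P = G x y
  variance : ∀ x y, ∫ s, ‖O x y s - G x y‖ ^ 2 ∂P ≤ sigma ^ 2

namespace BilevelProblem

variable {d d' : ℕ} {Ξ : Type u}

/-- The upper-level objective `F(x) = f(x, y*(x))`. -/
def F (S : BilevelProblem d d' Ξ) (x : Vec d) : ℝ := S.f x (S.yStar x)

/-- The standing assumptions on the problem and its oracles, `P` being the law of a sample. -/
structure Assumptions [MeasurableSpace Ξ] (S : BilevelProblem d d' Ξ) (P : Measure Ξ)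
    (c : BilevelConst) : Prop where
  closed_Yset : IsClosed S.Yset
  convex_Yset : Convex ℝ S.Yset
  /- `y*(x)` is the minimizer of `g(x, ·)` over `𝒴`. -/
  yStar_mem : ∀ x, S.yStar x ∈ S.Yset
  yStar_min : ∀ x, ∀ y ∈ S.Yset, S.g x (S.yStar x) ≤ S.g x y
  /- The constraint is not active at `y*(x)`; automatic if `𝒴` is the whole space. -/
  yStar_stationary : ∀ x, gradY S.g x (S.yStar x) = 0
  /- Differentiability of `f`, and two derivatives of `g`, one of them in `y`. -/
  f_diff : Differentiable ℝ fun q : Vec d × Vec d' => S.f q.1 q.2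
  g_diff : ∀ x, Differentiable ℝ (S.g x)
  gradY_g_diff : Differentiable ℝ fun q : Vec d × Vec d' => gradY S.g q.1 q.2
  strongConvex : ∀ x, StrongConvexOn Set.univ c.lam (S.g x)
  lip_fx : JointLipschitz c.Lfx (gradX S.f)
  lip_fy : JointLipschitz c.Lfy (gradY S.f)
  lip_gy : JointLipschitz c.Lgy (gradY S.g)
  lip_gxy : JointLipschitz c.Lgxy (hessXY S.g)
  lip_gyy : JointLipschitz c.Lgyy (hessYY S.g)
  oracle_fx : IsUnbiasedOracle P S.Ofx (gradX S.f) c.sigma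
  oracle_fy : IsUnbiasedOracle P S.Ofy (gradY S.f) c.sigma
  oracle_gy : IsUnbiasedOracle P S.Ogy (gradY S.g) c.sigma
  oracle_gxy : IsUnbiasedOracle P S.Ogxy (hessXY S.g) c.sigma
  oracle_gyy : IsUnbiasedOracle P S.Ogyy (hessYY S.g) c.sigma
  /- `0 ⪯ 𝒪_{gyy}(x, y) ⪯ C_{gyy} I`. -/
  oracle_gyy_bdd : ∀ x y, ∀ᵐ s ∂P, (S.Ogyy x y s).IsPositive ∧
    (c.Cgyy • ContinuousLinearMap.id ℝ (Vec d') - S.Ogyy x y s).IsPositive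
  bdd_fy : ∀ x y, ‖gradY S.f x y‖ ^ 2 ≤ c.Cfy ^ 2
  bdd_gxy : ∀ x y, ‖hessXY S.g x y‖ ^ 2 ≤ c.Cgxy ^ 2

end BilevelProblem

/-! ### The algorithm -/

/-- The oracle calls of the algorithm. Round `0` is the initialization, round `t + 1` is the
iteration `t`; `gyy r i` is the call number `i` of `𝒪_{gyy}` in round `r`. -/
inductive OracleCall where
  | fx (r : ℕ)
  | fy (r : ℕ)
  | gxy (r : ℕ)
  | gy (r : ℕ)
  | gyy (r i : ℕ)

/-- The inputs and the randomness of a run: initial points, momentum parameter `1 - β = γ`, step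
sizes, numbers of samples `k t`, the sample used by each oracle call, and the random length `p r`
of the product in round `r`. -/
structure SMBRun (d d' : ℕ) (Ξ : Type u) (Ω : Type v) where
  x0 : Vec d
  y0 : Vec d'
  γ : ℝ
  ηx : ℝ
  ηy : ℝ
  k : ℕ → ℕ
  smp : OracleCall → Ω → Ξ
  p : ℕ → Ω → ℕ

/-- The parameter `k` in force in round `r`: `k 0` in the initialization (`r = 0`) and `k t` in the
iteration `t` (`r = t + 1`). -/
def roundK (k : ℕ → ℕ) : ℕ → ℕ
  | 0 => k 0
  | t + 1 => k t

/-- The randomness of a run: every oracle call draws a sample of law `P`, `p r` is uniform on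
`{0, …, k - 1}` with the `k` of the round `r`, and all these are mutually independent. -/
structure SMBRun.IsRandom {d d' : ℕ} {Ξ : Type u} {Ω : Type v} [MeasurableSpace Ξ]
    [MeasurableSpace Ω] (R : SMBRun d d' Ξ Ω) (P : Measure Ξ) (μ : Measure Ω) : Prop where
  measurable_smp : ∀ a, Measurable (R.smp a)
  law_smp : ∀ a, μ.map (R.smp a) = P
  measurable_p : ∀ r, Measurable (R.p r)
  uniform_p : ∀ r, ∀ j < roundK R.k r, μ {ω | R.p r ω = j} = ((roundK R.k r : ℕ) : ENNReal)⁻¹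
  indep : iIndep (Sum.elim
    (fun a : OracleCall => MeasurableSpace.comap (R.smp a) inferInstance)
    (fun r : ℕ => MeasurableSpace.comap (R.p r) inferInstance)) μ

/-- The state of the algorithm, with the number of oracle calls made so far. -/
structure SMBState (d d' : ℕ) where
  x : Vec d
  y : Vec d'
  z : Vec d
  calls : ℕ

namespace BilevelProblem

variable {d d' : ℕ} {Ξ : Type u} {Ω : Type v}

/-- The Neumann-series estimator of `[∇²_{yy} g(x, y)]⁻¹` computed in round `r`:
`(k / C_{gyy}) ∏_{i = 1}^{p} (I - 𝒪_{gyy,i}(x, y) / C_{gyy})`. -/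
def hEst (S : BilevelProblem d d' Ξ) (c : BilevelConst) (R : SMBRun d d' Ξ Ω) (ω : Ω) (r : ℕ)
    (x : Vec d) (y : Vec d') : Vec d' →L[ℝ] Vec d' :=
  ((roundK R.k r : ℝ) / c.Cgyy) •
    ((List.range (R.p r ω)).map fun i =>
      (1 : Vec d' →L[ℝ] Vec d') - c.Cgyy⁻¹ • S.Ogyy x y (R.smp (.gyy r i) ω)).prod

/-- The stochastic hypergradient `𝒪_{fx} - 𝒪_{gxy} h 𝒪_{fy}` computed in round `r` at `(x, y)`.
It takes `3 + p r` oracle calls. -/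
def gradEst (S : BilevelProblem d d' Ξ) (c : BilevelConst) (R : SMBRun d d' Ξ Ω) (ω : Ω) (r : ℕ)
    (x : Vec d) (y : Vec d') : Vec d :=
  S.Ofx x y (R.smp (.fx r) ω)
    - S.Ogxy x y (R.smp (.gxy r) ω) (S.hEst c R ω r x y (S.Ofy x y (R.smp (.fy r) ω)))

/-- The state `(x_t, y_t, z_t)` of the algorithm SMB. -/
def smb (S : BilevelProblem d d' Ξ) (c : BilevelConst) (R : SMBRun d d' Ξ Ω) (ω : Ω) :
    ℕ → SMBState d d'
  | 0 => ⟨R.x0, R.y0, S.gradEst c R ω 0 R.x0 R.y0, 3 + R.p 0 ω⟩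
  | t + 1 =>
    let s := smb S c R ω t
    let z' := (1 - R.γ) • s.z + R.γ • S.gradEst c R ω (t + 1) s.x s.y
    ⟨s.x - R.ηx • z',
     euclProj S.Yset (s.y - R.ηy • S.Ogy s.x s.y (R.smp (.gy (t + 1)) ω)),
     z',
     s.calls + (3 + R.p (t + 1) ω) + 1⟩

/-- `‖∇F(x_t)‖²`. -/
def gradSq (S : BilevelProblem d d' Ξ) (c : BilevelConst) (R : SMBRun d d' Ξ Ω) (t : ℕ)
    (ω : Ω) : ℝ :=
  ‖gradient S.F (S.smb c R ω t).x‖ ^ 2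

/-- The estimator error `Δ_t = ‖z_{t+1} - ∇F(x_t)‖²`. -/
def estErr (S : BilevelProblem d d' Ξ) (c : BilevelConst) (R : SMBRun d d' Ξ Ω) (t : ℕ)
    (ω : Ω) : ℝ :=
  ‖(S.smb c R ω (t + 1)).z - gradient S.F (S.smb c R ω t).x‖ ^ 2

/-- The conclusion on the accuracy: the averages over the iterations `0, …, T` have finite
expectations, with `E[avg ‖∇F(x_t)‖²] ≤ ε²` and `E[avg Δ_t] ≤ 5 ε²`. -/
def Accurate [MeasurableSpace Ω] (S : BilevelProblem d d' Ξ) (c : BilevelConst)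
    (R : SMBRun d d' Ξ Ω) (μ : Measure Ω) (T : ℕ) (ε : ℝ) : Prop :=
  Integrable (fun ω => 1 / ((T : ℝ) + 1) * ∑ t ∈ Finset.range (T + 1), S.gradSq c R t ω) μ ∧
  ∫ ω, 1 / ((T : ℝ) + 1) * ∑ t ∈ Finset.range (T + 1), S.gradSq c R t ω ∂μ ≤ ε ^ 2 ∧
  Integrable (fun ω => 1 / ((T : ℝ) + 1) * ∑ t ∈ Finset.range (T + 1), S.estErr c R t ω) μ ∧
  ∫ ω, 1 / ((T : ℝ) + 1) * ∑ t ∈ Finset.range (T + 1), S.estErr c R t ω ∂μ ≤ 5 * ε ^ 2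

end BilevelProblem

/-- The conditions on the parameters for accuracy `ε`; `δ0` stands for `‖y₀ - y*(x₀)‖²` and `Δz0`
for `E[Δ₀]`. Upper bounds whose denominator may vanish are written multiplied out. -/
structure ParamCond (c : BilevelConst) (ΔF δ0 Δz0 ε γ ηx ηy : ℝ) (k : ℕ → ℕ) (T : ℕ) : Prop where
  γ_pos : 0 < γ
  γ_le_one : γ ≤ 1
  γ_le : ∀ t ≤ T, γ * (20 * c.C1 (k t)) ≤ ε ^ 2
  ηx_pos : 0 < ηx
  ηx_le₁ : ηx * (32 * √c.C0 * c.Ly) ≤ ηy * c.lam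
  ηx_le₂ : ηx * (8 * c.LF) ≤ γ
  ηy_pos : 0 < ηy
  ηy_le₁ : ηy * (640 * c.C0 * c.sigma ^ 2) ≤ c.lam * ε ^ 2
  ηy_le₂ : ηy * c.Lgy ^ 2 ≤ c.lam
  k_pos : ∀ t ≤ T, 1 ≤ k t
  k_ge : ∀ t ≤ T, c.Cgyy / (2 * c.lam) *
    Real.log (64 * c.Cgxy ^ 2 * c.Cfy ^ 2 / (c.lam ^ 2 * ε ^ 2)) ≤ k t
  T_ge₁ : 20 * ΔF / (ηx * ε ^ 2) ≤ T
  T_ge₂ : 20 * Δz0 / (γ * ε ^ 2) ≤ T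
  T_ge₃ : 320 * c.C0 * δ0 / (ηy * c.lam * ε ^ 2) ≤ T

end

/-!
The argument is a Lyapunov analysis of three coupled errors: the optimality gap, the lower-level
error `δ_t = ‖y_t - y*(x_t)‖²` and the estimator error `Δ_t = ‖z_{t+1} - ∇F(x_t)‖²`.

**The hypergradient.** Strong convexity makes `y*` Lipschitz, and `∇_y g(x, y*(x)) = 0` makes it
differentiable, so that `∇F(x) = ∇ₓf - ∇²_{xy}g [∇²_{yy}g]⁻¹ ∇_y f` at `y = y*(x)`
(`hasGradientAt_F`). The right side is Lipschitz in `(x, y)` (`sq_norm_hyperGrad_sub_le`), so `∇F`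
is Lipschitz.

**The oracle.** By independence and the uniform law of the length of the product, the stochastic
hypergradient has as its mean the hypergradient with a truncated Neumann series in the place of the
inverse Hessian (`integral_gradEst`). Its bias is geometrically small in `k`
(`sq_norm_hyperGrad_sub_meanGrad_le`) and its variance is at most `C₁(k)` (`variance_gradEst_le`).

**The recursions.** The randomness of round `t + 1` is independent of the iterate
`(x_t, y_t, z_t)`, which reduces conditional expectations to Tonelli's theorem
(`integral_le_of_round`). In expectation, with `q = η_y λ`,
* `∑ ‖∇F(x_t)‖² + 7/8 ∑ ‖z_{t+1}‖² ≤ 2 Δ_F / η_x + ∑ Δ_t`, by the descent lemma;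
* `δ_{t+1} ≤ (1 - q/2) δ_t + 3/2 η_y² σ² + (3/q) L_y² η_x² ‖z_{t+1}‖²`, by contraction of the
  projected gradient step;
* `Δ_{t+1} ≤ (1 - γ) Δ_t + γ/32 ‖z_{t+1}‖² + γ (ε²/16 + 4 C₀ δ_{t+1}) + γ² C₁(k)`, by the momentum.

Summed over `t`, the feedback through `‖z_{t+1}‖²` is absorbed by the first inequality (`accurate`).

**The complexity.** With `L = log (1 / ε)`, the choices `γ ~ ε²/L²`, `η_y ~ ε²`, `η_x ~ ε²/L²`,
`k ~ L`, `T ~ L⁴/ε⁴` satisfy all the conditions, since `C₁(k) ~ L²` and `E[Δ₀] ≲ L²`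
(`exists_paramCond`, `integral_estErr_zero_le`). A round makes at most `4 + k` oracle calls.
-/

noncomputable section

/-! ### Positive operators and strongly convex functions -/

section Norm

variable {E : Type*} [NormedAddCommGroup E]

theorem norm_add_sq_le_two (a b : E) : ‖a + b‖ ^ 2 ≤ 2 * ‖a‖ ^ 2 + 2 * ‖b‖ ^ 2 := by
  have := norm_add_le a b
  nlinarith [norm_nonneg (a + b), norm_nonneg a, norm_nonneg b, sq_nonneg (‖a‖ - ‖b‖)]

theorem norm_sub_sq_le_two (a b : E) : ‖a - b‖ ^ 2 ≤ 2 * ‖a‖ ^ 2 + 2 * ‖b‖ ^ 2 := by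
  simpa [sub_eq_add_neg] using norm_add_sq_le_two a (-b)

theorem norm_add_add_sq_le_three (a b c : E) :
    ‖a + b + c‖ ^ 2 ≤ 3 * ‖a‖ ^ 2 + 3 * ‖b‖ ^ 2 + 3 * ‖c‖ ^ 2 := by
  have h : ‖a + b + c‖ ≤ ‖a‖ + ‖b‖ + ‖c‖ := norm_add₃_le
  have h2 : ‖a + b + c‖ ^ 2 ≤ (‖a‖ + ‖b‖ + ‖c‖) ^ 2 := by gcongr
  nlinarith [sq_nonneg (‖a‖ - ‖b‖), sq_nonneg (‖a‖ - ‖c‖), sq_nonneg (‖b‖ - ‖c‖)]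

end Norm

section Hilbert

variable {E : Type*} [NormedAddCommGroup E] [InnerProductSpace ℝ E]

theorem norm_le_of_isPositive_of_inner_le {T : E →L[ℝ] E} (hT : T.IsPositive) {q : ℝ}
    (hq : 0 ≤ q) (h : ∀ v, inner ℝ (T v) v ≤ q * ‖v‖ ^ 2) : ‖T‖ ≤ q := by
  rw [T.norm_eq_iSup_rayleighQuotient hT.isSymmetric]
  refine ciSup_le fun v => ?_
  have h0 : 0 ≤ T.reApplyInnerSelf v := hT.2 v
  have h1 : T.reApplyInnerSelf v ≤ q * ‖v‖ ^ 2 := by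
    simpa [ContinuousLinearMap.reApplyInnerSelf] using h v
  rw [ContinuousLinearMap.rayleighQuotient, abs_of_nonneg (by positivity)]
  exact div_le_of_le_mul₀ (by positivity) hq h1

/-- If `0 ⪯ T ⪯ C` then `I - T / C` is a contraction. -/
theorem norm_one_sub_smul_le_one {T : E →L[ℝ] E} {C : ℝ} (hC : 0 < C) (hT : T.IsPositive)
    (hTC : (C • ContinuousLinearMap.id ℝ E - T).IsPositive) :
    ‖(1 : E →L[ℝ] E) - C⁻¹ • T‖ ≤ 1 := by
  have h : (1 : E →L[ℝ] E) - C⁻¹ • T = C⁻¹ • (C • ContinuousLinearMap.id ℝ E - T) := by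
    rw [smul_sub, smul_smul, inv_mul_cancel₀ hC.ne', one_smul]; rfl
  refine norm_le_of_isPositive_of_inner_le ?_ zero_le_one fun v => ?_
  · rw [h]; exact hTC.smul_of_nonneg (by positivity)
  · have h0 := hT.inner_nonneg_left v
    have : inner ℝ ((1 - C⁻¹ • T) v) v = ‖v‖ ^ 2 - C⁻¹ * inner ℝ (T v) v := by
      simp [inner_sub_left, inner_smul_left]
    rw [this, one_mul]
    have : 0 ≤ C⁻¹ * inner ℝ (T v) v := by positivity
    linarith

/-- If `lam ⪯ T ⪯ C` then `‖I - T / C‖ ≤ exp (-lam / C)`. The exponential is used in place of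
`1 - lam / C` because the latter may be negative on the trivial space. -/
theorem norm_one_sub_smul_le_exp {T : E →L[ℝ] E} {C lam : ℝ} (hC : 0 < C)
    (hTC : (C • ContinuousLinearMap.id ℝ E - T).IsPositive)
    (hl : ∀ v, lam * ‖v‖ ^ 2 ≤ inner ℝ (T v) v) :
    ‖(1 : E →L[ℝ] E) - C⁻¹ • T‖ ≤ Real.exp (-(lam / C)) := by
  have h : (1 : E →L[ℝ] E) - C⁻¹ • T = C⁻¹ • (C • ContinuousLinearMap.id ℝ E - T) := by
    rw [smul_sub, smul_smul, inv_mul_cancel₀ hC.ne', one_smul]; rfl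
  refine norm_le_of_isPositive_of_inner_le ?_ (Real.exp_pos _).le fun v => ?_
  · rw [h]; exact hTC.smul_of_nonneg (by positivity)
  · have : inner ℝ ((1 - C⁻¹ • T) v) v = ‖v‖ ^ 2 - C⁻¹ * inner ℝ (T v) v := by
      simp [inner_sub_left, inner_smul_left]
    rw [this]
    have h1 : C⁻¹ * (lam * ‖v‖ ^ 2) ≤ C⁻¹ * inner ℝ (T v) v := by gcongr; exact hl v
    have h2 : (1 - lam / C) * ‖v‖ ^ 2 ≤ Real.exp (-(lam / C)) * ‖v‖ ^ 2 := by
      gcongr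
      have := Real.add_one_le_exp (-(lam / C))
      linarith
    have h3 : C⁻¹ * (lam * ‖v‖ ^ 2) = lam / C * ‖v‖ ^ 2 := by ring
    linarith

theorem isUnit_of_coercive [CompleteSpace E] {T : E →L[ℝ] E} {lam : ℝ} (hlam : 0 < lam)
    (hl : ∀ v, lam * ‖v‖ ^ 2 ≤ inner ℝ (T v) v) : IsUnit T := by
  refine T.isUnit_of_forall_le_norm_inner_map (c := ⟨lam, hlam.le⟩) hlam fun v => ?_
  have : lam * ‖v‖ ^ 2 ≤ |inner ℝ (T v) v| := (hl v).trans (le_abs_self _)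
  rw [mul_comm]
  exact this

theorem norm_apply_ge_of_coercive {T : E →L[ℝ] E} {lam : ℝ}
    (hl : ∀ v, lam * ‖v‖ ^ 2 ≤ inner ℝ (T v) v) (v : E) : lam * ‖v‖ ≤ ‖T v‖ := by
  rcases eq_or_ne v 0 with rfl | hv
  · simp
  · have h1 := (hl v).trans (real_inner_le_norm (T v) v)
    have hv' : 0 < ‖v‖ := norm_pos_iff.2 hv
    nlinarith

theorem norm_inverse_le_of_coercive [CompleteSpace E] {T : E →L[ℝ] E} {lam : ℝ} (hlam : 0 < lam)
    (hl : ∀ v, lam * ‖v‖ ^ 2 ≤ inner ℝ (T v) v) : ‖Ring.inverse T‖ ≤ lam⁻¹ := by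
  refine ContinuousLinearMap.opNorm_le_bound _ (by positivity) fun v => ?_
  have h1 := norm_apply_ge_of_coercive hl (Ring.inverse T v)
  have h2 : T (Ring.inverse T v) = v := by
    rw [← mul_apply_eq_comp, Ring.mul_inverse_cancel _ (isUnit_of_coercive hlam hl)]
    simp
  rw [h2] at h1
  rw [inv_mul_eq_div, le_div_iff₀ hlam]
  linarith

/-- The inverse of a coercive operator depends on the operator in a Lipschitz manner. -/
theorem norm_inverse_sub_inverse_le [CompleteSpace E] {T T' : E →L[ℝ] E} {lam : ℝ}
    (hlam : 0 < lam) (hl : ∀ v, lam * ‖v‖ ^ 2 ≤ inner ℝ (T v) v)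
    (hl' : ∀ v, lam * ‖v‖ ^ 2 ≤ inner ℝ (T' v) v) :
    ‖Ring.inverse T - Ring.inverse T'‖ ≤ lam⁻¹ * ‖T - T'‖ * lam⁻¹ := by
  have hT := isUnit_of_coercive hlam hl
  have hT' := isUnit_of_coercive hlam hl'
  have h : Ring.inverse T - Ring.inverse T' = Ring.inverse T * (T' - T) * Ring.inverse T' := by
    rw [mul_sub, sub_mul, Ring.inverse_mul_cancel _ hT, mul_assoc, Ring.mul_inverse_cancel _ hT',
      mul_one, one_mul]
  rw [h]
  refine (norm_mul_le _ _).trans ?_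
  gcongr
  · refine (norm_mul_le _ _).trans ?_
    rw [norm_sub_rev T']
    gcongr
    exact norm_inverse_le_of_coercive hlam hl
  · exact norm_inverse_le_of_coercive hlam hl'

/-- First-order characterization of strong convexity. -/
theorem StrongConvexOn.inner_le_of_hasGradientAt [CompleteSpace E] {φ : E → ℝ} {m : ℝ}
    (h : StrongConvexOn Set.univ m φ) {y gr : E} (hg : HasGradientAt φ gr y) (y' : E) :
    inner ℝ gr (y' - y) ≤ φ y' - φ y - m / 2 * ‖y' - y‖ ^ 2 := by
  set w := y' - y with hw
  have hd : HasDerivAt (fun t : ℝ => φ (y + t • w)) (inner ℝ gr w) 0 := by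
    have h1 : HasFDerivAt φ (InnerProductSpace.toDual ℝ E gr) (y + (0 : ℝ) • w) := by
      simpa using hg.hasFDerivAt
    have h2 : HasDerivAt (fun t : ℝ => y + t • w) w 0 := by
      simpa using ((hasDerivAt_id (0 : ℝ)).smul_const w).const_add y
    simpa [Function.comp_def] using h1.comp_hasDerivAt (0 : ℝ) h2
  have hs := hd.tendsto_slope_zero_right
  have hl : Filter.Tendsto (fun t : ℝ => φ y' - φ y - (1 - t) * (m / 2 * ‖w‖ ^ 2))
      (nhdsWithin 0 (Set.Ioi 0)) (nhds (φ y' - φ y - (1 - 0) * (m / 2 * ‖w‖ ^ 2))) := by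
    refine Filter.Tendsto.mono_left (Continuous.tendsto (by fun_prop) 0) nhdsWithin_le_nhds
  have key := le_of_tendsto_of_tendsto hs hl ?_
  · simpa using key
  filter_upwards [Ioo_mem_nhdsGT (zero_lt_one' ℝ)] with t ht
  have hc := h.2 (Set.mem_univ y) (Set.mem_univ y') (sub_nonneg.2 ht.2.le) ht.1.le (by ring)
  have e1 : (1 - t) • y + t • y' = y + t • w := by rw [hw]; module
  rw [e1, norm_sub_rev y y'] at hc
  simp only [smul_eq_mul, zero_add, zero_smul, add_zero] at hc ⊢
  rw [inv_mul_le_iff₀ ht.1]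
  linarith

/-- The gradient of a strongly convex function is strongly monotone. -/
theorem StrongConvexOn.le_inner_of_hasGradientAt [CompleteSpace E] {φ : E → ℝ} {m : ℝ}
    (h : StrongConvexOn Set.univ m φ) {y gr y' gr' : E} (hg : HasGradientAt φ gr y)
    (hg' : HasGradientAt φ gr' y') :
    m * ‖y - y'‖ ^ 2 ≤ inner ℝ (gr - gr') (y - y') := by
  have h1 := h.inner_le_of_hasGradientAt hg y'
  have h2 := h.inner_le_of_hasGradientAt hg' y
  rw [← neg_sub y y', inner_neg_right, norm_neg] at h1
  rw [inner_sub_left]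
  linarith

/-- A strongly monotone map has a coercive derivative. -/
theorem coercive_of_stronglyMonotone {G : E → E} {m : ℝ} {y : E} {B : E →L[ℝ] E}
    (hB : HasFDerivAt G B y) (h : ∀ y', m * ‖y' - y‖ ^ 2 ≤ inner ℝ (G y' - G y) (y' - y)) (v : E) :
    m * ‖v‖ ^ 2 ≤ inner ℝ (B v) v := by
  have hd : HasDerivAt (fun t : ℝ => G (y + t • v)) (B v) 0 := by
    have h1 : HasFDerivAt G B (y + (0 : ℝ) • v) := by simpa using hB
    have h2 : HasDerivAt (fun t : ℝ => y + t • v) v 0 := by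
      simpa using ((hasDerivAt_id (0 : ℝ)).smul_const v).const_add y
    exact h1.comp_hasDerivAt (0 : ℝ) h2
  have hs := (hd.tendsto_slope_zero_right).inner (tendsto_const_nhds (x := v)) (𝕜 := ℝ)
  refine ge_of_tendsto hs ?_
  filter_upwards [self_mem_nhdsWithin] with t ht
  have ht : 0 < t := ht
  have := h (y + t • v)
  simp only [add_sub_cancel_left, norm_smul, inner_smul_right, Real.norm_eq_abs, abs_of_pos ht,
    zero_add, zero_smul, add_zero, inner_smul_left, conj_trivial] at this ⊢
  rw [← div_eq_inv_mul, le_div_iff₀ ht]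
  refine le_of_mul_le_mul_left ?_ ht
  linarith

/-- The descent lemma for a function with an `L`-Lipschitz gradient. -/
theorem le_of_lipschitz_gradient [CompleteSpace E] {φ : E → ℝ} (hφ : Differentiable ℝ φ) {L : ℝ}
    (hL : ∀ x x', ‖gradient φ x - gradient φ x'‖ ≤ L * ‖x - x'‖) (x x' : E) :
    φ x' ≤ φ x + inner ℝ (gradient φ x) (x' - x) + L / 2 * ‖x' - x‖ ^ 2 := by
  set w := x' - x with hw
  let ψ : ℝ → ℝ := fun t => φ (x + t • w) - t * inner ℝ (gradient φ x) w - t ^ 2 * (L / 2 * ‖w‖ ^ 2)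
  have hd : ∀ t, HasDerivAt ψ (inner ℝ (gradient φ (x + t • w)) w - inner ℝ (gradient φ x) w
      - 2 * t * (L / 2 * ‖w‖ ^ 2)) t := by
    intro t
    have h1 : HasFDerivAt φ (InnerProductSpace.toDual ℝ E (gradient φ (x + t • w))) (x + t • w) :=
      (hφ _).hasGradientAt.hasFDerivAt
    have h2 : HasDerivAt (fun t : ℝ => x + t • w) w t := by
      simpa using ((hasDerivAt_id t).smul_const w).const_add x
    have h3 : HasDerivAt (fun t : ℝ => φ (x + t • w)) (inner ℝ (gradient φ (x + t • w)) w) t := by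
      simpa [Function.comp_def] using h1.comp_hasDerivAt t h2
    have h4 := (hasDerivAt_id t).mul_const (inner ℝ (gradient φ x) w)
    have h5 := (hasDerivAt_pow 2 t).mul_const (L / 2 * ‖w‖ ^ 2)
    have := (h3.sub h4).sub h5
    simp only [one_mul, pow_one, Nat.cast_ofNat, Nat.add_one_sub_one] at this
    exact this
  have hanti : AntitoneOn ψ (Set.Icc 0 1) := by
    refine antitoneOn_of_deriv_nonpos (convex_Icc 0 1)
      (fun t _ => (hd t).continuousAt.continuousWithinAt)
      (fun t _ => (hd t).differentiableAt.differentiableWithinAt) fun t ht => ?_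
    rw [interior_Icc] at ht
    rw [(hd t).deriv]
    have h1 := real_inner_le_norm (gradient φ (x + t • w) - gradient φ x) w
    have h2 := hL (x + t • w) x
    rw [add_sub_cancel_left, norm_smul, Real.norm_eq_abs, abs_of_pos ht.1] at h2
    rw [inner_sub_left] at h1
    have h3 := mul_le_mul_of_nonneg_right h2 (norm_nonneg w)
    nlinarith
  have := hanti (Set.left_mem_Icc.2 zero_le_one) (Set.right_mem_Icc.2 zero_le_one) zero_le_one
  simp only [ψ, one_smul, zero_smul, add_zero] at this
  rw [hw, add_sub_cancel] at this
  rw [hw]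
  linarith

end Hilbert

/-! ### The Euclidean projection -/

section Projection

variable {n : ℕ} {K : Set (Vec n)}

theorem euclProj_spec (hne : K.Nonempty) (hc : IsClosed K) (y : Vec n) :
    euclProj K y ∈ K ∧ ∀ w ∈ K, ‖y - euclProj K y‖ ≤ ‖y - w‖ := by
  refine Classical.epsilon_spec (p := fun v => v ∈ K ∧ ∀ w ∈ K, ‖y - v‖ ≤ ‖y - w‖) ?_
  obtain ⟨v, hv, h⟩ := hc.exists_infDist_eq_dist hne y
  refine ⟨v, hv, fun w hw => ?_⟩
  rw [← dist_eq_norm, ← dist_eq_norm, ← h]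
  exact Metric.infDist_le_dist_of_mem hw

theorem inner_euclProj_le (hc : IsClosed K) (hK : Convex ℝ K) (y : Vec n)
    {w : Vec n} (hw : w ∈ K) : inner ℝ (y - euclProj K y) (w - euclProj K y) ≤ 0 := by
  obtain ⟨h1, h2⟩ := euclProj_spec ⟨w, hw⟩ hc y
  refine (norm_eq_iInf_iff_real_inner_le_zero hK h1).1 ?_ w hw
  have : Nonempty K := ⟨⟨w, hw⟩⟩
  refine le_antisymm (le_ciInf fun v => h2 v v.2) ?_
  exact ciInf_le ⟨0, by rintro _ ⟨v, rfl⟩; exact norm_nonneg _⟩ (⟨_, h1⟩ : K)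

theorem norm_euclProj_sub_le (hne : K.Nonempty) (hc : IsClosed K) (hK : Convex ℝ K)
    (y y' : Vec n) : ‖euclProj K y - euclProj K y'‖ ≤ ‖y - y'‖ := by
  have h1 := inner_euclProj_le hc hK y (euclProj_spec hne hc y').1
  have h2 := inner_euclProj_le hc hK y' (euclProj_spec hne hc y).1
  set a := euclProj K y
  set b := euclProj K y'
  have h3 : ‖a - b‖ ^ 2 ≤ inner ℝ (y - y') (a - b) := by
    have e : inner ℝ (y - y') (a - b) = ‖a - b‖ ^ 2 - inner ℝ (y - a) (b - a)
        - inner ℝ (y' - b) (a - b) := by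
      rw [← real_inner_self_eq_norm_sq, ← neg_sub a b, inner_neg_right, sub_neg_eq_add,
        ← inner_add_left, ← inner_sub_left]
      congr 1; abel
    linarith
  have h4 := h3.trans (real_inner_le_norm _ _)
  rcases eq_or_lt_of_le (norm_nonneg (a - b)) with h | h
  · rw [← h]; positivity
  · nlinarith

theorem norm_euclProj_sub_mem_le (hc : IsClosed K) (hK : Convex ℝ K) (y : Vec n) {w : Vec n}
    (hw : w ∈ K) : ‖euclProj K y - w‖ ≤ ‖y - w‖ := by
  have h := norm_euclProj_sub_le ⟨w, hw⟩ hc hK y w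
  have h2 := (euclProj_spec ⟨w, hw⟩ hc w).2 w hw
  rw [sub_self, norm_zero, norm_le_zero_iff, sub_eq_zero] at h2
  rwa [← h2] at h

theorem measurable_euclProj (hne : K.Nonempty) (hc : IsClosed K) (hK : Convex ℝ K) :
    Measurable (euclProj K) := by
  refine Continuous.measurable (LipschitzWith.continuous (K := 1) ?_)
  refine LipschitzWith.of_dist_le_mul fun y y' => ?_
  simpa [dist_eq_norm] using norm_euclProj_sub_le hne hc hK y y'

end Projection

/-! ### The hypergradient -/

section Partial

variable {d d' : ℕ}

theorem fderiv_eq_inner_gradX_add {f : Vec d → Vec d' → ℝ}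
    (hf : Differentiable ℝ fun q : Vec d × Vec d' => f q.1 q.2) (x : Vec d) (y : Vec d')
    (u : Vec d) (v : Vec d') :
    fderiv ℝ (fun q : Vec d × Vec d' => f q.1 q.2) (x, y) (u, v)
      = inner ℝ (gradX f x y) u + inner ℝ (gradY f x y) v := by
  have h := (hf (x, y)).hasFDerivAt
  have hx := HasFDerivAt.comp x h (hasFDerivAt_prodMk_left (𝕜 := ℝ) x y)
  have hy := HasFDerivAt.comp y h (hasFDerivAt_prodMk_right (𝕜 := ℝ) x y)
  have hx' : fderiv ℝ (fun x' => f x' y) x = _ := hx.fderiv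
  have hy' : fderiv ℝ (fun y' => f x y') y = _ := hy.fderiv
  rw [gradX, gradY, inner_gradient_left, inner_gradient_left, hx', hy']
  simp [← map_add]

theorem hasFDerivAt_gradY {g : Vec d → Vec d' → ℝ}
    (hg : Differentiable ℝ fun q : Vec d × Vec d' => gradY g q.1 q.2) (x : Vec d) (y : Vec d') :
    HasFDerivAt (fun q : Vec d × Vec d' => gradY g q.1 q.2)
      ((ContinuousLinearMap.adjoint (hessXY g x y)).coprod (hessYY g x y)) (x, y) := by
  have h := (hg (x, y)).hasFDerivAt
  have hx := HasFDerivAt.comp x h (hasFDerivAt_prodMk_left (𝕜 := ℝ) x y)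
  have hy := HasFDerivAt.comp y h (hasFDerivAt_prodMk_right (𝕜 := ℝ) x y)
  refine h.congr_fderiv ?_
  have hx' : fderiv ℝ (fun x' => gradY g x' y) x = _ := hx.fderiv
  have hy' : hessYY g x y = _ := hy.fderiv
  rw [hessXY, ContinuousLinearMap.adjoint_adjoint, hx', hy']
  refine ContinuousLinearMap.ext fun q => ?_
  simp [-map_add]

theorem hasFDerivAt_gradY_left {g : Vec d → Vec d' → ℝ}
    (hg : Differentiable ℝ fun q : Vec d × Vec d' => gradY g q.1 q.2) (x : Vec d) (y : Vec d') :
    HasFDerivAt (fun x' => gradY g x' y) (ContinuousLinearMap.adjoint (hessXY g x y)) x := by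
  have h := HasFDerivAt.comp x (hasFDerivAt_gradY hg x y) (hasFDerivAt_prodMk_left (𝕜 := ℝ) x y)
  refine h.congr_fderiv (ContinuousLinearMap.ext fun q => ?_)
  simp

theorem hasFDerivAt_gradY_right {g : Vec d → Vec d' → ℝ}
    (hg : Differentiable ℝ fun q : Vec d × Vec d' => gradY g q.1 q.2) (x : Vec d) (y : Vec d') :
    HasFDerivAt (gradY g x) (hessYY g x y) y := by
  have h := HasFDerivAt.comp y (hasFDerivAt_gradY hg x y) (hasFDerivAt_prodMk_right (𝕜 := ℝ) x y)
  refine h.congr_fderiv (ContinuousLinearMap.ext fun q => ?_)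
  simp

theorem JointLipschitz.continuous {V : Type*} [NormedAddCommGroup V] {L : ℝ}
    {G : Vec d → Vec d' → V} (h : JointLipschitz L G) :
    Continuous fun q : Vec d × Vec d' => G q.1 q.2 := by
  rw [continuous_iff_continuousAt]
  intro q
  rw [ContinuousAt, tendsto_iff_norm_sub_tendsto_zero]
  have hb : Filter.Tendsto (fun q' : Vec d × Vec d' =>
      L * √(‖q'.1 - q.1‖ ^ 2 + ‖q'.2 - q.2‖ ^ 2)) (nhds q)
      (nhds (L * √(‖q.1 - q.1‖ ^ 2 + ‖q.2 - q.2‖ ^ 2))) :=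
    Continuous.tendsto (by fun_prop) q
  simp only [sub_self, norm_zero] at hb
  refine squeeze_zero (fun _ => norm_nonneg _) (fun q' => h q'.1 q'.2 q.1 q.2) ?_
  simpa using hb

theorem JointLipschitz.sq_le {V : Type*} [NormedAddCommGroup V] {L : ℝ}
    {G : Vec d → Vec d' → V} (h : JointLipschitz L G) (x : Vec d) (y : Vec d') (x' : Vec d)
    (y' : Vec d') : ‖G x y - G x' y'‖ ^ 2 ≤ L ^ 2 * (‖x - x'‖ ^ 2 + ‖y - y'‖ ^ 2) := by
  have h1 : ‖G x y - G x' y'‖ ^ 2 ≤ (L * √(‖x - x'‖ ^ 2 + ‖y - y'‖ ^ 2)) ^ 2 := by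
    gcongr; exact h x y x' y'
  rwa [mul_pow, Real.sq_sqrt (by positivity)] at h1

end Partial

theorem isPositive_integral {E : Type*} [NormedAddCommGroup E] [InnerProductSpace ℝ E]
    [CompleteSpace E] {Ξ : Type*} [MeasurableSpace Ξ] {P : Measure Ξ} {O : Ξ → E →L[ℝ] E}
    (hO : Integrable O P) (h : ∀ᵐ s ∂P, (O s).IsPositive) : (∫ s, O s ∂P).IsPositive := by
  have hi : ∀ v w, inner ℝ w ((∫ s, O s ∂P) v) = ∫ s, inner ℝ w (O s v) ∂P := fun v w => by
    rw [ContinuousLinearMap.integral_apply hO, integral_inner (hO.apply_continuousLinearMap v)]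
  refine ⟨fun v w => ?_, fun v => ?_⟩
  · rw [real_inner_comm]
    simp only [ContinuousLinearMap.coe_coe]
    rw [hi, hi]
    refine integral_congr_ae ?_
    filter_upwards [h] with s hs
    rw [real_inner_comm]
    exact hs.isSymmetric v w
  · simp only [ContinuousLinearMap.reApplyInnerSelf, RCLike.re_to_real]
    rw [real_inner_comm, hi]
    refine integral_nonneg_of_ae ?_
    filter_upwards [h] with s hs
    exact hs.inner_nonneg_right v

namespace BilevelConst

theorem C0_nonneg (c : BilevelConst) : 0 ≤ c.C0 := by
  unfold C0; positivity

theorem LF_nonneg (c : BilevelConst) : 0 ≤ c.LF := Real.sqrt_nonneg _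

theorem LF_sq (c : BilevelConst) : c.LF ^ 2 = c.C0 * (1 + c.Ly ^ 2) := by
  have := c.C0_nonneg
  rw [LF, Real.sq_sqrt (by positivity)]

theorem Valid.Ly_nonneg {c : BilevelConst} (hc : c.Valid) : 0 ≤ c.Ly :=
  div_nonneg hc.Cgxy_nonneg hc.lam_pos.le

theorem C1_nonneg (c : BilevelConst) (k : ℕ) : 0 ≤ c.C1 k := by
  unfold C1; positivity

end BilevelConst

namespace BilevelProblem

variable {d d' : ℕ} {Ξ : Type u} {S : BilevelProblem d d' Ξ}

/-- The hypergradient surrogate `∇ₓf - ∇²_{xy}g [∇²_{yy}g]⁻¹ ∇_y f` at an arbitrary `(x, y)`; it is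
`∇F(x)` at `y = y*(x)`. -/
def hyperGrad (S : BilevelProblem d d' Ξ) (x : Vec d) (y : Vec d') : Vec d :=
  gradX S.f x y - hessXY S.g x y (Ring.inverse (hessYY S.g x y) (gradY S.f x y))

variable [MeasurableSpace Ξ] {P : Measure Ξ} {c : BilevelConst}

namespace Assumptions

theorem norm_gradY_f_le (h : S.Assumptions P c) (hc : c.Valid) (x : Vec d) (y : Vec d') :
    ‖gradY S.f x y‖ ≤ c.Cfy :=
  (sq_le_sq₀ (norm_nonneg _) hc.Cfy_nonneg).1 (h.bdd_fy x y)

theorem norm_hessXY_le (h : S.Assumptions P c) (hc : c.Valid) (x : Vec d) (y : Vec d') :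
    ‖hessXY S.g x y‖ ≤ c.Cgxy :=
  (sq_le_sq₀ (norm_nonneg _) hc.Cgxy_nonneg).1 (h.bdd_gxy x y)

theorem stronglyMonotone (h : S.Assumptions P c) (x : Vec d) (y y' : Vec d') :
    c.lam * ‖y - y'‖ ^ 2 ≤ inner ℝ (gradY S.g x y - gradY S.g x y') (y - y') :=
  (h.strongConvex x).le_inner_of_hasGradientAt (h.g_diff x y).hasGradientAt
    (h.g_diff x y').hasGradientAt

theorem hessYY_coercive (h : S.Assumptions P c) (x : Vec d) (y v : Vec d') :
    c.lam * ‖v‖ ^ 2 ≤ inner ℝ (hessYY S.g x y v) v :=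
  coercive_of_stronglyMonotone (hasFDerivAt_gradY_right h.gradY_g_diff x y)
    (fun y' => h.stronglyMonotone x y' y) v

theorem integrable_gyy [IsProbabilityMeasure P] (h : S.Assumptions P c) (x : Vec d) (y : Vec d') :
    Integrable (S.Ogyy x y) P :=
  (h.oracle_gyy.memLp x y).integrable (by norm_num)

theorem hessYY_isPositive [IsProbabilityMeasure P] (h : S.Assumptions P c) (x : Vec d)
    (y : Vec d') : (hessYY S.g x y).IsPositive := by
  rw [← h.oracle_gyy.mean x y]
  exact isPositive_integral (h.integrable_gyy x y) ((h.oracle_gyy_bdd x y).mono fun s hs => hs.1)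

theorem sub_hessYY_isPositive [IsProbabilityMeasure P] (h : S.Assumptions P c) (x : Vec d)
    (y : Vec d') :
    (c.Cgyy • ContinuousLinearMap.id ℝ (Vec d') - hessYY S.g x y).IsPositive := by
  have e : c.Cgyy • ContinuousLinearMap.id ℝ (Vec d') - hessYY S.g x y
      = ∫ s, (c.Cgyy • ContinuousLinearMap.id ℝ (Vec d') - S.Ogyy x y s) ∂P := by
    rw [integral_sub (integrable_const _) (h.integrable_gyy x y), h.oracle_gyy.mean x y]
    simp
  rw [e]
  exact isPositive_integral ((integrable_const _).sub (h.integrable_gyy x y))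
    ((h.oracle_gyy_bdd x y).mono fun s hs => hs.2)

theorem norm_inverse_hessYY_le (h : S.Assumptions P c) (hc : c.Valid) (x : Vec d) (y : Vec d') :
    ‖Ring.inverse (hessYY S.g x y)‖ ≤ c.lam⁻¹ :=
  norm_inverse_le_of_coercive hc.lam_pos (h.hessYY_coercive x y)

theorem isUnit_hessYY (h : S.Assumptions P c) (hc : c.Valid) (x : Vec d) (y : Vec d') :
    IsUnit (hessYY S.g x y) :=
  isUnit_of_coercive hc.lam_pos (h.hessYY_coercive x y)

/-- The lower-level solution map is Lipschitz. -/
theorem norm_yStar_sub_le (h : S.Assumptions P c) (hc : c.Valid) (x x' : Vec d) :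
    ‖S.yStar x - S.yStar x'‖ ≤ c.Ly * ‖x - x'‖ := by
  have h1 := h.stronglyMonotone x (S.yStar x) (S.yStar x')
  rw [h.yStar_stationary x, zero_sub] at h1
  have h2 : ‖gradY S.g x (S.yStar x')‖ ≤ c.Cgxy * ‖x - x'‖ := by
    have := (convex_univ (𝕜 := ℝ) (E := Vec d)).norm_image_sub_le_of_norm_hasFDerivWithin_le
      (f := fun x => gradY S.g x (S.yStar x'))
      (f' := fun x => ContinuousLinearMap.adjoint (hessXY S.g x (S.yStar x'))) (C := c.Cgxy)
      (fun x _ => (hasFDerivAt_gradY_left h.gradY_g_diff x _).hasFDerivWithinAt)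
      (fun x _ => by rw [LinearIsometryEquiv.norm_map]; exact h.norm_hessXY_le hc x _)
      (Set.mem_univ x') (Set.mem_univ x)
    simpa [h.yStar_stationary x'] using this
  have h3 := h1.trans (real_inner_le_norm _ _)
  rw [norm_neg] at h3
  rw [BilevelConst.Ly, div_mul_eq_mul_div, le_div_iff₀ hc.lam_pos]
  rcases eq_or_lt_of_le (norm_nonneg (S.yStar x - S.yStar x')) with h0 | h0
  · rw [← h0, zero_mul]; exact mul_nonneg hc.Cgxy_nonneg (norm_nonneg _)
  · nlinarith

theorem continuous_yStar (h : S.Assumptions P c) (hc : c.Valid) : Continuous S.yStar := by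
  refine (LipschitzWith.of_dist_le_mul (K := c.Ly.toNNReal) fun a b => ?_).continuous
  rw [dist_eq_norm, dist_eq_norm, Real.coe_toNNReal _ hc.Ly_nonneg]
  exact h.norm_yStar_sub_le hc a b

/-- The implicit function theorem for `∇_y g(x, y*(x)) = 0`: as `y*` is known to be Lipschitz, the
expansion of `∇_y g` at `(x, y*(x))` can be solved for the increment of `y*`. -/
theorem hasFDerivAt_yStar (h : S.Assumptions P c) (hc : c.Valid) (x : Vec d) :
    HasFDerivAt S.yStar (-(Ring.inverse (hessYY S.g x (S.yStar x)) ∘L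
      ContinuousLinearMap.adjoint (hessXY S.g x (S.yStar x)))) x := by
  set B := hessYY S.g x (S.yStar x) with hB
  set A := ContinuousLinearMap.adjoint (hessXY S.g x (S.yStar x)) with hA
  have hlip : (fun x' => S.yStar x' - S.yStar x) =O[nhds x] fun x' => x' - x :=
    Asymptotics.IsBigO.of_bound c.Ly (Filter.Eventually.of_forall fun x' =>
      h.norm_yStar_sub_le hc x' x)
  have hcont : Filter.Tendsto (fun x' => (x', S.yStar x')) (nhds x) (nhds (x, S.yStar x)) := by
    exact Filter.Tendsto.prodMk_nhds Filter.tendsto_id ((h.continuous_yStar hc).tendsto x)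
  have hd := (hasFDerivAt_gradY h.gradY_g_diff x (S.yStar x)).isLittleO.comp_tendsto hcont
  have hd' : (fun x' => A (x' - x) + B (S.yStar x' - S.yStar x)) =o[nhds x] fun x' => x' - x := by
    have h1 : ((fun q : Vec d × Vec d' => q - (x, S.yStar x)) ∘ fun x' => (x', S.yStar x'))
        =O[nhds x] fun x' => x' - x :=
      (Asymptotics.isBigO_refl _ _).prod_left hlip
    refine ((hd.trans_isBigO h1).neg_left).congr_left fun x' => ?_
    simp [h.yStar_stationary, hA, hB]
  rw [hasFDerivAt_iff_isLittleO]
  have h2 := ((Ring.inverse B).isBigO_comp (fun x' => A (x' - x) + B (S.yStar x' - S.yStar x))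
    (nhds x)).trans_isLittleO hd'
  refine h2.congr_left fun x' => ?_
  have e : ∀ v, Ring.inverse B (B v) = v := fun v => by
    rw [← mul_apply_eq_comp, Ring.inverse_mul_cancel _ (h.isUnit_hessYY hc _ _)]; rfl
  rw [map_add, e]
  simp only [neg_apply, ContinuousLinearMap.comp_apply]
  abel

/-- The inverse Hessian is self-adjoint. -/
theorem inner_inverse_hessYY [IsProbabilityMeasure P] (h : S.Assumptions P c) (hc : c.Valid)
    (x : Vec d) (y v w : Vec d') :
    inner ℝ (Ring.inverse (hessYY S.g x y) v) w = inner ℝ v (Ring.inverse (hessYY S.g x y) w) := by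
  set B := hessYY S.g x y
  have e : ∀ v, B (Ring.inverse B v) = v := fun v => by
    rw [← mul_apply_eq_comp, Ring.mul_inverse_cancel _ (h.isUnit_hessYY hc _ _)]; rfl
  have h1 := (h.hessYY_isPositive x y).isSymmetric (Ring.inverse B v) (Ring.inverse B w)
  simp only [ContinuousLinearMap.coe_coe] at h1
  change inner ℝ (B _) _ = inner ℝ _ (B _) at h1
  rw [e, e] at h1
  exact h1.symm

/-- The chain rule for `F(x) = f(x, y*(x))`. -/
theorem hasGradientAt_F [IsProbabilityMeasure P] (h : S.Assumptions P c) (hc : c.Valid)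
    (x : Vec d) : HasGradientAt S.F (S.hyperGrad x (S.yStar x)) x := by
  rw [hasGradientAt_iff_hasFDerivAt]
  have h1 := (h.f_diff (x, S.yStar x)).hasFDerivAt
  have h2 := (hasFDerivAt_id (𝕜 := ℝ) x).prodMk (h.hasFDerivAt_yStar hc x)
  have h3 := HasFDerivAt.comp x h1 h2
  refine HasFDerivAt.congr_fderiv (f := S.F) h3 (ContinuousLinearMap.ext fun v => ?_)
  simp only [InnerProductSpace.toDual_apply_apply, ContinuousLinearMap.comp_apply,
    ContinuousLinearMap.prod_apply, fderiv_eq_inner_gradX_add h.f_diff]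
  rw [hyperGrad, inner_sub_left, neg_apply, inner_neg_right,
    ContinuousLinearMap.comp_apply, ← h.inner_inverse_hessYY hc,
    ContinuousLinearMap.adjoint_inner_right, sub_eq_add_neg]
  rfl

theorem differentiable_F [IsProbabilityMeasure P] (h : S.Assumptions P c) (hc : c.Valid) :
    Differentiable ℝ S.F := fun x => (h.hasGradientAt_F hc x).differentiableAt

theorem gradient_F [IsProbabilityMeasure P] (h : S.Assumptions P c) (hc : c.Valid) (x : Vec d) :
    gradient S.F x = S.hyperGrad x (S.yStar x) := (h.hasGradientAt_F hc x).gradient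

/-- The square of the joint Lipschitz estimate of the hypergradient surrogate: its four sources of
error are `∇ₓf` and the factors of `∇²_{xy}g [∇²_{yy}g]⁻¹ ∇_y f`, changed one at a time. -/
theorem sq_norm_hyperGrad_sub_le (h : S.Assumptions P c) (hc : c.Valid) (x : Vec d) (y : Vec d')
    (x' : Vec d) (y' : Vec d') :
    ‖S.hyperGrad x y - S.hyperGrad x' y'‖ ^ 2
      ≤ c.C0 * (‖x - x'‖ ^ 2 + ‖y - y'‖ ^ 2) := by
  set N := ‖x - x'‖ ^ 2 + ‖y - y'‖ ^ 2 with hN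
  have hN0 : 0 ≤ N := by positivity
  set A := hessXY S.g x y
  set A' := hessXY S.g x' y'
  set J := Ring.inverse (hessYY S.g x y)
  set J' := Ring.inverse (hessYY S.g x' y')
  set b := gradY S.f x y
  set b' := gradY S.f x' y'
  have hl := hc.lam_pos
  have e : S.hyperGrad x y - S.hyperGrad x' y' = (gradX S.f x y - gradX S.f x' y')
      - ((A - A') (J b) + A' ((J - J') b) + A' (J' (b - b'))) := by
    simp only [hyperGrad, sub_apply, map_sub]
    abel
  have hfx := h.lip_fx.sq_le x y x' y'
  have h1 : ‖(A - A') (J b)‖ ^ 2 ≤ c.Lgxy ^ 2 * N * (c.lam⁻¹ * c.Cfy) ^ 2 := by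
    have h2 : ‖J b‖ ≤ c.lam⁻¹ * c.Cfy := (J.le_opNorm b).trans (mul_le_mul
      (h.norm_inverse_hessYY_le hc x y) (h.norm_gradY_f_le hc x y) (norm_nonneg _) (by positivity))
    calc ‖(A - A') (J b)‖ ^ 2 ≤ (‖A - A'‖ * ‖J b‖) ^ 2 := by
          gcongr; exact (A - A').le_opNorm _
      _ = ‖A - A'‖ ^ 2 * ‖J b‖ ^ 2 := by ring
      _ ≤ _ := by gcongr; exact h.lip_gxy.sq_le x y x' y'
  have h2 : ‖A' ((J - J') b)‖ ^ 2 ≤ c.Cgxy ^ 2 * (c.lam⁻¹ ^ 4 * (c.Lgyy ^ 2 * N) * c.Cfy ^ 2) := by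
    have hJ : ‖J - J'‖ ^ 2 ≤ c.lam⁻¹ ^ 4 * (c.Lgyy ^ 2 * N) := by
      calc ‖J - J'‖ ^ 2 ≤ (c.lam⁻¹ * ‖hessYY S.g x y - hessYY S.g x' y'‖ * c.lam⁻¹) ^ 2 := by
            gcongr
            exact norm_inverse_sub_inverse_le hl (h.hessYY_coercive x y) (h.hessYY_coercive x' y')
        _ = c.lam⁻¹ ^ 4 * ‖hessYY S.g x y - hessYY S.g x' y'‖ ^ 2 := by ring
        _ ≤ _ := by gcongr; exact h.lip_gyy.sq_le x y x' y'
    calc ‖A' ((J - J') b)‖ ^ 2 ≤ (‖A'‖ * (‖J - J'‖ * ‖b‖)) ^ 2 := by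
          gcongr
          refine (A'.le_opNorm _).trans ?_
          gcongr
          exact (J - J').le_opNorm _
      _ = ‖A'‖ ^ 2 * (‖J - J'‖ ^ 2 * ‖b‖ ^ 2) := by ring
      _ ≤ _ := by
          gcongr
          · exact h.norm_hessXY_le hc x' y'
          · exact h.norm_gradY_f_le hc x y
  have h3 : ‖A' (J' (b - b'))‖ ^ 2 ≤ c.Cgxy ^ 2 * (c.lam⁻¹ ^ 2 * (c.Lfy ^ 2 * N)) := by
    calc ‖A' (J' (b - b'))‖ ^ 2 ≤ (‖A'‖ * (‖J'‖ * ‖b - b'‖)) ^ 2 := by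
          gcongr
          refine (A'.le_opNorm _).trans ?_
          gcongr
          exact J'.le_opNorm _
      _ = ‖A'‖ ^ 2 * (‖J'‖ ^ 2 * ‖b - b'‖ ^ 2) := by ring
      _ ≤ _ := by
          gcongr
          · exact h.norm_hessXY_le hc x' y'
          · exact h.norm_inverse_hessYY_le hc x' y'
          · exact h.lip_fy.sq_le x y x' y'
  have h4 := norm_add_add_sq_le_three ((A - A') (J b)) (A' ((J - J') b)) (A' (J' (b - b')))
  have h5 := norm_sub_sq_le_two (gradX S.f x y - gradX S.f x' y')
    ((A - A') (J b) + A' ((J - J') b) + A' (J' (b - b')))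
  rw [e]
  have h6 : c.C0 * N = 2 * (c.Lfx ^ 2 * N) + 6 * (c.Lgxy ^ 2 * N * (c.lam⁻¹ * c.Cfy) ^ 2)
      + 6 * (c.Cgxy ^ 2 * (c.lam⁻¹ ^ 4 * (c.Lgyy ^ 2 * N) * c.Cfy ^ 2))
      + 6 * (c.Cgxy ^ 2 * (c.lam⁻¹ ^ 2 * (c.Lfy ^ 2 * N))) := by
    rw [BilevelConst.C0]; field_simp
  rw [h6]
  linarith

theorem norm_gradient_F_sub_le [IsProbabilityMeasure P] (h : S.Assumptions P c) (hc : c.Valid)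
    (x x' : Vec d) : ‖gradient S.F x - gradient S.F x'‖ ≤ c.LF * ‖x - x'‖ := by
  rw [h.gradient_F hc, h.gradient_F hc]
  refine le_of_sq_le_sq ?_ (mul_nonneg c.LF_nonneg (norm_nonneg _))
  have h1 := h.sq_norm_hyperGrad_sub_le hc x (S.yStar x) x' (S.yStar x')
  have h2 : ‖S.yStar x - S.yStar x'‖ ^ 2 ≤ (c.Ly * ‖x - x'‖) ^ 2 := by
    gcongr; exact h.norm_yStar_sub_le hc x x'
  rw [mul_pow, c.LF_sq]
  have h3 := mul_le_mul_of_nonneg_left h2 c.C0_nonneg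
  linarith

theorem continuous_gradient_F [IsProbabilityMeasure P] (h : S.Assumptions P c) (hc : c.Valid) :
    Continuous (gradient S.F) := by
  refine (LipschitzWith.of_dist_le_mul (K := c.LF.toNNReal) fun a b => ?_).continuous
  rw [dist_eq_norm, dist_eq_norm, Real.coe_toNNReal _ c.LF_nonneg]
  exact h.norm_gradient_F_sub_le hc a b

end Assumptions

end BilevelProblem

/-! ### The truncated Neumann series -/

section Neumann

variable {E : Type*} [NormedAddCommGroup E] [NormedSpace ℝ E]

/-- The truncated Neumann series `C⁻¹ ∑_{j < k} (I - B / C)^j` for `B⁻¹`. -/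
def neumannSum (C : ℝ) (B : E →L[ℝ] E) (k : ℕ) : E →L[ℝ] E :=
  C⁻¹ • ∑ j ∈ Finset.range k, (1 - C⁻¹ • B) ^ j

theorem norm_pow_le_of_norm_le {T : E →L[ℝ] E} {q : ℝ} (hT : ‖T‖ ≤ q) (n : ℕ) :
    ‖T ^ n‖ ≤ q ^ n := by
  have hq := (norm_nonneg T).trans hT
  induction n with
  | zero => rw [pow_zero, pow_zero]; exact ContinuousLinearMap.norm_id_le
  | succ n ih =>
    rw [pow_succ, pow_succ]
    exact (norm_mul_le _ _).trans (mul_le_mul ih hT (norm_nonneg _) (by positivity))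

theorem norm_neumannSum_le {C : ℝ} (hC : 0 < C) {B : E →L[ℝ] E} (hB : ‖1 - C⁻¹ • B‖ ≤ 1) (k : ℕ) :
    ‖neumannSum C B k‖ ≤ k / C := by
  rw [neumannSum, norm_smul, Real.norm_eq_abs, abs_of_pos (inv_pos.2 hC), div_eq_inv_mul]
  gcongr
  refine (norm_sum_le _ _).trans ((Finset.sum_le_card_nsmul _ _ 1 fun j _ => ?_).trans (by simp))
  simpa using norm_pow_le_of_norm_le hB j

theorem inverse_sub_neumannSum {C : ℝ} {B : E →L[ℝ] E} (hB : IsUnit B) (k : ℕ) :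
    Ring.inverse B - neumannSum C B k = Ring.inverse B * (1 - C⁻¹ • B) ^ k := by
  have h1 := mul_neg_geom_sum (1 - C⁻¹ • B) k
  rw [sub_sub_cancel] at h1
  have h2 : (1 - C⁻¹ • B) ^ k = 1 - B * neumannSum C B k := by
    rw [neumannSum, mul_smul_comm, ← smul_mul_assoc, h1, sub_sub_cancel]
  rw [h2, mul_sub, mul_one, ← mul_assoc, Ring.inverse_mul_cancel _ hB, one_mul]

end Neumann

namespace BilevelProblem

variable {d d' : ℕ} {Ξ : Type u}

/-- The mean of the stochastic hypergradient at `(x, y)` for the parameter `k`: the hypergradient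
with the inverse Hessian replaced by its truncated Neumann series. -/
def meanGrad (S : BilevelProblem d d' Ξ) (c : BilevelConst) (k : ℕ) (x : Vec d) (y : Vec d') :
    Vec d :=
  gradX S.f x y - hessXY S.g x y (neumannSum c.Cgyy (hessYY S.g x y) k (gradY S.f x y))

namespace Assumptions

variable {S : BilevelProblem d d' Ξ} [MeasurableSpace Ξ] {P : Measure Ξ} {c : BilevelConst}

theorem norm_one_sub_hessYY_le [IsProbabilityMeasure P] (h : S.Assumptions P c) (hc : c.Valid)
    (x : Vec d) (y : Vec d') : ‖1 - c.Cgyy⁻¹ • hessYY S.g x y‖ ≤ 1 :=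
  norm_one_sub_smul_le_one hc.Cgyy_pos (h.hessYY_isPositive x y) (h.sub_hessYY_isPositive x y)

theorem norm_neumannSum_hessYY_le [IsProbabilityMeasure P] (h : S.Assumptions P c) (hc : c.Valid)
    (k : ℕ) (x : Vec d) (y : Vec d') :
    ‖neumannSum c.Cgyy (hessYY S.g x y) k‖ ≤ k / c.Cgyy :=
  norm_neumannSum_le hc.Cgyy_pos (h.norm_one_sub_hessYY_le hc x y) k

/-- The bias of the stochastic hypergradient decays geometrically in `k`. -/
theorem norm_hyperGrad_sub_meanGrad_le [IsProbabilityMeasure P] (h : S.Assumptions P c)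
    (hc : c.Valid) (k : ℕ) (x : Vec d) (y : Vec d') :
    ‖S.hyperGrad x y - S.meanGrad c k x y‖
      ≤ c.Cgxy * c.Cfy / c.lam * Real.exp (-(k * c.lam / c.Cgyy)) := by
  have e : S.hyperGrad x y - S.meanGrad c k x y = -(hessXY S.g x y
      ((Ring.inverse (hessYY S.g x y) - neumannSum c.Cgyy (hessYY S.g x y) k)
        (gradY S.f x y))) := by
    simp only [hyperGrad, meanGrad, sub_apply, map_sub]; abel
  have hl := hc.lam_pos
  have h1 : ‖Ring.inverse (hessYY S.g x y) - neumannSum c.Cgyy (hessYY S.g x y) k‖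
      ≤ c.lam⁻¹ * Real.exp (-(k * c.lam / c.Cgyy)) := by
    rw [inverse_sub_neumannSum (h.isUnit_hessYY hc x y)]
    refine (norm_mul_le _ _).trans ?_
    gcongr
    · exact h.norm_inverse_hessYY_le hc x y
    · refine (norm_pow_le_of_norm_le (norm_one_sub_smul_le_exp hc.Cgyy_pos
        (h.sub_hessYY_isPositive x y) (h.hessYY_coercive x y)) k).trans ?_
      rw [← Real.exp_nat_mul]
      apply le_of_eq; congr 1; ring
  rw [e, norm_neg]
  calc _ ≤ c.Cgxy * (c.lam⁻¹ * Real.exp (-(k * c.lam / c.Cgyy)) * c.Cfy) := by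
        refine (ContinuousLinearMap.le_opNorm _ _).trans ?_
        refine mul_le_mul (h.norm_hessXY_le hc x y) ?_ (norm_nonneg _) hc.Cgxy_nonneg
        refine (ContinuousLinearMap.le_opNorm _ _).trans ?_
        exact mul_le_mul h1 (h.norm_gradY_f_le hc x y) (norm_nonneg _) (by positivity)
    _ = _ := by field_simp

/-- A truncation at `k ~ log (1 / ε)` terms makes the squared bias at most `ε² / 64`. -/
theorem sq_norm_hyperGrad_sub_meanGrad_le [IsProbabilityMeasure P] (h : S.Assumptions P c)
    (hc : c.Valid) {k : ℕ} {ε : ℝ} (hε : 0 < ε)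
    (hk : c.Cgyy / (2 * c.lam) *
      Real.log (64 * c.Cgxy ^ 2 * c.Cfy ^ 2 / (c.lam ^ 2 * ε ^ 2)) ≤ k)
    (x : Vec d) (y : Vec d') :
    ‖S.hyperGrad x y - S.meanGrad c k x y‖ ^ 2 ≤ ε ^ 2 / 64 := by
  have hl := hc.lam_pos
  have hC := hc.Cgyy_pos
  have h1 : ‖S.hyperGrad x y - S.meanGrad c k x y‖ ^ 2
      ≤ (c.Cgxy * c.Cfy / c.lam * Real.exp (-(k * c.lam / c.Cgyy))) ^ 2 := by
    gcongr; exact h.norm_hyperGrad_sub_meanGrad_le hc k x y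
  refine h1.trans ?_
  set M := c.Cgxy * c.Cfy / c.lam with hM
  have hM0 : 0 ≤ M := div_nonneg (mul_nonneg hc.Cgxy_nonneg hc.Cfy_nonneg) hl.le
  -- for `M = 0` the logarithm in `hk` has a junk value, but there is no bias
  rcases hM0.eq_or_lt with h0 | h0
  · rw [← h0, zero_mul, zero_pow two_ne_zero]; positivity
  have e : 64 * c.Cgxy ^ 2 * c.Cfy ^ 2 / (c.lam ^ 2 * ε ^ 2) = 64 * M ^ 2 / ε ^ 2 := by
    rw [hM]; field_simp
  rw [e] at hk
  have h2 : Real.log (64 * M ^ 2 / ε ^ 2) ≤ 2 * (k * c.lam / c.Cgyy) := by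
    rw [div_mul_eq_mul_div, div_le_iff₀ (by positivity)] at hk
    rw [← mul_div_assoc, le_div_iff₀ hC]
    linarith
  have h3 := (Real.log_le_iff_le_exp (by positivity : 0 < 64 * M ^ 2 / ε ^ 2)).1 h2
  rw [div_le_iff₀ (by positivity)] at h3
  rw [mul_pow, ← Real.exp_nat_mul]
  have h4 : Real.exp (2 * (k * c.lam / c.Cgyy)) *
      Real.exp ((2 : ℕ) * -(k * c.lam / c.Cgyy)) = 1 := by
    rw [← Real.exp_add]; simp
  have h5 := mul_le_mul_of_nonneg_right h3
    (Real.exp_pos ((2 : ℕ) * -(k * c.lam / c.Cgyy))).le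
  have h6 : Real.exp (2 * (k * c.lam / c.Cgyy)) * ε ^ 2 *
      Real.exp ((2 : ℕ) * -(k * c.lam / c.Cgyy)) = ε ^ 2 := by
    rw [mul_right_comm, h4, one_mul]
  linarith

end Assumptions

end BilevelProblem

/-! ### Independence of the samples -/

namespace SMBRun

variable {d d' : ℕ} {Ξ : Type u} {Ω : Type v} [MeasurableSpace Ξ]

/-- The σ-algebra generated by the samples and random lengths with index in `I`. -/
@[reducible]
def sigma (R : SMBRun d d' Ξ Ω) (I : Set (OracleCall ⊕ ℕ)) : MeasurableSpace Ω :=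
  ⨆ i ∈ I, Sum.elim (fun a : OracleCall => MeasurableSpace.comap (R.smp a) inferInstance)
    (fun r : ℕ => MeasurableSpace.comap (R.p r) inferInstance) i

variable {R : SMBRun d d' Ξ Ω}

theorem measurable_smp_sigma {I : Set (OracleCall ⊕ ℕ)} {a : OracleCall} (ha : Sum.inl a ∈ I) :
    Measurable[R.sigma I] (R.smp a) := by
  refine (comap_measurable (R.smp a)).mono ?_ le_rfl
  exact le_iSup₂_of_le (Sum.inl a) ha le_rfl

theorem measurable_p_sigma {I : Set (OracleCall ⊕ ℕ)} {r : ℕ} (hr : Sum.inr r ∈ I) :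
    Measurable[R.sigma I] (R.p r) := by
  refine (comap_measurable (R.p r)).mono ?_ le_rfl
  exact le_iSup₂_of_le (Sum.inr r) hr le_rfl

variable [MeasurableSpace Ω] {P : Measure Ξ} {μ : Measure Ω}

theorem IsRandom.sigma_le (hR : R.IsRandom P μ) (I : Set (OracleCall ⊕ ℕ)) :
    R.sigma I ≤ ‹MeasurableSpace Ω› := by
  refine iSup₂_le fun i _ => ?_
  rcases i with a | r
  · exact (hR.measurable_smp a).comap_le
  · exact (hR.measurable_p r).comap_le

theorem IsRandom.indep_sigma (hR : R.IsRandom P μ) {I J : Set (OracleCall ⊕ ℕ)}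
    (hIJ : Disjoint I J) : Indep (R.sigma I) (R.sigma J) μ := by
  refine indep_iSup_of_disjoint (fun i => ?_) hR.indep hIJ
  rcases i with a | r
  · exact (hR.measurable_smp a).comap_le
  · exact (hR.measurable_p r).comap_le

theorem IsRandom.indepFun (hR : R.IsRandom P μ) {I J : Set (OracleCall ⊕ ℕ)}
    (hIJ : Disjoint I J) {α β : Type*} [MeasurableSpace α] [MeasurableSpace β] {X : Ω → α}
    {Y : Ω → β} (hX : Measurable[R.sigma I] X) (hY : Measurable[R.sigma J] Y) :
    IndepFun X Y μ := by
  rw [IndepFun_iff_Indep]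
  exact indep_of_indep_of_le_left (indep_of_indep_of_le_right (hR.indep_sigma hIJ) hY.comap_le)
    hX.comap_le

theorem IsRandom.measurePreserving (hR : R.IsRandom P μ) (a : OracleCall) :
    MeasurePreserving (R.smp a) μ P := ⟨hR.measurable_smp a, hR.law_smp a⟩

theorem IsRandom.ae_p_lt [IsProbabilityMeasure μ] (hR : R.IsRandom P μ) (r : ℕ)
    (hk : 1 ≤ roundK R.k r) : ∀ᵐ ω ∂μ, R.p r ω < roundK R.k r := by
  set k := roundK R.k r with hkdef
  have hm : ∀ j, MeasurableSet {ω | R.p r ω = j} := fun j =>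
    hR.measurable_p r (measurableSet_singleton j)
  have hU : {ω | R.p r ω < k} = ⋃ j ∈ Finset.range k, {ω | R.p r ω = j} := by
    ext ω; simp
  have h1 : μ {ω | R.p r ω < k} = 1 := by
    rw [hU, measure_biUnion_finset (fun i _ j _ hij => ?_) (fun j _ => hm j)]
    · rw [Finset.sum_congr rfl fun j hj => hR.uniform_p r j (Finset.mem_range.1 hj)]
      rw [Finset.sum_const, Finset.card_range, nsmul_eq_mul]
      exact ENNReal.mul_inv_cancel (by exact_mod_cast (by omega : k ≠ 0)) (by simp)
    · rw [Function.onFun, Set.disjoint_left]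
      intro ω h1 h2
      exact hij (h1.symm.trans h2)
  exact (prob_compl_eq_zero_iff
    (by rw [hU]; exact Finset.measurableSet_biUnion _ fun j _ => hm j)).2 h1

end SMBRun

namespace IsUnbiasedOracle

variable {d d' : ℕ} {Ξ : Type u} {Ω : Type v} [MeasurableSpace Ξ] [MeasurableSpace Ω]
  {V : Type*} [NormedAddCommGroup V] [NormedSpace ℝ V] [MeasurableSpace V]
  {P : Measure Ξ} {μ : Measure Ω} {O : Vec d → Vec d' → Ξ → V} {G : Vec d → Vec d' → V}
  {sigma : ℝ} {φ : Ω → Ξ}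

theorem measurable_comp (h : IsUnbiasedOracle P O G sigma) {α : Type*} [MeasurableSpace α]
    {X : α → Vec d} {Y : α → Vec d'} {s : α → Ξ} (hX : Measurable X) (hY : Measurable Y)
    (hs : Measurable s) : Measurable fun a => O (X a) (Y a) (s a) :=
  h.measurable.comp (hX.prodMk (hY.prodMk hs))

theorem measurable_apply (h : IsUnbiasedOracle P O G sigma) (x : Vec d) (y : Vec d') :
    Measurable (O x y) :=
  h.measurable_comp measurable_const measurable_const measurable_id

theorem memLp_comp (h : IsUnbiasedOracle P O G sigma) (hφ : MeasurePreserving φ μ P) (x : Vec d)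
    (y : Vec d') : MemLp (fun ω => O x y (φ ω)) 2 μ :=
  (h.memLp x y).comp_measurePreserving hφ

theorem integral_comp (h : IsUnbiasedOracle P O G sigma) (hφ : MeasurePreserving φ μ P) (x : Vec d)
    (y : Vec d') : ∫ ω, O x y (φ ω) ∂μ = G x y := by
  rw [← h.mean x y, ← hφ.map_eq, integral_map hφ.measurable.aemeasurable]
  rw [hφ.map_eq]
  exact (h.memLp x y).1

theorem integrable_sq_comp [IsFiniteMeasure μ] (h : IsUnbiasedOracle P O G sigma)
    (hφ : MeasurePreserving φ μ P) (x : Vec d) (y : Vec d') :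
    Integrable (fun ω => ‖O x y (φ ω) - G x y‖ ^ 2) μ :=
  ((h.memLp_comp hφ x y).sub (memLp_const _)).norm.integrable_sq

theorem integral_sq_comp_le [IsFiniteMeasure P] (h : IsUnbiasedOracle P O G sigma)
    (hφ : MeasurePreserving φ μ P) (x : Vec d) (y : Vec d') :
    ∫ ω, ‖O x y (φ ω) - G x y‖ ^ 2 ∂μ ≤ sigma ^ 2 := by
  refine le_trans (le_of_eq ?_) (h.variance x y)
  rw [← hφ.map_eq]
  refine (integral_map (f := fun s => ‖O x y s - G x y‖ ^ 2) hφ.measurable.aemeasurable ?_).symm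
  rw [hφ.map_eq]
  exact (((h.memLp x y).sub (memLp_const _)).norm.integrable_sq).1

end IsUnbiasedOracle

/-! ### Mean and variance of the stochastic hypergradient -/

theorem ProbabilityTheory.IndepFun.integral_clm_mul {Ω E : Type*} [MeasurableSpace Ω]
    {μ : Measure Ω} [NormedAddCommGroup E] [NormedSpace ℝ E] [CompleteSpace E]
    {X Y : Ω → E →L[ℝ] E} (hXY : IndepFun X Y μ) (hX : Integrable X μ) (hY : Integrable Y μ) :
    ∫ ω, X ω * Y ω ∂μ = (∫ ω, X ω ∂μ) * ∫ ω, Y ω ∂μ :=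
  hXY.integral_bilin hX hY (ContinuousLinearMap.compL ℝ E E E)

theorem ProbabilityTheory.IndepFun.integral_clm_apply {Ω E F : Type*} [MeasurableSpace Ω]
    {μ : Measure Ω} [NormedAddCommGroup E] [NormedSpace ℝ E] [CompleteSpace E]
    [MeasurableSpace E] [BorelSpace E] [NormedAddCommGroup F] [NormedSpace ℝ F] [CompleteSpace F]
    {X : Ω → E →L[ℝ] F} {Y : Ω → E} (hXY : IndepFun X Y μ) (hX : Integrable X μ)
    (hY : Integrable Y μ) :
    Integrable (fun ω => X ω (Y ω)) μ ∧ ∫ ω, X ω (Y ω) ∂μ = (∫ ω, X ω ∂μ) (∫ ω, Y ω ∂μ) :=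
  ⟨hXY.integrable_bilin hX hY (ContinuousLinearMap.id ℝ (E →L[ℝ] F)),
    hXY.integral_bilin hX hY (ContinuousLinearMap.id ℝ (E →L[ℝ] F))⟩

namespace BilevelProblem

variable {d d' : ℕ} {Ξ : Type u} {Ω : Type v}

/-- The factor `I - 𝒪_{gyy,i}(x, y) / C_{gyy}` of the Neumann-series estimator. -/
def neumannFactor (S : BilevelProblem d d' Ξ) (c : BilevelConst) (R : SMBRun d d' Ξ Ω) (r : ℕ)
    (x : Vec d) (y : Vec d') (i : ℕ) (ω : Ω) : Vec d' →L[ℝ] Vec d' :=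
  1 - c.Cgyy⁻¹ • S.Ogyy x y (R.smp (.gyy r i) ω)

/-- The product of the first `j` factors of the Neumann-series estimator. -/
def neumannProd (S : BilevelProblem d d' Ξ) (c : BilevelConst) (R : SMBRun d d' Ξ Ω) (r : ℕ)
    (x : Vec d) (y : Vec d') (j : ℕ) (ω : Ω) : Vec d' →L[ℝ] Vec d' :=
  ((List.range j).map fun i => S.neumannFactor c R r x y i ω).prod

section

variable (S : BilevelProblem d d' Ξ) (c : BilevelConst) (R : SMBRun d d' Ξ Ω) (r : ℕ)

theorem neumannProd_zero (x : Vec d) (y : Vec d') (ω : Ω) : S.neumannProd c R r x y 0 ω = 1 := rfl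

theorem neumannProd_succ (x : Vec d) (y : Vec d') (j : ℕ) (ω : Ω) :
    S.neumannProd c R r x y (j + 1) ω
      = S.neumannProd c R r x y j ω * S.neumannFactor c R r x y j ω := by
  simp [neumannProd, List.range_succ]

theorem hEst_eq (x : Vec d) (y : Vec d') (ω : Ω) :
    S.hEst c R ω r x y = ((roundK R.k r : ℝ) / c.Cgyy) • S.neumannProd c R r x y (R.p r ω) ω := by
  simp only [hEst, neumannProd, neumannFactor]

end

namespace Assumptions

variable [MeasurableSpace Ξ] {S : BilevelProblem d d' Ξ} {P : Measure Ξ} {c : BilevelConst}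
  {R : SMBRun d d' Ξ Ω} {r : ℕ}

/-! Joint measurability in the point and in the randomness. The randomness enters through an
auxiliary map `θ` into `Ω`, so that one statement covers all σ-algebras on `Ω` and also products
with `Ω`. -/

section Measurability

variable {α : Type*} [MeasurableSpace α] {X : α → Vec d} {Y : α → Vec d'} {θ : α → Ω}

theorem measurable_one_sub_smul {n : ℕ} (a : ℝ) :
    Measurable fun T : Vec n →L[ℝ] Vec n => (1 : Vec n →L[ℝ] Vec n) - a • T :=
  Continuous.measurable (by fun_prop)

theorem measurable_smul_clm {n : ℕ} (a : ℝ) :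
    Measurable fun T : Vec n →L[ℝ] Vec n => a • T :=
  Continuous.measurable (by fun_prop)

theorem measurable_neumannProd (h : S.Assumptions P c) (hX : Measurable X) (hY : Measurable Y)
    (j : ℕ) (hs : ∀ i < j, Measurable fun a => R.smp (.gyy r i) (θ a)) :
    Measurable fun a => S.neumannProd c R r (X a) (Y a) j (θ a) := by
  induction j with
  | zero => simp only [neumannProd_zero]; exact measurable_const
  | succ j ih =>
    simp only [neumannProd_succ]
    refine (continuous_mul.measurable).comp ((ih fun i hi => hs i (by omega)).prodMk ?_)
    exact (measurable_one_sub_smul c.Cgyy⁻¹).comp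
      (h.oracle_gyy.measurable_comp hX hY (hs j (by omega)))

theorem measurable_neumannProd_random (h : S.Assumptions P c) (hX : Measurable X)
    (hY : Measurable Y) (hs : ∀ i, Measurable fun a => R.smp (.gyy r i) (θ a))
    (hp : Measurable fun a => R.p r (θ a)) :
    Measurable fun a => S.neumannProd c R r (X a) (Y a) (R.p r (θ a)) (θ a) := by
  have h1 : Measurable fun q : ℕ × α => S.neumannProd c R r (X q.2) (Y q.2) q.1 (θ q.2) := by
    apply measurable_from_prod_countable_right
    intro j
    exact h.measurable_neumannProd hX hY j fun i _ => hs i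
  have h2 := h1.comp (hp.prodMk measurable_id)
  exact h2

theorem measurable_hEst (h : S.Assumptions P c) (hX : Measurable X) (hY : Measurable Y)
    (hs : ∀ i, Measurable fun a => R.smp (.gyy r i) (θ a))
    (hp : Measurable fun a => R.p r (θ a)) :
    Measurable fun a => S.hEst c R (θ a) r (X a) (Y a) := by
  have h1 := h.measurable_neumannProd_random hX hY hs hp
  simp only [hEst_eq]
  exact (measurable_smul_clm _).comp h1

theorem measurable_clm_apply {n m : ℕ} {A : α → Vec n →L[ℝ] Vec m} {b : α → Vec n}
    (hA : Measurable A) (hb : Measurable b) : Measurable fun a => A a (b a) :=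
  (isBoundedBilinearMap_apply (𝕜 := ℝ) (E := Vec n) (F := Vec m)).continuous.measurable.comp
    (hA.prodMk hb)

theorem measurable_gradEst (h : S.Assumptions P c) (hX : Measurable X) (hY : Measurable Y)
    (hfx : Measurable fun a => R.smp (.fx r) (θ a)) (hfy : Measurable fun a => R.smp (.fy r) (θ a))
    (hgxy : Measurable fun a => R.smp (.gxy r) (θ a))
    (hs : ∀ i, Measurable fun a => R.smp (.gyy r i) (θ a))
    (hp : Measurable fun a => R.p r (θ a)) :
    Measurable fun a => S.gradEst c R (θ a) r (X a) (Y a) := by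
  refine (h.oracle_fx.measurable_comp hX hY hfx).sub ?_
  refine measurable_clm_apply (h.oracle_gxy.measurable_comp hX hY hgxy) ?_
  exact measurable_clm_apply (h.measurable_hEst hX hY hs hp)
    (h.oracle_fy.measurable_comp hX hY hfy)

theorem measurable_neumannProd_sigma (h : S.Assumptions P c) {I : Set (OracleCall ⊕ ℕ)} (j : ℕ)
    (hI : ∀ i < j, Sum.inl (.gyy r i) ∈ I) (x : Vec d) (y : Vec d') :
    Measurable[R.sigma I] (S.neumannProd c R r x y j) := by
  let _ : MeasurableSpace Ω := R.sigma I
  exact h.measurable_neumannProd (θ := id) measurable_const measurable_const j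
    fun i hi => SMBRun.measurable_smp_sigma (hI i hi)

theorem measurable_neumannFactor_sigma (h : S.Assumptions P c) {I : Set (OracleCall ⊕ ℕ)} {i : ℕ}
    (hI : Sum.inl (.gyy r i) ∈ I) (x : Vec d) (y : Vec d') :
    Measurable[R.sigma I] (S.neumannFactor c R r x y i) :=
  (measurable_one_sub_smul c.Cgyy⁻¹).comp
    ((h.oracle_gyy.measurable_apply x y).comp (SMBRun.measurable_smp_sigma hI))

theorem measurable_hEst_sigma (h : S.Assumptions P c) {I : Set (OracleCall ⊕ ℕ)}
    (hI : ∀ i, Sum.inl (.gyy r i) ∈ I) (hI' : Sum.inr r ∈ I) (x : Vec d) (y : Vec d') :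
    Measurable[R.sigma I] fun ω => S.hEst c R ω r x y := by
  let _ : MeasurableSpace Ω := R.sigma I
  exact h.measurable_hEst (θ := id) measurable_const measurable_const
    (fun i => SMBRun.measurable_smp_sigma (hI i)) (SMBRun.measurable_p_sigma hI')

end Measurability

variable [MeasurableSpace Ω] {μ : Measure Ω}

theorem ae_norm_neumannFactor_le (h : S.Assumptions P c) (hc : c.Valid) (hR : R.IsRandom P μ)
    (x : Vec d) (y : Vec d') : ∀ᵐ ω ∂μ, ∀ i, ‖S.neumannFactor c R r x y i ω‖ ≤ 1 := by
  rw [ae_all_iff]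
  intro i
  filter_upwards [(hR.measurePreserving (.gyy r i)).quasiMeasurePreserving.ae
    (h.oracle_gyy_bdd x y)] with ω hω
  exact norm_one_sub_smul_le_one hc.Cgyy_pos hω.1 hω.2

theorem ae_norm_neumannProd_le (h : S.Assumptions P c) (hc : c.Valid) (hR : R.IsRandom P μ)
    (x : Vec d) (y : Vec d') : ∀ᵐ ω ∂μ, ∀ j, ‖S.neumannProd c R r x y j ω‖ ≤ 1 := by
  filter_upwards [h.ae_norm_neumannFactor_le hc hR (r := r) x y] with ω hω j
  induction j with
  | zero => exact ContinuousLinearMap.norm_id_le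
  | succ j ih =>
    rw [neumannProd_succ]
    exact (norm_mul_le _ _).trans (mul_le_one₀ ih (norm_nonneg _) (hω j))

theorem ae_norm_hEst_le (h : S.Assumptions P c) (hc : c.Valid) (hR : R.IsRandom P μ)
    (x : Vec d) (y : Vec d') :
    ∀ᵐ ω ∂μ, ‖S.hEst c R ω r x y‖ ≤ (roundK R.k r : ℝ) / c.Cgyy := by
  have hC := hc.Cgyy_pos
  filter_upwards [h.ae_norm_neumannProd_le hc hR (r := r) x y] with ω hω
  rw [hEst_eq, norm_smul, Real.norm_eq_abs, abs_of_nonneg (by positivity)]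
  exact mul_le_of_le_one_right (by positivity) (hω _)

variable [IsProbabilityMeasure μ]

theorem integrable_smul_gyy (h : S.Assumptions P c) (hR : R.IsRandom P μ) (a : ℝ)
    (x : Vec d) (y : Vec d') (i : ℕ) :
    Integrable (fun ω => a • S.Ogyy x y (R.smp (.gyy r i) ω)) μ :=
  ((h.oracle_gyy.memLp_comp (hR.measurePreserving (.gyy r i)) x y).integrable
    (by norm_num)).smul a

theorem integrable_neumannProd (h : S.Assumptions P c) (hc : c.Valid) (hR : R.IsRandom P μ)
    (x : Vec d) (y : Vec d') (j : ℕ) : Integrable (S.neumannProd c R r x y j) μ := by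
  refine Integrable.of_bound (C := 1) ?_ ?_
  · exact (h.measurable_neumannProd (θ := id) measurable_const measurable_const j
      (fun i _ => hR.measurable_smp (.gyy r i))).aestronglyMeasurable
  · filter_upwards [h.ae_norm_neumannProd_le hc hR (r := r) x y] with ω hω using hω j

theorem integrable_neumannFactor (h : S.Assumptions P c) (hR : R.IsRandom P μ)
    (x : Vec d) (y : Vec d') (j : ℕ) : Integrable (S.neumannFactor c R r x y j) μ :=
  (integrable_const _).sub (h.integrable_smul_gyy hR _ x y j)

theorem integral_neumannFactor (h : S.Assumptions P c) (hR : R.IsRandom P μ)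
    (x : Vec d) (y : Vec d') (i : ℕ) :
    ∫ ω, S.neumannFactor c R r x y i ω ∂μ = 1 - c.Cgyy⁻¹ • hessYY S.g x y := by
  simp only [neumannFactor]
  rw [integral_sub (integrable_const _) (h.integrable_smul_gyy hR _ x y i), integral_smul,
    h.oracle_gyy.integral_comp (hR.measurePreserving (.gyy r i))]
  simp

/-- By independence, the mean of the product is the product of the means. -/
theorem integral_neumannProd (h : S.Assumptions P c) (hc : c.Valid) (hR : R.IsRandom P μ)
    (x : Vec d) (y : Vec d') (j : ℕ) :
    ∫ ω, S.neumannProd c R r x y j ω ∂μ = (1 - c.Cgyy⁻¹ • hessYY S.g x y) ^ j := by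
  induction j with
  | zero => simp [neumannProd_zero]
  | succ j ih =>
    have hind : IndepFun (S.neumannProd c R r x y j) (S.neumannFactor c R r x y j) μ := by
      refine hR.indepFun (I := {a | ∃ i < j, a = Sum.inl (.gyy r i)})
        (J := {Sum.inl (.gyy r j)}) ?_ ?_ ?_
      · rw [Set.disjoint_singleton_right]
        rintro ⟨i, hi, h'⟩
        simp only [Sum.inl.injEq, OracleCall.gyy.injEq, true_and] at h'
        omega
      · exact h.measurable_neumannProd_sigma (I := {a | ∃ i < j, a = Sum.inl (.gyy r i)}) j
          (fun i hi => ⟨i, hi, rfl⟩) x y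
      · exact h.measurable_neumannFactor_sigma (Set.mem_singleton _) x y
    simp only [neumannProd_succ]
    rw [hind.integral_clm_mul (h.integrable_neumannProd hc hR x y j)
      (h.integrable_neumannFactor hR x y j), ih, h.integral_neumannFactor hR, pow_succ]

/-- The length `p` of the product is uniform on `{0, …, k - 1}` and independent of the factors, so
the mean of the estimator is the average of the means of the products of fixed length, times
`k / C_{gyy}`: the truncated Neumann series. -/
theorem integral_hEst (h : S.Assumptions P c) (hc : c.Valid) (hR : R.IsRandom P μ)
    (hk : 1 ≤ roundK R.k r) (x : Vec d) (y : Vec d') :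
    ∫ ω, S.hEst c R ω r x y ∂μ = neumannSum c.Cgyy (hessYY S.g x y) (roundK R.k r) := by
  set k := roundK R.k r with hkdef
  have hmj : ∀ j, MeasurableSet {ω | R.p r ω = j} := fun j =>
    hR.measurable_p r (measurableSet_singleton j)
  let e : ℕ → Ω → ℝ := fun j => Set.indicator {ω | R.p r ω = j} fun _ => 1
  have he : (fun ω => S.hEst c R ω r x y) =ᵐ[μ] fun ω =>
      ((k : ℝ) / c.Cgyy) • ∑ j ∈ Finset.range k, e j ω • S.neumannProd c R r x y j ω := by
    filter_upwards [hR.ae_p_lt r hk] with ω hω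
    rw [hEst_eq, Finset.sum_eq_single (R.p r ω)]
    · simp [e, hkdef]
    · intro j _ hj
      simp only [e, Set.indicator_of_notMem (show ω ∉ {ω | R.p r ω = j} from Ne.symm hj)]
      exact zero_smul ℝ (S.neumannProd c R r x y j ω)
    · intro hj
      exact absurd (Finset.mem_range.2 hω) hj
  have hme : ∀ j, Measurable (e j) := fun j => measurable_const.indicator (hmj j)
  have hint : ∀ j, Integrable (fun ω => e j ω • S.neumannProd c R r x y j ω) μ := by
    intro j
    refine (h.integrable_neumannProd hc hR x y j).bdd_smul 1
      (hme j).aestronglyMeasurable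
      (Filter.Eventually.of_forall fun ω => ?_)
    by_cases hω : R.p r ω = j <;> simp [e, hω]
  have hj : ∀ j ∈ Finset.range k, ∫ ω, e j ω • S.neumannProd c R r x y j ω ∂μ
      = (k : ℝ)⁻¹ • (1 - c.Cgyy⁻¹ • hessYY S.g x y) ^ j := by
    intro j hj
    have hind : IndepFun (e j) (S.neumannProd c R r x y j) μ := by
      refine hR.indepFun (I := {Sum.inr r}) (J := {a | ∃ i, a = Sum.inl (.gyy r i)}) ?_ ?_ ?_
      · rw [Set.disjoint_singleton_left]
        rintro ⟨i, h'⟩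
        cases h'
      · exact (measurable_const.indicator (measurableSet_singleton j)).comp
          (SMBRun.measurable_p_sigma (R := R) (I := {Sum.inr r}) (r := r) rfl)
      · exact h.measurable_neumannProd_sigma (I := {a | ∃ i, a = Sum.inl (.gyy r i)}) j
          (fun i _ => ⟨i, rfl⟩) x y
    rw [hind.integral_fun_smul_eq_smul_integral
      (hme j).aestronglyMeasurable
      (h.integrable_neumannProd hc hR x y j).1, h.integral_neumannProd hc hR]
    congr 1
    rw [integral_indicator_const _ (hmj j), Measure.real,
      hR.uniform_p r j (Finset.mem_range.1 hj)]
    simp [hkdef]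
  rw [integral_congr_ae he, integral_smul, integral_finsetSum _ fun j _ => hint j,
    Finset.sum_congr rfl hj, ← Finset.smul_sum, smul_smul, neumannSum]
  congr 1
  have : (k : ℝ) ≠ 0 := by exact_mod_cast (by omega : k ≠ 0)
  field_simp

end Assumptions

end BilevelProblem

/-- The bias-variance decomposition. -/
theorem integral_sq_norm_add_sub_mean {Ω E : Type*} [MeasurableSpace Ω] {μ : Measure Ω}
    [IsProbabilityMeasure μ] [NormedAddCommGroup E] [InnerProductSpace ℝ E] [CompleteSpace E]
    {X : Ω → E} (hX : MemLp X 2 μ) (u : E) :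
    Integrable (fun ω => ‖u + (X ω - ∫ ω', X ω' ∂μ)‖ ^ 2) μ ∧
    ∫ ω, ‖u + (X ω - ∫ ω', X ω' ∂μ)‖ ^ 2 ∂μ
      = ‖u‖ ^ 2 + ∫ ω, ‖X ω - ∫ ω', X ω' ∂μ‖ ^ 2 ∂μ := by
  set m := ∫ ω', X ω' ∂μ with hm
  have hXi : Integrable X μ := hX.integrable (by norm_num)
  have h0 : MemLp (fun ω => X ω - m) 2 μ := hX.sub (memLp_const m)
  have h1 : Integrable (fun ω => X ω - m) μ := h0.integrable (by norm_num)
  have h2 : ∫ ω, (X ω - m) ∂μ = 0 := by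
    rw [integral_sub hXi (integrable_const _)]; simp [hm]
  have h3 : Integrable (fun ω => ‖X ω - m‖ ^ 2) μ := h0.norm.integrable_sq
  have h4 : Integrable (fun ω => inner ℝ u (X ω - m)) μ := h1.const_inner u
  have e : (fun ω => ‖u + (X ω - m)‖ ^ 2)
      = fun ω => (‖u‖ ^ 2 + 2 * inner ℝ u (X ω - m)) + ‖X ω - m‖ ^ 2 := by
    ext1 ω; exact norm_add_sq_real _ _
  rw [e]
  have h5 : Integrable (fun ω => ‖u‖ ^ 2 + 2 * inner ℝ u (X ω - m)) μ :=
    (integrable_const _).add (h4.const_mul 2)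
  refine ⟨h5.add h3, ?_⟩
  rw [integral_add h5 h3, integral_add (integrable_const _) (h4.const_mul 2), integral_const_mul,
    integral_inner h1, h2]
  simp

/-- Conditioning on `X` for a function of two independent variables `X` and `W`, as an
inequality: a bound `ψ(a)` on the mean of `φ(a, W)` gives `E φ(X, W) ≤ E ψ(X)`. -/
theorem integral_le_of_indepFun {Ω α β : Type*} [MeasurableSpace Ω] {μ : Measure Ω}
    [IsProbabilityMeasure μ] [MeasurableSpace α] [MeasurableSpace β] {X : Ω → α} {W : Ω → β}
    (hX : Measurable X) (hW : Measurable W) (hXW : IndepFun X W μ) {φ : α × β → ℝ}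
    (hφ : Measurable φ) (h0 : ∀ q, 0 ≤ φ q) {ψ : α → ℝ} (hψ : Integrable (fun ω => ψ (X ω)) μ)
    (hφi : ∀ a, Integrable (fun ω => φ (a, W ω)) μ) (hle : ∀ a, ∫ ω, φ (a, W ω) ∂μ ≤ ψ a) :
    Integrable (fun ω => φ (X ω, W ω)) μ ∧ ∫ ω, φ (X ω, W ω) ∂μ ≤ ∫ ω, ψ (X ω) ∂μ := by
  have hψ0 : ∀ a, 0 ≤ ψ a := fun a => (integral_nonneg fun ω => h0 _).trans (hle a)
  have hm : Measurable fun ω => φ (X ω, W ω) := hφ.comp (hX.prodMk hW)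
  have key : ∫⁻ ω, ENNReal.ofReal (φ (X ω, W ω)) ∂μ ≤ ENNReal.ofReal (∫ ω, ψ (X ω) ∂μ) := by
    have h1 : ∫⁻ ω, ENNReal.ofReal (φ (X ω, W ω)) ∂μ
        = ∫⁻ q, ENNReal.ofReal (φ q) ∂(μ.map fun ω => (X ω, W ω)) :=
      (lintegral_map hφ.ennreal_ofReal (hX.prodMk hW)).symm
    rw [h1, (indepFun_iff_map_prod_eq_prod_map_map hX.aemeasurable hW.aemeasurable).1 hXW,
      lintegral_prod _ hφ.ennreal_ofReal.aemeasurable,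
      lintegral_map hφ.ennreal_ofReal.lintegral_prod_right' hX,
      ofReal_integral_eq_lintegral_ofReal hψ (Filter.Eventually.of_forall fun ω => hψ0 _)]
    refine lintegral_mono fun ω => ?_
    have h2 : Measurable fun w => ENNReal.ofReal (φ (X ω, w)) :=
      hφ.ennreal_ofReal.comp measurable_prodMk_left
    rw [lintegral_map h2 hW,
      ← ofReal_integral_eq_lintegral_ofReal (hφi _) (Filter.Eventually.of_forall fun ω => h0 _)]
    exact ENNReal.ofReal_le_ofReal (hle _)
  have hint : Integrable (fun ω => φ (X ω, W ω)) μ := by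
    refine ⟨hm.aestronglyMeasurable, ?_⟩
    rw [hasFiniteIntegral_iff_ofReal (Filter.Eventually.of_forall fun ω => h0 _)]
    exact key.trans_lt ENNReal.ofReal_lt_top
  refine ⟨hint, ?_⟩
  rw [← ENNReal.ofReal_le_ofReal_iff (integral_nonneg fun ω => hψ0 _),
    ofReal_integral_eq_lintegral_ofReal hint (Filter.Eventually.of_forall fun ω => h0 _)]
  exact key

namespace BilevelProblem.Assumptions

variable {d d' : ℕ} {Ξ : Type u} {Ω : Type v} [MeasurableSpace Ξ] {S : BilevelProblem d d' Ξ}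
  {P : Measure Ξ} {c : BilevelConst} {R : SMBRun d d' Ξ Ω} {r : ℕ} [MeasurableSpace Ω]
  {μ : Measure Ω}

theorem measurable_gradEst_run (h : S.Assumptions P c) (hR : R.IsRandom P μ) (x : Vec d)
    (y : Vec d') : Measurable fun ω => S.gradEst c R ω r x y :=
  h.measurable_gradEst (θ := id) measurable_const measurable_const (hR.measurable_smp _)
    (hR.measurable_smp _) (hR.measurable_smp _) (fun _ => hR.measurable_smp _) (hR.measurable_p _)

variable [IsProbabilityMeasure μ]

theorem integrable_hEst (h : S.Assumptions P c) (hc : c.Valid) (hR : R.IsRandom P μ)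
    (x : Vec d) (y : Vec d') : Integrable (fun ω => S.hEst c R ω r x y) μ := by
  refine Integrable.of_bound (C := (roundK R.k r : ℝ) / c.Cgyy) ?_ (h.ae_norm_hEst_le hc hR x y)
  exact (h.measurable_hEst (θ := id) measurable_const measurable_const
      (fun i => hR.measurable_smp (.gyy r i)) (hR.measurable_p r)).aestronglyMeasurable

/-- `𝒪_{gxy}`, `h` and `𝒪_{fy}` are independent, so the mean of their product is the product of the
means. -/
theorem integral_gradEst (h : S.Assumptions P c) (hc : c.Valid) (hR : R.IsRandom P μ)
    (hk : 1 ≤ roundK R.k r) (x : Vec d) (y : Vec d') :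
    ∫ ω, S.gradEst c R ω r x y ∂μ = S.meanGrad c (roundK R.k r) x y := by
  have hb := (h.oracle_fy.memLp_comp (hR.measurePreserving (.fy r)) x y).integrable (by norm_num)
  have hA := (h.oracle_gxy.memLp_comp (hR.measurePreserving (.gxy r)) x y).integrable
    (by norm_num)
  have ha := (h.oracle_fx.memLp_comp (hR.measurePreserving (.fx r)) x y).integrable (by norm_num)
  let I : Set (OracleCall ⊕ ℕ) := {a | (∃ i, a = Sum.inl (.gyy r i)) ∨ a = Sum.inr r}
  let J : Set (OracleCall ⊕ ℕ) := {Sum.inl (.fy r)}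
  let K : Set (OracleCall ⊕ ℕ) := {Sum.inl (.gxy r)}
  have hmb : ∀ {L : Set (OracleCall ⊕ ℕ)}, Sum.inl (.fy r) ∈ L →
      Measurable[R.sigma L] fun ω => S.Ofy x y (R.smp (.fy r) ω) := fun hL =>
    (h.oracle_fy.measurable_apply x y).comp (SMBRun.measurable_smp_sigma hL)
  have hind1 : IndepFun (fun ω => S.hEst c R ω r x y)
      (fun ω => S.Ofy x y (R.smp (.fy r) ω)) μ := by
    refine hR.indepFun (I := I) (J := J) ?_
      (h.measurable_hEst_sigma (fun i => Or.inl ⟨i, rfl⟩) (Or.inr rfl) x y) (hmb rfl)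
    simp [I, J]
  obtain ⟨hi1, he1⟩ := hind1.integral_clm_apply (h.integrable_hEst hc hR x y) hb
  have hind2 : IndepFun (fun ω => S.Ogxy x y (R.smp (.gxy r) ω))
      (fun ω => S.hEst c R ω r x y (S.Ofy x y (R.smp (.fy r) ω))) μ := by
    refine hR.indepFun (I := K) (J := I ∪ J) ?_
      ((h.oracle_gxy.measurable_apply x y).comp (SMBRun.measurable_smp_sigma rfl)) ?_
    · simp [I, J, K]
    · have m1 := h.measurable_hEst_sigma (c := c) (R := R) (r := r) (I := I ∪ J)
        (fun i => Or.inl (Or.inl ⟨i, rfl⟩)) (Or.inl (Or.inr rfl)) x y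
      have m2 := hmb (L := I ∪ J) (Or.inr rfl)
      exact @measurable_clm_apply Ω (R.sigma (I ∪ J)) _ _ _ _ m1 m2
  obtain ⟨hi2, he2⟩ := hind2.integral_clm_apply hA hi1
  simp only [gradEst]
  rw [integral_sub ha hi2, he2, he1, h.oracle_fx.integral_comp (hR.measurePreserving _),
    h.oracle_fy.integral_comp (hR.measurePreserving _),
    h.oracle_gxy.integral_comp (hR.measurePreserving _), h.integral_hEst hc hR hk, meanGrad]

variable [IsProbabilityMeasure P]

theorem integral_sq_norm_Ofy_le (h : S.Assumptions P c) (hR : R.IsRandom P μ)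
    (x : Vec d) (y : Vec d') :
    ∫ ω, ‖S.Ofy x y (R.smp (.fy r) ω)‖ ^ 2 ∂μ ≤ c.Cfy ^ 2 + c.sigma ^ 2 := by
  have hm := hR.measurePreserving (.fy r)
  obtain ⟨-, h2⟩ := integral_sq_norm_add_sub_mean (h.oracle_fy.memLp_comp hm x y) (gradY S.f x y)
  rw [h.oracle_fy.integral_comp hm] at h2
  simp only [add_sub_cancel] at h2
  rw [h2]
  exact add_le_add (h.bdd_fy x y) (h.oracle_fy.integral_sq_comp_le hm x y)

/-- The second moment of the stochastic hypergradient around its mean. The error of the product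
`𝒪_{gxy} h 𝒪_{fy}` is telescoped, one factor at a time. -/
theorem variance_gradEst_le (h : S.Assumptions P c) (hc : c.Valid) (hR : R.IsRandom P μ)
    (x : Vec d) (y : Vec d') :
    Integrable (fun ω => ‖S.gradEst c R ω r x y - S.meanGrad c (roundK R.k r) x y‖ ^ 2) μ ∧
    ∫ ω, ‖S.gradEst c R ω r x y - S.meanGrad c (roundK R.k r) x y‖ ^ 2 ∂μ
      ≤ c.C1 (roundK R.k r) := by
  set k := roundK R.k r with hkdef
  have hC := hc.Cgyy_pos
  let κ : ℝ := (k : ℝ) / c.Cgyy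
  have hκ : 0 ≤ κ := by positivity
  let a : Ω → Vec d := fun ω => S.Ofx x y (R.smp (.fx r) ω)
  let b : Ω → Vec d' := fun ω => S.Ofy x y (R.smp (.fy r) ω)
  let A : Ω → (Vec d' →L[ℝ] Vec d) := fun ω => S.Ogxy x y (R.smp (.gxy r) ω)
  let H : Ω → (Vec d' →L[ℝ] Vec d') := fun ω => S.hEst c R ω r x y
  let a0 := gradX S.f x y
  let b0 := gradY S.f x y
  let A0 := hessXY S.g x y
  let H0 := neumannSum c.Cgyy (hessYY S.g x y) k
  have hA0 : ‖A0‖ ≤ c.Cgxy := h.norm_hessXY_le hc x y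
  have hH0 : ‖H0‖ ≤ κ := h.norm_neumannSum_hessYY_le hc k x y
  have ia : Integrable (fun ω => ‖a ω - a0‖ ^ 2) μ :=
    h.oracle_fx.integrable_sq_comp (hR.measurePreserving _) x y
  have ib : Integrable (fun ω => ‖b ω - b0‖ ^ 2) μ :=
    h.oracle_fy.integrable_sq_comp (hR.measurePreserving _) x y
  have ib' : Integrable (fun ω => ‖b ω‖ ^ 2) μ :=
    (h.oracle_fy.memLp_comp (hR.measurePreserving (.fy r)) x y).norm.integrable_sq
  have iA : Integrable (fun ω => ‖A ω - A0‖ ^ 2) μ :=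
    h.oracle_gxy.integrable_sq_comp (hR.measurePreserving _) x y
  have hind : IndepFun (fun ω => ‖A ω - A0‖ ^ 2) (fun ω => ‖b ω‖ ^ 2) μ := by
    have h0 : IndepFun A b μ := by
      refine hR.indepFun (I := {Sum.inl (.gxy r)}) (J := {Sum.inl (.fy r)}) (by simp)
        ((h.oracle_gxy.measurable_apply x y).comp
          (SMBRun.measurable_smp_sigma (Set.mem_singleton _)))
        ((h.oracle_fy.measurable_apply x y).comp
          (SMBRun.measurable_smp_sigma (Set.mem_singleton _)))
    have m1 : Measurable fun T : Vec d' →L[ℝ] Vec d => ‖T - A0‖ ^ 2 :=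
      Continuous.measurable (by fun_prop)
    have m2 : Measurable fun v : Vec d' => ‖v‖ ^ 2 := Continuous.measurable (by fun_prop)
    exact h0.comp m1 m2
  have iAb : Integrable (fun ω => ‖A ω - A0‖ ^ 2 * ‖b ω‖ ^ 2) μ := hind.integrable_mul iA ib'
  have eAb : ∫ ω, ‖A ω - A0‖ ^ 2 * ‖b ω‖ ^ 2 ∂μ ≤ c.sigma ^ 2 * (c.Cfy ^ 2 + c.sigma ^ 2) := by
    rw [hind.integral_fun_mul_eq_mul_integral iA.1 ib'.1]
    exact mul_le_mul (h.oracle_gxy.integral_sq_comp_le (hR.measurePreserving _) x y)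
      (h.integral_sq_norm_Ofy_le hR x y) (integral_nonneg fun _ => by positivity) (by positivity)
  let B : Ω → ℝ := fun ω => 2 * ‖a ω - a0‖ ^ 2 + 6 * κ ^ 2 * (‖A ω - A0‖ ^ 2 * ‖b ω‖ ^ 2)
    + 24 * κ ^ 2 * c.Cgxy ^ 2 * ‖b ω‖ ^ 2 + 6 * κ ^ 2 * c.Cgxy ^ 2 * ‖b ω - b0‖ ^ 2
  have i1 : Integrable (fun ω => 2 * ‖a ω - a0‖ ^ 2 + 6 * κ ^ 2 * (‖A ω - A0‖ ^ 2 * ‖b ω‖ ^ 2)) μ :=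
    (ia.const_mul _).add (iAb.const_mul _)
  have i2 : Integrable (fun ω => 2 * ‖a ω - a0‖ ^ 2 + 6 * κ ^ 2 * (‖A ω - A0‖ ^ 2 * ‖b ω‖ ^ 2)
      + 24 * κ ^ 2 * c.Cgxy ^ 2 * ‖b ω‖ ^ 2) μ := i1.add (ib'.const_mul _)
  have iB : Integrable B μ := i2.add (ib.const_mul _)
  have hle : ∀ᵐ ω ∂μ, ‖S.gradEst c R ω r x y - S.meanGrad c k x y‖ ^ 2 ≤ B ω := by
    filter_upwards [h.ae_norm_hEst_le hc hR (r := r) x y] with ω hω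
    have hH : ‖H ω‖ ≤ κ := hω
    have e : S.gradEst c R ω r x y - S.meanGrad c k x y = (a ω - a0)
        - ((A ω - A0) (H ω (b ω)) + A0 ((H ω - H0) (b ω)) + A0 (H0 (b ω - b0))) := by
      simp only [gradEst, meanGrad, sub_apply, map_sub, a, A, H, b, a0, A0, H0, b0]
      abel
    have h1 : ‖(A ω - A0) (H ω (b ω))‖ ≤ ‖A ω - A0‖ * (κ * ‖b ω‖) := by
      refine (ContinuousLinearMap.le_opNorm _ _).trans ?_
      gcongr
      exact (ContinuousLinearMap.le_opNorm _ _).trans (by gcongr)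
    have h2 : ‖A0 ((H ω - H0) (b ω))‖ ≤ c.Cgxy * (2 * κ * ‖b ω‖) := by
      refine (ContinuousLinearMap.le_opNorm _ _).trans ?_
      refine mul_le_mul hA0 ?_ (norm_nonneg _) hc.Cgxy_nonneg
      refine (ContinuousLinearMap.le_opNorm _ _).trans ?_
      gcongr
      linarith [norm_sub_le (H ω) H0]
    have h3 : ‖A0 (H0 (b ω - b0))‖ ≤ c.Cgxy * (κ * ‖b ω - b0‖) := by
      refine (ContinuousLinearMap.le_opNorm _ _).trans ?_
      refine mul_le_mul hA0 ?_ (norm_nonneg _) hc.Cgxy_nonneg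
      exact (ContinuousLinearMap.le_opNorm _ _).trans (by gcongr)
    have h1' := pow_le_pow_left₀ (norm_nonneg _) h1 2
    have h2' := pow_le_pow_left₀ (norm_nonneg _) h2 2
    have h3' := pow_le_pow_left₀ (norm_nonneg _) h3 2
    have h4 := norm_add_add_sq_le_three ((A ω - A0) (H ω (b ω))) (A0 ((H ω - H0) (b ω)))
      (A0 (H0 (b ω - b0)))
    have h5 := norm_sub_sq_le_two (a ω - a0)
      ((A ω - A0) (H ω (b ω)) + A0 ((H ω - H0) (b ω)) + A0 (H0 (b ω - b0)))
    rw [e]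
    simp only [B]
    linarith
  have hi : Integrable (fun ω => ‖S.gradEst c R ω r x y - S.meanGrad c k x y‖ ^ 2) μ := by
    refine iB.mono' ?_ (hle.mono fun ω hω => ?_)
    · exact (((h.measurable_gradEst_run hR x y).sub_const _).norm.pow_const 2).aestronglyMeasurable
    · rwa [Real.norm_eq_abs, abs_of_nonneg (by positivity)]
  refine ⟨hi, (integral_mono_ae hi iB hle).trans ?_⟩
  have e1 : ∫ ω, B ω ∂μ = 2 * ∫ ω, ‖a ω - a0‖ ^ 2 ∂μ
      + 6 * κ ^ 2 * ∫ ω, ‖A ω - A0‖ ^ 2 * ‖b ω‖ ^ 2 ∂μ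
      + 24 * κ ^ 2 * c.Cgxy ^ 2 * ∫ ω, ‖b ω‖ ^ 2 ∂μ
      + 6 * κ ^ 2 * c.Cgxy ^ 2 * ∫ ω, ‖b ω - b0‖ ^ 2 ∂μ := by
    simp only [B]
    rw [integral_add i2 (ib.const_mul _), integral_add i1 (ib'.const_mul _),
      integral_add (ia.const_mul _) (iAb.const_mul _)]
    simp only [integral_const_mul]
  have e2 : c.C1 k = 2 * c.sigma ^ 2 + 6 * κ ^ 2 * (c.sigma ^ 2 * (c.Cfy ^ 2 + c.sigma ^ 2))
      + 24 * κ ^ 2 * c.Cgxy ^ 2 * (c.Cfy ^ 2 + c.sigma ^ 2)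
      + 6 * κ ^ 2 * c.Cgxy ^ 2 * c.sigma ^ 2 := by
    simp only [BilevelConst.C1, κ, div_pow]; ring
  rw [e1, e2]
  gcongr
  · exact h.oracle_fx.integral_sq_comp_le (hR.measurePreserving _) x y
  · exact h.integral_sq_norm_Ofy_le hR x y
  · exact h.oracle_fy.integral_sq_comp_le (hR.measurePreserving _) x y

theorem memLp_gradEst (h : S.Assumptions P c) (hc : c.Valid) (hR : R.IsRandom P μ)
    (x : Vec d) (y : Vec d') : MemLp (fun ω => S.gradEst c R ω r x y) 2 μ := by
  have h1 : MemLp (fun ω => S.gradEst c R ω r x y - S.meanGrad c (roundK R.k r) x y) 2 μ := by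
    rw [memLp_two_iff_integrable_sq_norm
      ((h.measurable_gradEst_run hR x y).sub_const _).aestronglyMeasurable]
    exact (h.variance_gradEst_le hc hR x y).1
  have h2 := h1.add (memLp_const (S.meanGrad c (roundK R.k r) x y))
  refine h2.congr_norm (h.measurable_gradEst_run hR x y).aestronglyMeasurable ?_
  exact Filter.Eventually.of_forall fun ω => by simp

theorem integral_sq_norm_add_smul_gradEst_le (h : S.Assumptions P c) (hc : c.Valid)
    (hR : R.IsRandom P μ) (hk : 1 ≤ roundK R.k r) (x : Vec d) (y : Vec d') (γ : ℝ) (v : Vec d) :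
    Integrable (fun ω => ‖v + γ • S.gradEst c R ω r x y‖ ^ 2) μ ∧
    ∫ ω, ‖v + γ • S.gradEst c R ω r x y‖ ^ 2 ∂μ
      ≤ ‖v + γ • S.meanGrad c (roundK R.k r) x y‖ ^ 2 + γ ^ 2 * c.C1 (roundK R.k r) := by
  obtain ⟨h1, h2⟩ := integral_sq_norm_add_sub_mean
    ((h.memLp_gradEst hc hR (r := r) x y).const_smul γ)
    (v + γ • S.meanGrad c (roundK R.k r) x y)
  simp only [Pi.smul_apply] at h1 h2
  rw [integral_smul, h.integral_gradEst hc hR hk] at h1 h2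
  have e : ∀ w : Vec d, v + γ • S.meanGrad c (roundK R.k r) x y
      + (γ • w - γ • S.meanGrad c (roundK R.k r) x y) = v + γ • w := fun w => by abel
  simp only [e] at h1 h2
  refine ⟨h1, h2.le.trans ?_⟩
  simp only [← smul_sub, norm_smul, mul_pow, Real.norm_eq_abs, sq_abs, integral_const_mul]
  gcongr
  exact (h.variance_gradEst_le hc hR x y).2

end BilevelProblem.Assumptions

/-! ### One step of the algorithm -/

/-- The round in which an oracle is called. -/
def OracleCall.round : OracleCall → ℕ
  | fx r => r
  | fy r => r
  | gxy r => r
  | gy r => r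
  | gyy r _ => r

/-- The indices of the randomness used in the rounds that belong to `A`. -/
def roundIndices (A : Set ℕ) : Set (OracleCall ⊕ ℕ) := {i | Sum.elim OracleCall.round id i ∈ A}

theorem disjoint_roundIndices {A B : Set ℕ} (h : Disjoint A B) :
    Disjoint (roundIndices A) (roundIndices B) :=
  Set.disjoint_left.2 fun _ h1 h2 => Set.disjoint_left.1 h h1 h2

section Norm

variable {E : Type*} [NormedAddCommGroup E] [InnerProductSpace ℝ E]

/-- Convexity of `‖·‖²`, at `p` and `γ⁻¹ q` with weights `1 - γ` and `γ`. -/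
theorem sq_norm_convex_add_le {γ : ℝ} (h0 : 0 < γ) (h1 : γ ≤ 1) (p q : E) :
    ‖(1 - γ) • p + q‖ ^ 2 ≤ (1 - γ) * ‖p‖ ^ 2 + γ⁻¹ * ‖q‖ ^ 2 := by
  have h2 : 0 ≤ (1 - γ) * γ⁻¹ * ‖γ • p - q‖ ^ 2 := by
    have := sub_nonneg.2 h1
    positivity
  rw [norm_sub_sq_real, norm_smul, inner_smul_left, mul_pow, Real.norm_eq_abs, sq_abs] at h2
  rw [norm_add_sq_real, norm_smul, inner_smul_left, mul_pow, Real.norm_eq_abs, sq_abs]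
  simp only [conj_trivial] at h2 ⊢
  have e : (1 - γ) * γ⁻¹ * (γ ^ 2 * ‖p‖ ^ 2 - 2 * (γ * inner ℝ p q) + ‖q‖ ^ 2)
      = (1 - γ) * γ * ‖p‖ ^ 2 - 2 * (1 - γ) * inner ℝ p q + (γ⁻¹ - 1) * ‖q‖ ^ 2 := by
    field_simp
  rw [e] at h2
  linarith

theorem sq_norm_add_le_young {a : ℝ} (ha : 0 < a) (p q : E) :
    ‖p + q‖ ^ 2 ≤ (1 + a) * ‖p‖ ^ 2 + (1 + a⁻¹) * ‖q‖ ^ 2 := by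
  have h2 : 0 ≤ a⁻¹ * ‖a • p - q‖ ^ 2 := by positivity
  rw [norm_sub_sq_real, norm_smul, inner_smul_left, mul_pow, Real.norm_eq_abs, sq_abs] at h2
  rw [norm_add_sq_real]
  simp only [conj_trivial] at h2
  have e : a⁻¹ * (a ^ 2 * ‖p‖ ^ 2 - 2 * (a * inner ℝ p q) + ‖q‖ ^ 2)
      = a * ‖p‖ ^ 2 - 2 * inner ℝ p q + a⁻¹ * ‖q‖ ^ 2 := by
    field_simp
  rw [e] at h2
  linarith

end Norm

theorem continuous_neumannSum {E : Type*} [NormedAddCommGroup E] [NormedSpace ℝ E] (C : ℝ)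
    (k : ℕ) : Continuous fun B : E →L[ℝ] E => neumannSum C B k := by
  unfold neumannSum
  fun_prop

namespace BilevelProblem

variable {d d' : ℕ} {Ξ : Type u} {Ω : Type v}

/-- The lower-level error `‖y_t - y*(x_t)‖²`. -/
def lowerErr (S : BilevelProblem d d' Ξ) (c : BilevelConst) (R : SMBRun d d' Ξ Ω) (t : ℕ)
    (ω : Ω) : ℝ :=
  ‖(S.smb c R ω t).y - S.yStar (S.smb c R ω t).x‖ ^ 2

/-- The size `‖z_t‖²` of the momentum. -/
def momSq (S : BilevelProblem d d' Ξ) (c : BilevelConst) (R : SMBRun d d' Ξ Ω) (t : ℕ)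
    (ω : Ω) : ℝ :=
  ‖(S.smb c R ω t).z‖ ^ 2

/-- The iterate `(x_t, y_t, z_t)`. -/
def iterate (S : BilevelProblem d d' Ξ) (c : BilevelConst) (R : SMBRun d d' Ξ Ω) (t : ℕ)
    (ω : Ω) : Vec d × Vec d' × Vec d :=
  ((S.smb c R ω t).x, (S.smb c R ω t).y, (S.smb c R ω t).z)

/-- The conditional mean of `z_{t+1} - ∇F(x_t)` given the iterate `a = (x_t, y_t, z_t)`. -/
def condErr (S : BilevelProblem d d' Ξ) (c : BilevelConst) (γ : ℝ) (k : ℕ)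
    (a : Vec d × Vec d' × Vec d) : Vec d :=
  ((1 - γ) • a.2.2 - gradient S.F a.1) + γ • S.meanGrad c k a.1 a.2.1

section

variable (S : BilevelProblem d d' Ξ) (c : BilevelConst) (R : SMBRun d d' Ξ Ω) (ω : Ω) (t : ℕ)

theorem smb_succ_x : (S.smb c R ω (t + 1)).x
    = (S.smb c R ω t).x - R.ηx • (S.smb c R ω (t + 1)).z := rfl

theorem smb_succ_y : (S.smb c R ω (t + 1)).y = euclProj S.Yset ((S.smb c R ω t).y
    - R.ηy • S.Ogy (S.smb c R ω t).x (S.smb c R ω t).y (R.smp (.gy (t + 1)) ω)) := rfl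

theorem smb_succ_z : (S.smb c R ω (t + 1)).z = (1 - R.γ) • (S.smb c R ω t).z
    + R.γ • S.gradEst c R ω (t + 1) (S.smb c R ω t).x (S.smb c R ω t).y := rfl

end

namespace Assumptions

variable [MeasurableSpace Ξ] {S : BilevelProblem d d' Ξ} {P : Measure Ξ} {c : BilevelConst}
  {R : SMBRun d d' Ξ Ω} {t : ℕ}

theorem continuous_meanGrad (h : S.Assumptions P c) (k : ℕ) :
    Continuous fun q : Vec d × Vec d' => S.meanGrad c k q.1 q.2 := by
  unfold meanGrad
  refine h.lip_fx.continuous.sub (h.lip_gxy.continuous.clm_apply ?_)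
  exact ((continuous_neumannSum c.Cgyy k).comp h.lip_gyy.continuous).clm_apply h.lip_fy.continuous

theorem measurable_iterate [MeasurableSpace Ω] (h : S.Assumptions P c) (t : ℕ)
    (hs : ∀ a : OracleCall, a.round ≤ t → Measurable (R.smp a))
    (hp : ∀ r ≤ t, Measurable (R.p r)) : Measurable (S.iterate c R t) := by
  induction t with
  | zero =>
    refine measurable_const.prodMk (measurable_const.prodMk ?_)
    exact h.measurable_gradEst (θ := id) measurable_const measurable_const (hs _ le_rfl)
      (hs _ le_rfl) (hs _ le_rfl) (fun _ => hs _ le_rfl) (hp _ le_rfl)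
  | succ t ih =>
    have hi := ih (fun a ha => hs a (by omega)) (fun r hr => hp r (by omega))
    have hx : Measurable fun ω => (S.smb c R ω t).x := hi.fst
    have hy : Measurable fun ω => (S.smb c R ω t).y := hi.snd.fst
    have hz : Measurable fun ω => (S.smb c R ω t).z := hi.snd.snd
    have hg : Measurable fun ω => S.gradEst c R ω (t + 1) (S.smb c R ω t).x (S.smb c R ω t).y :=
      h.measurable_gradEst (θ := id) hx hy (hs _ le_rfl)
        (hs _ le_rfl) (hs _ le_rfl) (fun _ => hs _ le_rfl) (hp _ le_rfl)
    have hz' : Measurable fun ω => (S.smb c R ω (t + 1)).z :=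
      (hz.const_smul (1 - R.γ)).add (hg.const_smul R.γ)
    refine (hx.sub (hz'.const_smul R.ηx)).prodMk (Measurable.prodMk ?_ hz')
    refine (measurable_euclProj ⟨_, h.yStar_mem 0⟩ h.closed_Yset h.convex_Yset).comp ?_
    exact hy.sub ((h.oracle_gy.measurable_comp hx hy (hs (.gy (t + 1)) le_rfl)).const_smul R.ηy)

theorem measurable_iterate_sigma (h : S.Assumptions P c) (t : ℕ) :
    Measurable[R.sigma (roundIndices (Set.Iic t))] (S.iterate c R t) := by
  let _ : MeasurableSpace Ω := R.sigma (roundIndices (Set.Iic t))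
  exact h.measurable_iterate t (fun a ha => SMBRun.measurable_smp_sigma ha)
    (fun r hr => SMBRun.measurable_p_sigma hr)

/-- Joint measurability of the stochastic hypergradient of the round `r` in the iterate and in the
randomness of that round alone, which is what conditioning on the iterate requires. -/
theorem measurable_prod_gradEst (h : S.Assumptions P c) (r : ℕ) :
    @Measurable _ _ (@Prod.instMeasurableSpace (Vec d × Vec d' × Vec d) Ω _
      (R.sigma (roundIndices {r}))) _
      fun q => S.gradEst c R q.2 r q.1.1 q.1.2.1 := by
  let _ : MeasurableSpace Ω := R.sigma (roundIndices {r})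
  have hs : ∀ a : OracleCall, a.round = r → Measurable fun q : (Vec d × Vec d' × Vec d) × Ω =>
      R.smp a q.2 := fun a ha =>
    (SMBRun.measurable_smp_sigma (I := roundIndices {r}) ha).comp measurable_snd
  have hp : Measurable fun q : (Vec d × Vec d' × Vec d) × Ω => R.p r q.2 :=
    (SMBRun.measurable_p_sigma (I := roundIndices {r}) rfl).comp measurable_snd
  exact h.measurable_gradEst (α := (Vec d × Vec d' × Vec d) × Ω) (X := fun q => q.1.1)
    (Y := fun q => q.1.2.1) (θ := fun q => q.2)
    measurable_fst.fst measurable_fst.snd.fst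
    (hs (.fx r) rfl) (hs (.fy r) rfl) (hs (.gxy r) rfl) (fun i => hs (.gyy r i) rfl) hp

theorem measurable_prod_Ogy (h : S.Assumptions P c) (r : ℕ) :
    @Measurable _ _ (@Prod.instMeasurableSpace (Vec d × Vec d' × Vec d) Ω _
      (R.sigma (roundIndices {r}))) _
      fun q => S.Ogy q.1.1 q.1.2.1 (R.smp (.gy r) q.2) := by
  let _ : MeasurableSpace Ω := R.sigma (roundIndices {r})
  have hs : Measurable fun q : (Vec d × Vec d' × Vec d) × Ω => R.smp (.gy r) q.2 :=
    (SMBRun.measurable_smp_sigma (R := R) (I := roundIndices {r}) (a := .gy r) rfl).comp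
      measurable_snd
  exact h.oracle_gy.measurable_comp measurable_fst.fst measurable_fst.snd.fst hs

theorem measurable_prod_estErr (h : S.Assumptions P c) (hF : Continuous (gradient S.F)) (γ : ℝ)
    (r : ℕ) :
    @Measurable _ _ (@Prod.instMeasurableSpace (Vec d × Vec d' × Vec d) Ω _
      (R.sigma (roundIndices {r}))) _
      fun q => ‖((1 - γ) • q.1.2.2 - gradient S.F q.1.1)
        + γ • S.gradEst c R q.2 r q.1.1 q.1.2.1‖ ^ 2 := by
  have h3 : Continuous fun p : (Vec d × Vec d' × Vec d) × Vec d =>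
      ‖((1 - γ) • p.1.2.2 - gradient S.F p.1.1) + γ • p.2‖ ^ 2 := by fun_prop
  have h1 := h.measurable_prod_gradEst (R := R) (c := c) r
  let _ : MeasurableSpace Ω := R.sigma (roundIndices {r})
  have h4 := h3.measurable.comp (measurable_fst.prodMk h1)
  exact h4

variable [MeasurableSpace Ω] {μ : Measure Ω}

/-- A gradient step with a strongly monotone Lipschitz map contracts the distance to its zero. -/
theorem sq_norm_gradient_step_le (h : S.Assumptions P c) {η : ℝ} (hη : 0 < η)
    (hη' : η * c.Lgy ^ 2 ≤ c.lam) (x : Vec d) (y : Vec d') :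
    ‖y - S.yStar x - η • gradY S.g x y‖ ^ 2 ≤ (1 - η * c.lam) * ‖y - S.yStar x‖ ^ 2 := by
  have h1 := h.stronglyMonotone x y (S.yStar x)
  have h2 := h.lip_gy.sq_le x y x (S.yStar x)
  rw [h.yStar_stationary, sub_zero] at h1 h2
  rw [sub_self, norm_zero, zero_pow two_ne_zero, zero_add] at h2
  rw [norm_sub_sq_real, inner_smul_right, real_inner_comm, norm_smul, mul_pow, Real.norm_eq_abs,
    sq_abs]
  have h3 := mul_le_mul_of_nonneg_left h2 (sq_nonneg η)
  have h4 := mul_le_mul_of_nonneg_left h1 hη.le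
  have h5 := mul_le_mul_of_nonneg_right hη' (mul_nonneg hη.le (sq_nonneg ‖y - S.yStar x‖))
  nlinarith

theorem measurable_iterate_run (h : S.Assumptions P c) (hR : R.IsRandom P μ) (t : ℕ) :
    Measurable (S.iterate c R t) :=
  h.measurable_iterate t (fun a _ => hR.measurable_smp a) fun r _ => hR.measurable_p r

theorem measurable_lowerErr (h : S.Assumptions P c) (hc : c.Valid) (hR : R.IsRandom P μ) (t : ℕ) :
    Measurable (S.lowerErr c R t) :=
  (((h.measurable_iterate_run (c := c) hR t).snd.fst).sub ((h.continuous_yStar hc).measurable.comp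
    (h.measurable_iterate_run (c := c) hR t).fst)).norm.pow_const 2

theorem measurable_momSq (h : S.Assumptions P c) (hR : R.IsRandom P μ) (t : ℕ) :
    Measurable (S.momSq c R t) :=
  (h.measurable_iterate_run hR t).snd.snd.norm.pow_const 2

theorem measurable_gradSq [IsProbabilityMeasure P] (h : S.Assumptions P c) (hc : c.Valid)
    (hR : R.IsRandom P μ) (t : ℕ) :
    Measurable (S.gradSq c R t) :=
  ((h.continuous_gradient_F hc).measurable.comp
    (h.measurable_iterate_run hR t).fst).norm.pow_const 2

variable [IsProbabilityMeasure μ]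

/-- Conditioning on the iterate `t`, which is independent of the randomness of the round `t + 1`. -/
theorem integral_le_of_round (h : S.Assumptions P c) (hR : R.IsRandom P μ) (t : ℕ)
    {φ : (Vec d × Vec d' × Vec d) × Ω → ℝ}
    (hφ : @Measurable _ _ (@Prod.instMeasurableSpace (Vec d × Vec d' × Vec d) Ω _
      (R.sigma (roundIndices {t + 1}))) _ φ)
    (h0 : ∀ q, 0 ≤ φ q) {ψ : Vec d × Vec d' × Vec d → ℝ}
    (hψ : Integrable (fun ω => ψ (S.iterate c R t ω)) μ)
    (hφi : ∀ a, Integrable (fun ω => φ (a, ω)) μ) (hle : ∀ a, ∫ ω, φ (a, ω) ∂μ ≤ ψ a) :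
    Integrable (fun ω => φ (S.iterate c R t ω, ω)) μ ∧
      ∫ ω, φ (S.iterate c R t ω, ω) ∂μ ≤ ∫ ω, ψ (S.iterate c R t ω) ∂μ := by
  have hdis : Disjoint (roundIndices (Set.Iic t)) (roundIndices {t + 1}) :=
    disjoint_roundIndices (by simp)
  -- the second variable is the identity of `Ω`, as a map to `Ω` with the σ-algebra of the round
  refine @integral_le_of_indepFun Ω _ Ω _ μ _ _ (R.sigma (roundIndices {t + 1}))
    (S.iterate c R t) id ?_ ?_ ?_ φ hφ h0 ψ hψ hφi hle
  · exact (h.measurable_iterate_sigma t).mono (hR.sigma_le _) le_rfl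
  · exact measurable_id'' (hR.sigma_le _)
  · exact @SMBRun.IsRandom.indepFun _ _ _ _ _ _ _ _ _ hR _ _ hdis _ _ _
      (R.sigma (roundIndices {t + 1})) _ _ (h.measurable_iterate_sigma t)
      (@measurable_id _ (R.sigma (roundIndices {t + 1})))

variable [IsProbabilityMeasure P]

/-- The conditional mean of the stochastic hypergradient differs from `∇F(x)` by the bias of the
Neumann series and the error in the lower-level variable. -/
theorem norm_meanGrad_sub_gradient_sq_le (h : S.Assumptions P c) (hc : c.Valid) {k : ℕ} {b : ℝ}
    (hb : ∀ x y, ‖S.hyperGrad x y - S.meanGrad c k x y‖ ^ 2 ≤ b) (x : Vec d) (y : Vec d') :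
    ‖S.meanGrad c k x y - gradient S.F x‖ ^ 2
      ≤ 2 * b + 2 * c.C0 * ‖y - S.yStar x‖ ^ 2 := by
  have h1 := h.sq_norm_hyperGrad_sub_le hc x y x (S.yStar x)
  rw [sub_self, norm_zero, zero_pow two_ne_zero, zero_add, ← h.gradient_F hc] at h1
  have h2 := norm_sub_sq_le_two (S.hyperGrad x y - gradient S.F x)
    (S.hyperGrad x y - S.meanGrad c k x y)
  rw [sub_sub_sub_cancel_left] at h2
  have := hb x y
  linarith

theorem measurable_condErr (h : S.Assumptions P c) (hc : c.Valid) (γ : ℝ) (k : ℕ) :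
    Measurable (S.condErr c γ k) := by
  refine Continuous.measurable ?_
  have h1 := h.continuous_gradient_F hc
  have h2 : Continuous fun a : Vec d × Vec d' × Vec d => S.meanGrad c k a.1 a.2.1 :=
    (h.continuous_meanGrad k).comp (continuous_fst.prodMk continuous_snd.fst)
  unfold condErr
  fun_prop

/-- A crude bound, which serves to show that `condErr` is square integrable along a run. -/
theorem sq_norm_condErr_le (h : S.Assumptions P c) (hc : c.Valid) {k : ℕ} {b : ℝ}
    (hb : ∀ x y, ‖S.hyperGrad x y - S.meanGrad c k x y‖ ^ 2 ≤ b) (γ : ℝ)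
    (a : Vec d × Vec d' × Vec d) :
    ‖S.condErr c γ k a‖ ^ 2 ≤ 3 * (1 - γ) ^ 2 * ‖a.2.2‖ ^ 2
      + 3 * (1 - γ) ^ 2 * ‖gradient S.F a.1‖ ^ 2
      + 3 * γ ^ 2 * (2 * b + 2 * c.C0 * ‖a.2.1 - S.yStar a.1‖ ^ 2) := by
  have e : S.condErr c γ k a = (1 - γ) • a.2.2 + (-(1 - γ)) • gradient S.F a.1
      + γ • (S.meanGrad c k a.1 a.2.1 - gradient S.F a.1) := by
    rw [condErr]; module
  have h1 := norm_add_add_sq_le_three ((1 - γ) • a.2.2) ((-(1 - γ)) • gradient S.F a.1)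
    (γ • (S.meanGrad c k a.1 a.2.1 - gradient S.F a.1))
  rw [← e] at h1
  simp only [norm_smul, mul_pow, Real.norm_eq_abs, sq_abs, neg_sq] at h1
  have h2 := mul_le_mul_of_nonneg_left
    (h.norm_meanGrad_sub_gradient_sq_le hc hb a.1 a.2.1) (sq_nonneg γ)
  linarith

/-- The estimator error splits into its conditional mean and a variance of order `γ²`. -/
theorem integral_estErr_le (h : S.Assumptions P c) (hc : c.Valid) (hR : R.IsRandom P μ)
    (hk : 1 ≤ R.k t)
    (hu : Integrable (fun ω => ‖S.condErr c R.γ (R.k t) (S.iterate c R t ω)‖ ^ 2) μ) :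
    Integrable (S.estErr c R t) μ ∧ ∫ ω, S.estErr c R t ω ∂μ
      ≤ ∫ ω, ‖S.condErr c R.γ (R.k t) (S.iterate c R t ω)‖ ^ 2 ∂μ + R.γ ^ 2 * c.C1 (R.k t) := by
  let φ : (Vec d × Vec d' × Vec d) × Ω → ℝ := fun q =>
    ‖((1 - R.γ) • q.1.2.2 - gradient S.F q.1.1) + R.γ • S.gradEst c R q.2 (t + 1) q.1.1 q.1.2.1‖ ^ 2
  have hφ : @Measurable _ _ (@Prod.instMeasurableSpace (Vec d × Vec d' × Vec d) Ω _
      (R.sigma (roundIndices {t + 1}))) _ φ := by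
    exact h.measurable_prod_estErr (h.continuous_gradient_F hc) R.γ (t + 1)
  have hpt : ∀ a : Vec d × Vec d' × Vec d, Integrable (fun ω => φ (a, ω)) μ ∧
      ∫ ω, φ (a, ω) ∂μ ≤ ‖S.condErr c R.γ (R.k t) a‖ ^ 2 + R.γ ^ 2 * c.C1 (R.k t) := by
    intro a
    have hk' : roundK R.k (t + 1) = R.k t := rfl
    have := h.integral_sq_norm_add_smul_gradEst_le hc hR (hk'.symm ▸ hk) a.1 a.2.1 R.γ
      ((1 - R.γ) • a.2.2 - gradient S.F a.1)
    rw [hk'] at this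
    exact this
  have key := h.integral_le_of_round hR t (c := c) hφ (fun q => by positivity)
    (ψ := fun a => ‖S.condErr c R.γ (R.k t) a‖ ^ 2 + R.γ ^ 2 * c.C1 (R.k t))
    (hu.add (integrable_const _)) (fun a => (hpt a).1) (fun a => (hpt a).2)
  have e : ∀ ω, φ (S.iterate c R t ω, ω) = S.estErr c R t ω := fun ω => by
    simp only [φ, iterate, estErr, smb_succ_z]
    congr 2
    abel
  have e2 : ∫ ω, φ (S.iterate c R t ω, ω) ∂μ = ∫ ω, S.estErr c R t ω ∂μ := integral_congr_ae
    (Filter.Eventually.of_forall e)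
  have e3 : ∫ ω, (‖S.condErr c R.γ (R.k t) (S.iterate c R t ω)‖ ^ 2 + R.γ ^ 2 * c.C1 (R.k t)) ∂μ
      = ∫ ω, ‖S.condErr c R.γ (R.k t) (S.iterate c R t ω)‖ ^ 2 ∂μ + R.γ ^ 2 * c.C1 (R.k t) := by
    rw [integral_add hu (integrable_const _)]
    simp
  rw [← e2, ← e3]
  exact ⟨key.1.congr (Filter.Eventually.of_forall e), key.2⟩

/-- A projected stochastic gradient step on the lower level contracts the distance to the current
solution, up to the variance. -/
theorem integral_projected_step_le (h : S.Assumptions P c) (hc : c.Valid) (hR : R.IsRandom P μ)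
    (hη : 0 < R.ηy) (hη' : R.ηy * c.Lgy ^ 2 ≤ c.lam) (hd : Integrable (S.lowerErr c R t) μ) :
    Integrable (fun ω => ‖(S.smb c R ω (t + 1)).y - S.yStar (S.smb c R ω t).x‖ ^ 2) μ ∧
    ∫ ω, ‖(S.smb c R ω (t + 1)).y - S.yStar (S.smb c R ω t).x‖ ^ 2 ∂μ
      ≤ (1 - R.ηy * c.lam) * ∫ ω, S.lowerErr c R t ω ∂μ + R.ηy ^ 2 * c.sigma ^ 2 := by
  let φ : (Vec d × Vec d' × Vec d) × Ω → ℝ := fun q =>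
    ‖q.1.2.1 - S.yStar q.1.1 - R.ηy • S.Ogy q.1.1 q.1.2.1 (R.smp (.gy (t + 1)) q.2)‖ ^ 2
  have hφ : @Measurable _ _ (@Prod.instMeasurableSpace (Vec d × Vec d' × Vec d) Ω _
      (R.sigma (roundIndices {t + 1}))) _ φ := by
    have h1 := h.measurable_prod_Ogy (R := R) (c := c) (t + 1)
    have h2 := (h.continuous_yStar hc).measurable
    let _ : MeasurableSpace Ω := R.sigma (roundIndices {t + 1})
    exact ((measurable_fst.snd.fst.sub (h2.comp measurable_fst.fst)).sub
      (h1.const_smul R.ηy)).norm.pow_const 2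
  have hm := hR.measurePreserving (.gy (t + 1))
  have hpt : ∀ a : Vec d × Vec d' × Vec d, Integrable (fun ω => φ (a, ω)) μ ∧
      ∫ ω, φ (a, ω) ∂μ
        ≤ (1 - R.ηy * c.lam) * ‖a.2.1 - S.yStar a.1‖ ^ 2 + R.ηy ^ 2 * c.sigma ^ 2 := by
    intro a
    obtain ⟨h1, h2⟩ := integral_sq_norm_add_sub_mean
      ((h.oracle_gy.memLp_comp hm a.1 a.2.1).const_smul (-R.ηy))
      (a.2.1 - S.yStar a.1 - R.ηy • gradY S.g a.1 a.2.1)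
    simp only [Pi.smul_apply] at h1 h2
    rw [integral_smul, h.oracle_gy.integral_comp hm] at h1 h2
    have e : ∀ w : Vec d', a.2.1 - S.yStar a.1 - R.ηy • gradY S.g a.1 a.2.1
        + (-R.ηy • w - -R.ηy • gradY S.g a.1 a.2.1) = a.2.1 - S.yStar a.1 - R.ηy • w :=
      fun w => by module
    simp only [e] at h1 h2
    refine ⟨h1, h2.le.trans ?_⟩
    simp only [← smul_sub, norm_smul, mul_pow, Real.norm_eq_abs, sq_abs, neg_sq,
      integral_const_mul]
    gcongr
    · exact h.sq_norm_gradient_step_le hη hη' _ _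
    · exact h.oracle_gy.integral_sq_comp_le hm _ _
  have hψ : Integrable (fun ω => (1 - R.ηy * c.lam) * S.lowerErr c R t ω
      + R.ηy ^ 2 * c.sigma ^ 2) μ := (hd.const_mul _).add (integrable_const _)
  have key := h.integral_le_of_round hR t (c := c) hφ (fun q => by positivity)
    (ψ := fun a => (1 - R.ηy * c.lam) * ‖a.2.1 - S.yStar a.1‖ ^ 2 + R.ηy ^ 2 * c.sigma ^ 2)
    hψ (fun a => (hpt a).1) (fun a => (hpt a).2)
  have hle : ∀ ω, ‖(S.smb c R ω (t + 1)).y - S.yStar (S.smb c R ω t).x‖ ^ 2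
      ≤ φ (S.iterate c R t ω, ω) := by
    intro ω
    have := norm_euclProj_sub_mem_le h.closed_Yset h.convex_Yset ((S.smb c R ω t).y
      - R.ηy • S.Ogy (S.smb c R ω t).x (S.smb c R ω t).y (R.smp (.gy (t + 1)) ω))
      (h.yStar_mem (S.smb c R ω t).x)
    simp only [φ, iterate]
    rw [sub_right_comm, smb_succ_y]
    gcongr
  have hmeas : Measurable fun ω => ‖(S.smb c R ω (t + 1)).y - S.yStar (S.smb c R ω t).x‖ ^ 2 :=
    (((h.measurable_iterate_run (c := c) hR (t + 1)).snd.fst).sub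
      ((h.continuous_yStar hc).measurable.comp
        (h.measurable_iterate_run (c := c) hR t).fst)).norm.pow_const 2
  have hi : Integrable
      (fun ω => ‖(S.smb c R ω (t + 1)).y - S.yStar (S.smb c R ω t).x‖ ^ 2) μ := by
    refine key.1.mono' hmeas.aestronglyMeasurable (Filter.Eventually.of_forall fun ω => ?_)
    rw [Real.norm_eq_abs, abs_of_nonneg (by positivity)]
    exact hle ω
  refine ⟨hi, (integral_mono hi key.1 hle).trans (key.2.trans (le_of_eq ?_))⟩
  change ∫ ω, ((1 - R.ηy * c.lam) * S.lowerErr c R t ω + R.ηy ^ 2 * c.sigma ^ 2) ∂μ = _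
  rw [integral_add (hd.const_mul _) (integrable_const _), integral_const_mul]
  simp

end Assumptions

end BilevelProblem

/-! ### Accuracy of the algorithm -/

/-- Summation of a contractive recursion. -/
theorem sum_le_of_contraction {a s : ℕ → ℝ} {ρ : ℝ} {T : ℕ} (hρ : ρ ≤ 1) (ha : 0 ≤ a T)
    (h : ∀ t < T, a (t + 1) ≤ (1 - ρ) * a t + s t) :
    ρ * ∑ t ∈ Finset.range (T + 1), a t ≤ a 0 + ∑ t ∈ Finset.range T, s t := by
  have key : ∀ n ≤ T, a n + ρ * ∑ t ∈ Finset.range n, a t ≤ a 0 + ∑ t ∈ Finset.range n, s t := by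
    intro n hn
    induction n with
    | zero => simp
    | succ n ih =>
      rw [Finset.sum_range_succ, Finset.sum_range_succ]
      have := ih (by omega)
      have := h n (by omega)
      linarith
  have h1 := key T le_rfl
  have h2 := mul_le_of_le_one_left ha hρ
  rw [Finset.sum_range_succ]
  linarith

theorem sum_shift_le_sum {a : ℕ → ℝ} (ha : 0 ≤ a 0) (T : ℕ) :
    ∑ t ∈ Finset.range T, a (t + 1) ≤ ∑ t ∈ Finset.range (T + 1), a t := by
  rw [Finset.sum_range_succ']
  linarith

namespace BilevelProblem.Assumptions

variable {d d' : ℕ} {Ξ : Type u} {Ω : Type v} [MeasurableSpace Ξ] {S : BilevelProblem d d' Ξ}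
  {P : Measure Ξ} {c : BilevelConst} {R : SMBRun d d' Ξ Ω} {t : ℕ}

/-- The relation of `λ` to `L_{gy}`, which fails only for the trivial lower-level space. -/
theorem lam_le_Lgy (h : S.Assumptions P c) [Nontrivial (Vec d')] :
    c.lam ≤ c.Lgy := by
  obtain ⟨v, hv⟩ := exists_ne (0 : Vec d')
  have h1 := h.stronglyMonotone 0 v 0
  have h2 := h.lip_gy 0 v 0 0
  simp only [sub_zero, sub_self, norm_zero, zero_pow two_ne_zero, zero_add,
    Real.sqrt_sq (norm_nonneg v)] at h1 h2
  have h3 := h1.trans (real_inner_le_norm _ _)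
  have hv' : 0 < ‖v‖ := norm_pos_iff.2 hv
  have h4 := mul_le_mul_of_nonneg_right h2 hv'.le
  have h5 : c.lam * ‖v‖ ^ 2 ≤ c.Lgy * ‖v‖ ^ 2 := by linarith
  exact le_of_mul_le_mul_right h5 (by positivity)

theorem mul_lam_le_one (h : S.Assumptions P c) (hc : c.Valid) [Nontrivial (Vec d')] {η : ℝ}
    (hη : 0 < η) (hη' : η * c.Lgy ^ 2 ≤ c.lam) : η * c.lam ≤ 1 := by
  have h1 := h.lam_le_Lgy
  have hl := hc.lam_pos
  have h2 : η * c.lam ^ 2 ≤ η * c.Lgy ^ 2 := by gcongr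
  have h3 : (η * c.lam) * c.lam ≤ 1 * c.lam := by linarith
  exact le_of_mul_le_mul_right h3 hl

/-- The lower-level solution moves by at most `L_y η_x ‖z_{t+1}‖` in one step. -/
theorem lowerErr_succ_le (h : S.Assumptions P c) (hc : c.Valid) {a : ℝ} (ha : 0 < a) (ω : Ω) :
    S.lowerErr c R (t + 1) ω
      ≤ (1 + a) * ‖(S.smb c R ω (t + 1)).y - S.yStar (S.smb c R ω t).x‖ ^ 2
        + (1 + a⁻¹) * (c.Ly ^ 2 * R.ηx ^ 2) * S.momSq c R (t + 1) ω := by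
  have h1 := sq_norm_add_le_young ha ((S.smb c R ω (t + 1)).y - S.yStar (S.smb c R ω t).x)
    (S.yStar (S.smb c R ω t).x - S.yStar (S.smb c R ω (t + 1)).x)
  rw [sub_add_sub_cancel] at h1
  have h2 := pow_le_pow_left₀ (norm_nonneg _)
    (h.norm_yStar_sub_le hc (S.smb c R ω t).x (S.smb c R ω (t + 1)).x) 2
  rw [smb_succ_x, sub_sub_cancel, norm_smul, mul_pow, mul_pow, Real.norm_eq_abs, sq_abs] at h2
  rw [lowerErr, momSq]
  refine h1.trans ?_
  rw [mul_assoc (1 + a⁻¹)]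
  rw [smb_succ_x]
  gcongr
  linarith

/-- The momentum keeps a fraction `1 - γ` of the previous estimator error; the rest is due to the
motion of `∇F(x_t)` and to the conditional bias of the stochastic hypergradient. -/
theorem sq_norm_condErr_succ_le [IsProbabilityMeasure P] (h : S.Assumptions P c) (hc : c.Valid)
    {k : ℕ} {b : ℝ} (hb : ∀ x y, ‖S.hyperGrad x y - S.meanGrad c k x y‖ ^ 2 ≤ b)
    (hγ : 0 < R.γ) (hγ1 : R.γ ≤ 1) (hη : 0 ≤ R.ηx) (hηF : R.ηx * (8 * c.LF) ≤ R.γ) (ω : Ω) :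
    ‖S.condErr c R.γ k (S.iterate c R (t + 1) ω)‖ ^ 2
      ≤ (1 - R.γ) * S.estErr c R t ω + R.γ / 32 * S.momSq c R (t + 1) ω
        + R.γ * (4 * b + 4 * c.C0 * S.lowerErr c R (t + 1) ω) := by
  set x := (S.smb c R ω t).x with hx
  set x' := (S.smb c R ω (t + 1)).x with hx'
  set y' := (S.smb c R ω (t + 1)).y with hy'
  set z' := (S.smb c R ω (t + 1)).z with hz'
  have e : S.condErr c R.γ k (S.iterate c R (t + 1) ω) = (1 - R.γ) • (z' - gradient S.F x)
      + ((1 - R.γ) • (gradient S.F x - gradient S.F x')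
        + R.γ • (S.meanGrad c k x' y' - gradient S.F x')) := by
    simp only [condErr, iterate, ← hx', ← hy', ← hz']
    module
  have h1 := sq_norm_convex_add_le hγ hγ1 (z' - gradient S.F x)
    ((1 - R.γ) • (gradient S.F x - gradient S.F x')
        + R.γ • (S.meanGrad c k x' y' - gradient S.F x'))
  have h2 := norm_add_sq_le_two ((1 - R.γ) • (gradient S.F x - gradient S.F x'))
    (R.γ • (S.meanGrad c k x' y' - gradient S.F x'))
  simp only [norm_smul, mul_pow, Real.norm_eq_abs, sq_abs] at h2
  have h3 := h.norm_meanGrad_sub_gradient_sq_le hc hb x' y'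
  have h4 : (1 - R.γ) ^ 2 * ‖gradient S.F x - gradient S.F x'‖ ^ 2 ≤ R.γ ^ 2 / 64 * ‖z'‖ ^ 2 := by
    have hxx : x - x' = R.ηx • z' := by rw [hx', smb_succ_x]; abel
    have h5 := h.norm_gradient_F_sub_le hc x x'
    rw [hxx, norm_smul, Real.norm_eq_abs, abs_of_nonneg hη] at h5
    have h6 : ‖gradient S.F x - gradient S.F x'‖ ≤ R.γ / 8 * ‖z'‖ := by
      refine h5.trans ?_
      rw [← mul_assoc]
      gcongr
      linarith
    have h7 := pow_le_pow_left₀ (norm_nonneg _) h6 2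
    have h8 : (1 - R.γ) ^ 2 ≤ 1 := by nlinarith
    calc _ ≤ 1 * (R.γ / 8 * ‖z'‖) ^ 2 := by gcongr
      _ = _ := by ring
  have h9 : R.γ⁻¹ * ‖(1 - R.γ) • (gradient S.F x - gradient S.F x')
        + R.γ • (S.meanGrad c k x' y' - gradient S.F x')‖ ^ 2
      ≤ R.γ / 32 * ‖z'‖ ^ 2 + R.γ * (4 * b + 4 * c.C0 * ‖y' - S.yStar x'‖ ^ 2) := by
    rw [inv_mul_le_iff₀ hγ]
    have h10 := mul_le_mul_of_nonneg_left h3 (sq_nonneg R.γ)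
    nlinarith
  rw [e]
  simp only [estErr, momSq, lowerErr, ← hx, ← hx', ← hy', ← hz']
  linarith

/-- The descent lemma along the step `-η_x z_{t+1}`. The term `‖z_{t+1}‖²` is kept, to absorb the
motion of `∇F(x_t)` and of `y*(x_t)` in the two other recursions. -/
theorem descent_step [IsProbabilityMeasure P] (h : S.Assumptions P c) (hc : c.Valid)
    (hγ1 : R.γ ≤ 1) (hη : 0 < R.ηx) (hηF : R.ηx * (8 * c.LF) ≤ R.γ) (ω : Ω) :
    S.F (S.smb c R ω (t + 1)).x ≤ S.F (S.smb c R ω t).x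
      - R.ηx / 2 * (S.gradSq c R t ω + 7 / 8 * S.momSq c R (t + 1) ω - S.estErr c R t ω) := by
  have h1 := le_of_lipschitz_gradient (h.differentiable_F hc) (h.norm_gradient_F_sub_le hc)
    (S.smb c R ω t).x (S.smb c R ω (t + 1)).x
  have hxx : (S.smb c R ω (t + 1)).x - (S.smb c R ω t).x = -(R.ηx • (S.smb c R ω (t + 1)).z) := by
    rw [smb_succ_x]; abel
  rw [hxx, norm_neg, norm_smul, inner_neg_right, inner_smul_right, mul_pow, Real.norm_eq_abs,
    sq_abs] at h1
  simp only [gradSq, momSq, estErr]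
  rw [norm_sub_sq_real, real_inner_comm]
  have h2 : c.LF / 2 * (R.ηx ^ 2 * ‖(S.smb c R ω (t + 1)).z‖ ^ 2)
      ≤ R.ηx / 16 * ‖(S.smb c R ω (t + 1)).z‖ ^ 2 := by
    have h3 : R.ηx * c.LF ≤ 1 / 8 := by linarith
    have h4 := mul_le_mul_of_nonneg_right h3
      (mul_nonneg hη.le (sq_nonneg ‖(S.smb c R ω (t + 1)).z‖))
    linarith
  linarith

theorem sum_descent_le [IsProbabilityMeasure P] (h : S.Assumptions P c) (hc : c.Valid)
    (hbdd : BddBelow (Set.range S.F)) {ΔF : ℝ} (hΔ : S.F R.x0 - (⨅ x, S.F x) ≤ ΔF)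
    (hγ1 : R.γ ≤ 1) (hη : 0 < R.ηx) (hηF : R.ηx * (8 * c.LF) ≤ R.γ) (n : ℕ) (ω : Ω) :
    ∑ t ∈ Finset.range n, S.gradSq c R t ω + 7 / 8 * ∑ t ∈ Finset.range n, S.momSq c R (t + 1) ω
      ≤ 2 * ΔF / R.ηx + ∑ t ∈ Finset.range n, S.estErr c R t ω := by
  have key : S.F (S.smb c R ω n).x ≤ S.F R.x0 - R.ηx / 2 * (∑ t ∈ Finset.range n, S.gradSq c R t ω
      + 7 / 8 * ∑ t ∈ Finset.range n, S.momSq c R (t + 1) ω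
      - ∑ t ∈ Finset.range n, S.estErr c R t ω) := by
    induction n with
    | zero => simp [smb]
    | succ n ih =>
      simp only [Finset.sum_range_succ]
      have := h.descent_step hc (t := n) hγ1 hη hηF ω
      linarith
  have h1 := ciInf_le hbdd (S.smb c R ω n).x
  have h2 : R.ηx * (∑ t ∈ Finset.range n, S.gradSq c R t ω
      + 7 / 8 * ∑ t ∈ Finset.range n, S.momSq c R (t + 1) ω
      - ∑ t ∈ Finset.range n, S.estErr c R t ω) ≤ 2 * ΔF := by linarith
  rw [← le_div_iff₀' hη] at h2
  linarith

variable [MeasurableSpace Ω] {μ : Measure Ω} [IsProbabilityMeasure μ] [IsProbabilityMeasure P]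

theorem integrable_condErr (h : S.Assumptions P c) (hc : c.Valid) (hR : R.IsRandom P μ) (γ : ℝ)
    (k : ℕ) (hm : Integrable (S.momSq c R t) μ) (hg : Integrable (S.gradSq c R t) μ)
    (hd : Integrable (S.lowerErr c R t) μ) :
    Integrable (fun ω => ‖S.condErr c γ k (S.iterate c R t ω)‖ ^ 2) μ := by
  have hb : ∀ x y, ‖S.hyperGrad x y - S.meanGrad c k x y‖ ^ 2
      ≤ (c.Cgxy * c.Cfy / c.lam * Real.exp (-(k * c.lam / c.Cgyy))) ^ 2 := fun x y => by
    gcongr; exact h.norm_hyperGrad_sub_meanGrad_le hc k x y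
  set b := (c.Cgxy * c.Cfy / c.lam * Real.exp (-(k * c.lam / c.Cgyy))) ^ 2
  have hi : Integrable (fun ω => 3 * (1 - γ) ^ 2 * S.momSq c R t ω
      + 3 * (1 - γ) ^ 2 * S.gradSq c R t ω
      + 3 * γ ^ 2 * (2 * b + 2 * c.C0 * S.lowerErr c R t ω)) μ :=
    ((hm.const_mul _).add (hg.const_mul _)).add
      (((integrable_const _).add (hd.const_mul _)).const_mul _)
  refine hi.mono' ?_ (Filter.Eventually.of_forall fun ω => ?_)
  · exact (((h.measurable_condErr hc γ k).comp (h.measurable_iterate_run hR t)).norm.pow_const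
      2).aestronglyMeasurable
  · rw [Real.norm_eq_abs, abs_of_nonneg (by positivity)]
    exact h.sq_norm_condErr_le hc hb γ (S.iterate c R t ω)

/-- All second moments along the run are finite. -/
theorem integrable_run (h : S.Assumptions P c) (hc : c.Valid) (hR : R.IsRandom P μ)
    (hη : 0 < R.ηy) (hη' : R.ηy * c.Lgy ^ 2 ≤ c.lam) {T : ℕ} (hk : ∀ t ≤ T, 1 ≤ R.k t) :
    ∀ t ≤ T + 1, Integrable (S.momSq c R t) μ ∧ Integrable (S.gradSq c R t) μ ∧
      Integrable (S.lowerErr c R t) μ := by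
  intro t
  induction t with
  | zero =>
    intro _
    refine ⟨?_, ?_, ?_⟩
    · exact (h.memLp_gradEst hc hR (r := 0) R.x0 R.y0).norm.integrable_sq
    · exact integrable_const (‖gradient S.F R.x0‖ ^ 2)
    · exact integrable_const (‖R.y0 - S.yStar R.x0‖ ^ 2)
  | succ t ih =>
    intro ht
    obtain ⟨hm, hg, hd⟩ := ih (by omega)
    have hu := h.integrable_condErr hc hR R.γ (R.k t) hm hg hd
    have hD := (h.integral_estErr_le hc hR (hk t (by omega)) hu).1
    have hm' : Integrable (S.momSq c R (t + 1)) μ := by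
      refine ((hD.const_mul 2).add (hg.const_mul 2)).mono'
        (h.measurable_momSq hR (t + 1)).aestronglyMeasurable
        (Filter.Eventually.of_forall fun ω => ?_)
      rw [Real.norm_eq_abs, momSq, abs_of_nonneg (by positivity)]
      have := norm_add_sq_le_two ((S.smb c R ω (t + 1)).z - gradient S.F (S.smb c R ω t).x)
        (gradient S.F (S.smb c R ω t).x)
      rw [sub_add_cancel] at this
      exact this
    refine ⟨hm', ?_, ?_⟩
    · refine ((hg.const_mul 2).add (hm'.const_mul (2 * (c.LF ^ 2 * R.ηx ^ 2)))).mono'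
        (h.measurable_gradSq hc hR (t + 1)).aestronglyMeasurable
        (Filter.Eventually.of_forall fun ω => ?_)
      rw [Real.norm_eq_abs, gradSq, abs_of_nonneg (by positivity)]
      have h1 := norm_sub_sq_le_two (gradient S.F (S.smb c R ω t).x)
        (gradient S.F (S.smb c R ω t).x - gradient S.F (S.smb c R ω (t + 1)).x)
      rw [sub_sub_cancel] at h1
      have h2 := pow_le_pow_left₀ (norm_nonneg _)
        (h.norm_gradient_F_sub_le hc (S.smb c R ω t).x (S.smb c R ω (t + 1)).x) 2
      rw [smb_succ_x, sub_sub_cancel, norm_smul, mul_pow, mul_pow, Real.norm_eq_abs, sq_abs,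
        ← smb_succ_x] at h2
      refine h1.trans ?_
      simp only [Pi.add_apply, gradSq, momSq]
      linarith
    · have hp := (h.integral_projected_step_le hc hR hη hη' hd).1
      refine ((hp.const_mul (1 + 1)).add
        (hm'.const_mul ((1 + 1⁻¹) * (c.Ly ^ 2 * R.ηx ^ 2)))).mono'
        (h.measurable_lowerErr hc hR (t + 1)).aestronglyMeasurable
        (Filter.Eventually.of_forall fun ω => ?_)
      rw [Real.norm_eq_abs, abs_of_nonneg (sq_nonneg _)]
      exact h.lowerErr_succ_le hc one_pos ω

end BilevelProblem.Assumptions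

namespace BilevelProblem.Assumptions

variable {d d' : ℕ} {Ξ : Type u} {Ω : Type v} [MeasurableSpace Ξ] {S : BilevelProblem d d' Ξ}
  {P : Measure Ξ} {c : BilevelConst} {R : SMBRun d d' Ξ Ω} {t : ℕ}
  [MeasurableSpace Ω] {μ : Measure Ω} [IsProbabilityMeasure μ] [IsProbabilityMeasure P]

/-- The recursion for the lower-level error, in expectation. -/
theorem integral_lowerErr_succ_le (h : S.Assumptions P c) (hc : c.Valid) (hR : R.IsRandom P μ)
    (hη : 0 < R.ηy) (hη' : R.ηy * c.Lgy ^ 2 ≤ c.lam) (hη1 : R.ηy * c.lam ≤ 1)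
    (hd : Integrable (S.lowerErr c R t) μ) (hd' : Integrable (S.lowerErr c R (t + 1)) μ)
    (hm : Integrable (S.momSq c R (t + 1)) μ) :
    ∫ ω, S.lowerErr c R (t + 1) ω ∂μ ≤ (1 - R.ηy * c.lam / 2) * ∫ ω, S.lowerErr c R t ω ∂μ
      + (3 / 2 * R.ηy ^ 2 * c.sigma ^ 2
        + 3 / (R.ηy * c.lam) * (c.Ly ^ 2 * R.ηx ^ 2) * ∫ ω, S.momSq c R (t + 1) ω ∂μ) := by
  have hl := hc.lam_pos
  set q := R.ηy * c.lam with hq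
  have hq0 : 0 < q := by positivity
  obtain ⟨hp, hp2⟩ := h.integral_projected_step_le hc hR hη hη' hd
  have h1 : ∫ ω, S.lowerErr c R (t + 1) ω ∂μ
      ≤ ∫ ω, ((1 + q / 2) * ‖(S.smb c R ω (t + 1)).y - S.yStar (S.smb c R ω t).x‖ ^ 2
        + (1 + (q / 2)⁻¹) * (c.Ly ^ 2 * R.ηx ^ 2) * S.momSq c R (t + 1) ω) ∂μ :=
    integral_mono hd' ((hp.const_mul _).add (hm.const_mul _))
      fun ω => h.lowerErr_succ_le hc (by positivity) ω
  rw [integral_add (hp.const_mul _) (hm.const_mul _), integral_const_mul, integral_const_mul] at h1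
  have hY0 : 0 ≤ ∫ ω, S.lowerErr c R t ω ∂μ := integral_nonneg fun ω => sq_nonneg _
  have hM0 : 0 ≤ ∫ ω, S.momSq c R (t + 1) ω ∂μ := integral_nonneg fun ω => sq_nonneg _
  have h2 : 1 + (q / 2)⁻¹ ≤ 3 / q := by
    rw [inv_div, le_div_iff₀ hq0, add_mul, div_mul_cancel₀ _ hq0.ne']
    linarith
  have h3 := mul_le_mul_of_nonneg_left hp2 (by positivity : 0 ≤ 1 + q / 2)
  have h4 : (1 + (q / 2)⁻¹) * (c.Ly ^ 2 * R.ηx ^ 2) * ∫ ω, S.momSq c R (t + 1) ω ∂μ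
      ≤ 3 / q * (c.Ly ^ 2 * R.ηx ^ 2) * ∫ ω, S.momSq c R (t + 1) ω ∂μ := by gcongr
  have h5 : (1 + q / 2) * ((1 - q) * ∫ ω, S.lowerErr c R t ω ∂μ + R.ηy ^ 2 * c.sigma ^ 2)
      ≤ (1 - q / 2) * ∫ ω, S.lowerErr c R t ω ∂μ + 3 / 2 * R.ηy ^ 2 * c.sigma ^ 2 := by
    have h6 : (1 + q / 2) * (1 - q) ≤ 1 - q / 2 := by nlinarith
    have h7 := mul_le_mul_of_nonneg_right h6 hY0
    have h8 : (1 + q / 2) * (R.ηy ^ 2 * c.sigma ^ 2) ≤ 3 / 2 * (R.ηy ^ 2 * c.sigma ^ 2) := by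
      gcongr; linarith
    linarith
  linarith

/-- The recursion for the estimator error, in expectation. -/
theorem integral_estErr_succ_le (h : S.Assumptions P c) (hc : c.Valid) (hR : R.IsRandom P μ)
    {b : ℝ} (hk : 1 ≤ R.k (t + 1))
    (hb : ∀ x y, ‖S.hyperGrad x y - S.meanGrad c (R.k (t + 1)) x y‖ ^ 2 ≤ b)
    (hγ : 0 < R.γ) (hγ1 : R.γ ≤ 1) (hη : 0 ≤ R.ηx) (hηF : R.ηx * (8 * c.LF) ≤ R.γ)
    (hD : Integrable (S.estErr c R t) μ)
    (hm : Integrable (S.momSq c R (t + 1)) μ) (hg : Integrable (S.gradSq c R (t + 1)) μ)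
    (hd : Integrable (S.lowerErr c R (t + 1)) μ) :
    ∫ ω, S.estErr c R (t + 1) ω ∂μ ≤ (1 - R.γ) * ∫ ω, S.estErr c R t ω ∂μ
      + (R.γ / 32 * ∫ ω, S.momSq c R (t + 1) ω ∂μ
        + R.γ * (4 * b + 4 * c.C0 * ∫ ω, S.lowerErr c R (t + 1) ω ∂μ)
        + R.γ ^ 2 * c.C1 (R.k (t + 1))) := by
  have hu := h.integrable_condErr hc hR R.γ (R.k (t + 1)) hm hg hd
  have h1 := (h.integral_estErr_le hc hR hk hu).2
  have i1 : Integrable (fun ω => (1 - R.γ) * S.estErr c R t ω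
      + R.γ / 32 * S.momSq c R (t + 1) ω) μ := (hD.const_mul _).add (hm.const_mul _)
  have i2 : Integrable (fun ω => 4 * b + 4 * c.C0 * S.lowerErr c R (t + 1) ω) μ :=
    (integrable_const _).add (hd.const_mul _)
  have h2 := integral_mono hu (i1.add (i2.const_mul R.γ))
    fun ω => h.sq_norm_condErr_succ_le hc hb hγ hγ1 hη hηF ω
  simp only [Pi.add_apply] at h2
  rw [integral_add i1 (i2.const_mul _), integral_add (hD.const_mul _) (hm.const_mul _),
    integral_const_mul, integral_const_mul, integral_const_mul,
    integral_add (integrable_const _) (hd.const_mul _), integral_const_mul] at h2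
  simp only [integral_const, probReal_univ, one_smul, integral_const_mul] at h2
  linarith

/-- Summing the recursion for the lower-level error. If the lower-level space is trivial then all
these errors vanish, and otherwise the recursion is a contraction. -/
theorem sum_lowerErr_le (h : S.Assumptions P c) (hc : c.Valid) (hR : R.IsRandom P μ)
    (hη : 0 < R.ηy) (hη' : R.ηy * c.Lgy ^ 2 ≤ c.lam) {T : ℕ} (hk : ∀ t ≤ T, 1 ≤ R.k t) :
    R.ηy * c.lam / 2 * ∑ t ∈ Finset.range (T + 1), ∫ ω, S.lowerErr c R t ω ∂μ
      ≤ ‖R.y0 - S.yStar R.x0‖ ^ 2 + (3 / 2 * R.ηy ^ 2 * c.sigma ^ 2 * T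
        + 3 / (R.ηy * c.lam) * (c.Ly ^ 2 * R.ηx ^ 2)
          * ∑ t ∈ Finset.range (T + 1), ∫ ω, S.momSq c R (t + 1) ω ∂μ) := by
  have hl := hc.lam_pos
  have hM0 : ∀ t, 0 ≤ ∫ ω, S.momSq c R t ω ∂μ := fun t => integral_nonneg fun ω => sq_nonneg _
  have hM1 : 0 ≤ ∑ t ∈ Finset.range (T + 1), ∫ ω, S.momSq c R (t + 1) ω ∂μ :=
    Finset.sum_nonneg fun t _ => hM0 _
  rcases subsingleton_or_nontrivial (Vec d') with hsub | hnt
  · have : ∀ t, ∫ ω, S.lowerErr c R t ω ∂μ = 0 := fun t => by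
      have : S.lowerErr c R t = fun _ => 0 := by
        ext1 ω
        rw [lowerErr, Subsingleton.elim ((S.smb c R ω t).y - S.yStar (S.smb c R ω t).x) 0]
        simp
      rw [this]; simp
    simp only [this, Finset.sum_const_zero, mul_zero]
    positivity
  · have hη1 := h.mul_lam_le_one hc hη hη'
    have hI := h.integrable_run hc hR hη hη' hk
    have h1 := sum_le_of_contraction (a := fun t => ∫ ω, S.lowerErr c R t ω ∂μ) (T := T)
      (ρ := R.ηy * c.lam / 2) (by linarith) (integral_nonneg fun ω => sq_nonneg _)
      fun t ht => h.integral_lowerErr_succ_le hc hR hη hη' hη1 (hI t (by omega)).2.2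
        (hI (t + 1) (by omega)).2.2 (hI (t + 1) (by omega)).1
    simp only [Finset.sum_add_distrib, ← Finset.mul_sum, Finset.sum_const, Finset.card_range,
      nsmul_eq_mul] at h1
    have h0 : ∫ ω, S.lowerErr c R 0 ω ∂μ = ‖R.y0 - S.yStar R.x0‖ ^ 2 := by
      have : S.lowerErr c R 0 = fun _ => ‖R.y0 - S.yStar R.x0‖ ^ 2 := rfl
      rw [this]; simp
    rw [h0] at h1
    have h2 : ∑ t ∈ Finset.range T, ∫ ω, S.momSq c R (t + 1) ω ∂μ
        ≤ ∑ t ∈ Finset.range (T + 1), ∫ ω, S.momSq c R (t + 1) ω ∂μ := by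
      rw [Finset.sum_range_succ]
      linarith [hM0 (T + 1)]
    have h3 : 3 / (R.ηy * c.lam) * (c.Ly ^ 2 * R.ηx ^ 2)
        * ∑ t ∈ Finset.range T, ∫ ω, S.momSq c R (t + 1) ω ∂μ
        ≤ 3 / (R.ηy * c.lam) * (c.Ly ^ 2 * R.ηx ^ 2)
        * ∑ t ∈ Finset.range (T + 1), ∫ ω, S.momSq c R (t + 1) ω ∂μ := by gcongr
    linarith

/-- Summing the recursion for the estimator error. -/
theorem sum_estErr_le (h : S.Assumptions P c) (hc : c.Valid) (hR : R.IsRandom P μ)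
    {b e : ℝ} {T : ℕ} (hk : ∀ t ≤ T, 1 ≤ R.k t)
    (hb : ∀ t ≤ T, ∀ x y, ‖S.hyperGrad x y - S.meanGrad c (R.k t) x y‖ ^ 2 ≤ b)
    (hγ : 0 < R.γ) (hγ1 : R.γ ≤ 1) (hγ2 : ∀ t ≤ T, R.γ * c.C1 (R.k t) ≤ e)
    (hη : 0 ≤ R.ηx) (hηF : R.ηx * (8 * c.LF) ≤ R.γ)
    (hηy : 0 < R.ηy) (hηy' : R.ηy * c.Lgy ^ 2 ≤ c.lam) :
    R.γ * ∑ t ∈ Finset.range (T + 1), ∫ ω, S.estErr c R t ω ∂μ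
      ≤ ∫ ω, S.estErr c R 0 ω ∂μ + R.γ *
        (1 / 32 * ∑ t ∈ Finset.range (T + 1), ∫ ω, S.momSq c R (t + 1) ω ∂μ
        + 4 * b * T + 4 * c.C0 * ∑ t ∈ Finset.range (T + 1), ∫ ω, S.lowerErr c R t ω ∂μ
        + e * T) := by
  have hI := h.integrable_run hc hR hηy hηy' hk
  have hD : ∀ t ≤ T, Integrable (S.estErr c R t) μ := fun t ht =>
    (h.integral_estErr_le hc hR (hk t ht) (h.integrable_condErr hc hR R.γ (R.k t)
      (hI t (by omega)).1 (hI t (by omega)).2.1 (hI t (by omega)).2.2)).1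
  have hM0 : ∀ t, 0 ≤ ∫ ω, S.momSq c R t ω ∂μ := fun t => integral_nonneg fun ω => sq_nonneg _
  have h1 := sum_le_of_contraction (a := fun t => ∫ ω, S.estErr c R t ω ∂μ) (T := T)
    (s := fun t => R.γ * (1 / 32 * ∫ ω, S.momSq c R (t + 1) ω ∂μ
        + 4 * b + 4 * c.C0 * ∫ ω, S.lowerErr c R (t + 1) ω ∂μ + e))
    hγ1 (integral_nonneg fun ω => sq_nonneg _) fun t ht => by
      have h2 := h.integral_estErr_succ_le hc hR (hk (t + 1) (by omega)) (hb (t + 1) (by omega))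
        hγ hγ1 hη hηF (hD t (by omega)) (hI (t + 1) (by omega)).1 (hI (t + 1) (by omega)).2.1
        (hI (t + 1) (by omega)).2.2
      have h3 := mul_le_mul_of_nonneg_left (hγ2 (t + 1) (by omega)) hγ.le
      refine h2.trans ?_
      linarith
  simp only [Finset.sum_add_distrib, ← Finset.mul_sum, Finset.sum_const, Finset.card_range,
    nsmul_eq_mul] at h1
  refine h1.trans ?_
  have h2 : ∑ t ∈ Finset.range T, ∫ ω, S.momSq c R (t + 1) ω ∂μ
      ≤ ∑ t ∈ Finset.range (T + 1), ∫ ω, S.momSq c R (t + 1) ω ∂μ := by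
    rw [Finset.sum_range_succ]
    linarith [hM0 (T + 1)]
  have h3 : ∑ t ∈ Finset.range T, ∫ ω, S.lowerErr c R (t + 1) ω ∂μ
      ≤ ∑ t ∈ Finset.range (T + 1), ∫ ω, S.lowerErr c R t ω ∂μ :=
    sum_shift_le_sum (a := fun t => ∫ ω, S.lowerErr c R t ω ∂μ)
      (integral_nonneg fun ω => sq_nonneg _) T
  have h4 := mul_le_mul_of_nonneg_left h3 c.C0_nonneg
  refine add_le_add le_rfl (mul_le_mul_of_nonneg_left ?_ hγ.le)
  linarith

/-- Accuracy of the algorithm: the summed recursions for the objective, the lower-level error and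
the estimator error form a linear system whose feedback terms are small under the parameter
conditions. -/
theorem accurate (h : S.Assumptions P c) (hc : c.Valid) (hR : R.IsRandom P μ)
    (hbdd : BddBelow (Set.range S.F)) {ΔF ε : ℝ} {T : ℕ}
    (hΔ : S.F R.x0 - (⨅ x, S.F x) ≤ ΔF) (hε : 0 < ε)
    (hp : ParamCond c ΔF (‖R.y0 - S.yStar R.x0‖ ^ 2) (∫ ω, S.estErr c R 0 ω ∂μ) ε
      R.γ R.ηx R.ηy R.k T) : S.Accurate c R μ T ε := by
  have hl := hc.lam_pos
  have hγ := hp.γ_pos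
  have hηx := hp.ηx_pos
  have hηy := hp.ηy_pos
  have hC0 := c.C0_nonneg
  have hI := h.integrable_run hc hR hp.ηy_pos hp.ηy_le₂ hp.k_pos
  have hD : ∀ t ≤ T, Integrable (S.estErr c R t) μ := fun t ht =>
    (h.integral_estErr_le hc hR (hp.k_pos t ht) (h.integrable_condErr hc hR R.γ (R.k t)
      (hI t (by omega)).1 (hI t (by omega)).2.1 (hI t (by omega)).2.2)).1
  have hDs : ∀ t ∈ Finset.range (T + 1), Integrable (S.estErr c R t) μ := fun t ht =>
    hD t (by have := Finset.mem_range.1 ht; omega)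
  have hNs : ∀ t ∈ Finset.range (T + 1), Integrable (S.gradSq c R t) μ := fun t ht =>
    (hI t (Finset.mem_range.1 ht).le).2.1
  have hMs : ∀ t ∈ Finset.range (T + 1), Integrable (S.momSq c R (t + 1)) μ := fun t ht =>
    (hI (t + 1) (by have := Finset.mem_range.1 ht; omega)).1
  set SD := ∑ t ∈ Finset.range (T + 1), ∫ ω, S.estErr c R t ω ∂μ with hSD
  set SN := ∑ t ∈ Finset.range (T + 1), ∫ ω, S.gradSq c R t ω ∂μ with hSN
  set SM := ∑ t ∈ Finset.range (T + 1), ∫ ω, S.momSq c R (t + 1) ω ∂μ with hSM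
  set SY := ∑ t ∈ Finset.range (T + 1), ∫ ω, S.lowerErr c R t ω ∂μ with hSY
  have hSN0 : 0 ≤ SN := Finset.sum_nonneg fun t _ => integral_nonneg fun ω => sq_nonneg _
  have hSM0 : 0 ≤ SM := Finset.sum_nonneg fun t _ => integral_nonneg fun ω => sq_nonneg _
  -- the descent inequality, in expectation
  have h1 : SN + 7 / 8 * SM ≤ 2 * ΔF / R.ηx + SD := by
    have := integral_mono ((integrable_finsetSum _ hNs).add
      ((integrable_finsetSum _ hMs).const_mul (7 / 8)))
      ((integrable_const (2 * ΔF / R.ηx)).add (integrable_finsetSum _ hDs))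
      (fun ω => h.sum_descent_le hc hbdd hΔ hp.γ_le_one hηx hp.ηx_le₂ (T + 1) ω)
    simp only [Pi.add_apply] at this
    rw [integral_add (integrable_finsetSum _ hNs) ((integrable_finsetSum _ hMs).const_mul (7 / 8)),
      integral_add (integrable_const _) (integrable_finsetSum _ hDs), integral_const_mul,
      integral_finsetSum _ hNs, integral_finsetSum _ hMs, integral_finsetSum _ hDs] at this
    simpa using this
  have h2 := h.sum_lowerErr_le hc hR hp.ηy_pos hp.ηy_le₂ hp.k_pos
  have h3 := h.sum_estErr_le hc hR (b := ε ^ 2 / 64) (e := ε ^ 2 / 20) hp.k_pos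
    (fun t ht x y => h.sq_norm_hyperGrad_sub_meanGrad_le hc hε (hp.k_ge t ht) x y) hγ hp.γ_le_one
    (fun t ht => by have := hp.γ_le t ht; linarith) hηx.le hp.ηx_le₂ hp.ηy_pos hp.ηy_le₂
  rw [← hSD, ← hSM, ← hSY] at h3
  rw [← hSM, ← hSY] at h2
  have hT0 : (0 : ℝ) ≤ T := Nat.cast_nonneg T
  have t1 : 2 * ΔF / R.ηx ≤ T * ε ^ 2 / 10 := by
    have := hp.T_ge₁
    rw [div_le_iff₀ (by positivity)] at this ⊢
    linarith
  have t2 : ∫ ω, S.estErr c R 0 ω ∂μ ≤ R.γ * (T * ε ^ 2 / 20) := by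
    have := hp.T_ge₂
    rw [div_le_iff₀ (by positivity)] at this
    linarith
  have t3 := hp.T_ge₃
  set q := R.ηy * c.lam with hq
  have hq0 : 0 < q := by positivity
  have t3' : 320 * c.C0 * ‖R.y0 - S.yStar R.x0‖ ^ 2 ≤ T * (q * ε ^ 2) := by
    rwa [div_le_iff₀ (by positivity)] at t3
  have s1 : SD ≤ T * ε ^ 2 / 20 + (1 / 32 * SM + 4 * (ε ^ 2 / 64) * T + 4 * c.C0 * SY
      + ε ^ 2 / 20 * T) := by
    refine le_of_mul_le_mul_left ?_ hγ
    linarith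
  -- the step size condition on `ηx`, squared
  have s2 : 1024 * (c.C0 * (c.Ly ^ 2 * R.ηx ^ 2)) ≤ q ^ 2 := by
    have h0 : 0 ≤ R.ηx * (32 * √c.C0 * c.Ly) := by have := hc.Ly_nonneg; positivity
    have := pow_le_pow_left₀ h0 hp.ηx_le₁ 2
    have e : (R.ηx * (32 * √c.C0 * c.Ly)) ^ 2 = 1024 * (√c.C0 ^ 2 * (c.Ly ^ 2 * R.ηx ^ 2)) := by
      ring
    rw [e, Real.sq_sqrt hC0] at this
    exact this
  have s3 : 4 * c.C0 * SY ≤ T * ε ^ 2 / 40 + 12 / 640 * (T * ε ^ 2) + 24 / 1024 * SM := by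
    have e1 := mul_le_mul_of_nonneg_left h2 (by positivity : 0 ≤ 8 * c.C0 / q)
    have e2 : 8 * c.C0 / q * (q / 2 * SY) = 4 * c.C0 * SY := by field_simp; ring
    have e3 : 8 * c.C0 / q * ‖R.y0 - S.yStar R.x0‖ ^ 2 ≤ T * ε ^ 2 / 40 := by
      rw [div_mul_eq_mul_div, div_le_iff₀ hq0]; linarith
    have e4 : 8 * c.C0 / q * (3 / 2 * R.ηy ^ 2 * c.sigma ^ 2 * T) ≤ 12 / 640 * (T * ε ^ 2) := by
      rw [div_mul_eq_mul_div, div_le_iff₀ hq0]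
      have := mul_le_mul_of_nonneg_left hp.ηy_le₁ (by positivity : 0 ≤ 12 / 640 * (R.ηy * T))
      rw [hq]
      linarith
    have e5 : 8 * c.C0 / q * (3 / q * (c.Ly ^ 2 * R.ηx ^ 2) * SM) ≤ 24 / 1024 * SM := by
      have e6 : 8 * c.C0 / q * (3 / q * (c.Ly ^ 2 * R.ηx ^ 2) * SM)
          = (24 * (c.C0 * (c.Ly ^ 2 * R.ηx ^ 2)) / q ^ 2) * SM := by field_simp; ring
      rw [e6]
      refine mul_le_mul_of_nonneg_right ?_ hSM0
      rw [div_le_iff₀ (by positivity)]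
      linarith
    rw [e2] at e1
    linarith
  have hTε : 0 ≤ T * ε ^ 2 := by positivity
  have fD : SD ≤ (T + 1) * (5 * ε ^ 2) := by nlinarith
  have fN : SN ≤ (T + 1) * ε ^ 2 := by nlinarith
  have hT1 : (0 : ℝ) < T + 1 := by positivity
  refine ⟨(integrable_finsetSum _ hNs).const_mul _, ?_, (integrable_finsetSum _ hDs).const_mul _,
    ?_⟩
  · rw [integral_const_mul, integral_finsetSum _ hNs, one_div, inv_mul_le_iff₀ hT1]
    exact fN
  · rw [integral_const_mul, integral_finsetSum _ hDs, one_div, inv_mul_le_iff₀ hT1]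
    exact fD

end BilevelProblem.Assumptions

/-! ### The choice of the parameters -/

theorem BilevelConst.C1_le (c : BilevelConst) {k : ℕ} (hk : 1 ≤ k) :
    c.C1 k ≤ c.C1 1 * (k : ℝ) ^ 2 := by
  have h1 : (1 : ℝ) ≤ (k : ℝ) ^ 2 := one_le_pow₀ (by exact_mod_cast hk)
  have h2 : 2 * c.sigma ^ 2 * 1 ≤ 2 * c.sigma ^ 2 * (k : ℝ) ^ 2 :=
    mul_le_mul_of_nonneg_left h1 (by positivity)
  have e : c.C1 1 * (k : ℝ) ^ 2 = c.C1 k + (2 * c.sigma ^ 2 * (k : ℝ) ^ 2 - 2 * c.sigma ^ 2) := by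
    simp only [C1, Nat.cast_one]
    ring
  linarith

/-- A number of samples of order `log (1 / ε)` suffices for the bias of the Neumann series. -/
theorem BilevelConst.exists_samples (c : BilevelConst) (hc : c.Valid) :
    ∃ a : ℝ, 0 < a ∧ ∀ ε : ℝ, 0 < ε → 1 / 2 ≤ Real.log (1 / ε) → ∃ K : ℕ, 1 ≤ K ∧
      (K : ℝ) ≤ a * Real.log (1 / ε) ∧ c.Cgyy / (2 * c.lam) *
        Real.log (64 * c.Cgxy ^ 2 * c.Cfy ^ 2 / (c.lam ^ 2 * ε ^ 2)) ≤ K := by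
  have hl := hc.lam_pos
  have hC := hc.Cgyy_pos
  set s := c.Cgyy / (2 * c.lam) with hs
  have hs0 : 0 < s := by positivity
  set M := 64 * c.Cgxy ^ 2 * c.Cfy ^ 2 / c.lam ^ 2 with hM
  -- constants are absorbed by `1 ≤ 2 log (1 / ε)`
  refine ⟨4 + s * (2 * |Real.log M| + 2), by positivity, fun ε hε hL => ?_⟩
  set L := Real.log (1 / ε) with hLdef
  have e : 64 * c.Cgxy ^ 2 * c.Cfy ^ 2 / (c.lam ^ 2 * ε ^ 2) = M / ε ^ 2 := by
    rw [hM, div_div]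
  rw [e]
  have h1 : Real.log (M / ε ^ 2) ≤ |Real.log M| + 2 * L := by
    rcases eq_or_ne M 0 with h0 | h0
    -- here `Real.log 0 = 0` stands for `-∞`
    · simp only [h0, zero_div, Real.log_zero, abs_zero]
      linarith
    · rw [Real.log_div h0 (by positivity), Real.log_pow, hLdef, one_div, Real.log_inv]
      push_cast
      linarith [le_abs_self (Real.log M)]
  have h2 : s * Real.log (M / ε ^ 2) ≤ s * (|Real.log M| + 2 * L) :=
    mul_le_mul_of_nonneg_left h1 hs0.le
  have h3 : 0 ≤ s * (|Real.log M| + 2 * L) := by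
    have : 0 ≤ L := by linarith
    positivity
  refine ⟨⌈s * (|Real.log M| + 2 * L)⌉₊ + 1, by omega, ?_, ?_⟩
  · have h4 := (Nat.ceil_lt_add_one h3).le
    have h5 : s * |Real.log M| * 1 ≤ s * |Real.log M| * (2 * L) :=
      mul_le_mul_of_nonneg_left (by linarith) (by positivity)
    push_cast
    linarith
  · have := Nat.le_ceil (s * (|Real.log M| + 2 * L))
    push_cast
    linarith

set_option maxHeartbeats 800000 in
/-- The parameters `γ ~ ε² / L²`, `η_y ~ ε²`, `η_x ~ ε² / L²`, `k ~ L` and `T ~ L⁴ / ε⁴`, with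
`L = log (1 / ε)`, satisfy the conditions for the accuracy `ε`; the total number of samples is of
order `L⁵ / ε⁴`. -/
theorem BilevelConst.exists_paramCond (c : BilevelConst) (hc : c.Valid) (ΔF D : ℝ) :
    ∃ A : ℝ, ∀ ε : ℝ, 0 < ε → ε ≤ 1 / 2 → ∃ (γ ηx ηy : ℝ) (K T : ℕ), 1 ≤ K ∧
      (K : ℝ) ≤ A * Real.log (1 / ε) ∧
      ((T : ℝ) + 2) * (4 + K) ≤ A * Real.log (1 / ε) ^ 5 / ε ^ 4 ∧
      ∀ δ0 Δz0 : ℝ, δ0 ≤ D → Δz0 ≤ c.C1 K + 2 * c.C0 * δ0 + ε ^ 2 / 32 →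
        ParamCond c ΔF δ0 Δz0 ε γ ηx ηy (fun _ => K) T := by
  have hl := hc.lam_pos
  have hC0 := c.C0_nonneg
  have hLF := c.LF_nonneg
  have hLy := hc.Ly_nonneg
  obtain ⟨a, ha, hK⟩ := c.exists_samples hc
  set b := c.C1 1 with hb
  have hb0 : 0 ≤ b := c.C1_nonneg 1
  set Dp := max D 0 with hDp
  have hDp0 : 0 ≤ Dp := le_max_right _ _
  obtain ⟨cγ, hcγ⟩ : ∃ x, x = 1 + 20 * (b * a ^ 2) := ⟨_, rfl⟩
  have hcγ0 : 0 < cγ := by rw [hcγ]; positivity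
  obtain ⟨cy, hcy⟩ : ∃ x, x = c.lam / (1 + 640 * c.C0 * c.sigma ^ 2 + c.Lgy ^ 2) := ⟨_, rfl⟩
  have hcy0 : 0 < cy := by rw [hcy]; positivity
  obtain ⟨cx, hcx⟩ : ∃ x, x = 1 / (1 + 128 * √c.C0 * c.Ly / (cy * c.lam) + 8 * c.LF * cγ) :=
    ⟨_, rfl⟩
  have hcx0 : 0 < cx := by rw [hcx]; positivity
  obtain ⟨w, hw⟩ : ∃ x, x = b * a ^ 2 + 8 * c.C0 * Dp + 1 := ⟨_, rfl⟩
  have hw0 : 0 < w := by rw [hw]; positivity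
  obtain ⟨τ, hτ⟩ : ∃ x, x = 80 * |ΔF| / cx + 20 * cγ * w + 16 * (320 * c.C0 * Dp / (cy * c.lam)) :=
    ⟨_, rfl⟩
  have hτ1 : 0 ≤ 80 * |ΔF| / cx := by positivity
  have hτ2 : 0 ≤ 20 * cγ * w := by positivity
  have hτ3 : 0 ≤ 16 * (320 * c.C0 * Dp / (cy * c.lam)) := by positivity
  have hτ0 : 0 ≤ τ := by rw [hτ]; positivity
  have hcyS : cy * (1 + 640 * c.C0 * c.sigma ^ 2 + c.Lgy ^ 2) = c.lam := by
    rw [hcy, div_mul_cancel₀ _ (by positivity)]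
  have hcxS : cx * (128 * √c.C0 * c.Ly / (cy * c.lam)) + cx * (8 * c.LF * cγ) ≤ 1 := by
    have : cx * (1 + 128 * √c.C0 * c.Ly / (cy * c.lam) + 8 * c.LF * cγ) = 1 := by
      rw [hcx, div_mul_cancel₀ _ (by positivity)]
    linarith
  have hcx1 : cx * (128 * √c.C0 * c.Ly) ≤ cy * c.lam := by
    have h0 : 0 ≤ cx * (8 * c.LF * cγ) := by positivity
    have h1 : cx * (128 * √c.C0 * c.Ly / (cy * c.lam)) ≤ 1 := by linarith
    rwa [mul_div_assoc', div_le_one₀ (by positivity)] at h1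
  have hcx2 : cx * (8 * c.LF * cγ) ≤ 1 := by
    have h0 : 0 ≤ cx * (128 * √c.C0 * c.Ly / (cy * c.lam)) := by positivity
    linarith
  have hcy1 : cy * (640 * c.C0 * c.sigma ^ 2) ≤ c.lam := by
    have : 0 ≤ cy * (1 + c.Lgy ^ 2) := by positivity
    linarith
  have hcy2 : cy * c.Lgy ^ 2 ≤ c.lam := by
    have : 0 ≤ cy * (1 + 640 * c.C0 * c.sigma ^ 2) := by positivity
    linarith
  refine ⟨(τ + 48) * (8 + a), fun ε hε hε2 => ?_⟩
  set L := Real.log (1 / ε) with hLdef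
  have hL : 1 / 2 ≤ L := by
    have h1 : Real.log 2 ≤ L := by
      refine Real.log_le_log (by norm_num) ?_
      rw [le_div_iff₀ hε]
      linarith
    linarith [Real.log_two_gt_d9]
  have hL0 : 0 < L := by linarith
  obtain ⟨K, hK1, hKa, hKe⟩ := hK ε hε hL
  have hL2 : 1 ≤ 4 * L ^ 2 := by
    have := pow_le_pow_left₀ (by norm_num) hL 2
    linarith
  have hL4 : L ^ 2 ≤ 4 * L ^ 4 := by
    have := mul_le_mul_of_nonneg_right hL2 (sq_nonneg L)
    linarith
  have hε1 : ε ^ 2 ≤ 1 / 4 := by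
    have := pow_le_pow_left₀ hε.le hε2 2
    linarith
  have hε4 : ε ^ 4 ≤ 1 := pow_le_one₀ hε.le (by linarith)
  have hC1 : c.C1 K ≤ b * a ^ 2 * L ^ 2 := by
    refine (c.C1_le hK1).trans ?_
    have := pow_le_pow_left₀ (Nat.cast_nonneg K) hKa 2
    have := mul_le_mul_of_nonneg_left this hb0
    linarith
  refine ⟨ε ^ 2 / (cγ * L ^ 2), cx * ε ^ 2 / L ^ 2, cy * ε ^ 2, K, ⌈τ * L ^ 4 / ε ^ 4⌉₊, hK1,
    ?_, ?_, fun δ0 Δz0 hδ hΔ => ?_⟩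
  · refine hKa.trans (mul_le_mul_of_nonneg_right ?_ hL0.le)
    have : 0 ≤ τ * (8 + a) := by positivity
    linarith
  · have h1 : (⌈τ * L ^ 4 / ε ^ 4⌉₊ : ℝ) + 2 ≤ (τ + 48) * (L ^ 4 / ε ^ 4) := by
      have h2 := (Nat.ceil_lt_add_one (by positivity : 0 ≤ τ * L ^ 4 / ε ^ 4)).le
      have h3 : 3 ≤ 48 * (L ^ 4 / ε ^ 4) := by
        rw [mul_div_assoc', le_div_iff₀ (by positivity)]
        linarith
      rw [mul_div_assoc] at h2 ⊢
      linarith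
    have h2 : 4 + (K : ℝ) ≤ (8 + a) * L := by linarith
    calc ((⌈τ * L ^ 4 / ε ^ 4⌉₊ : ℝ) + 2) * (4 + K)
        ≤ (τ + 48) * (L ^ 4 / ε ^ 4) * ((8 + a) * L) := by gcongr
      _ = _ := by ring
  have hδ' : δ0 ≤ Dp := hδ.trans (le_max_left _ _)
  have hCδ : c.C0 * δ0 ≤ c.C0 * Dp := mul_le_mul_of_nonneg_left hδ' hC0
  have hT : τ * L ^ 4 / ε ^ 4 ≤ (⌈τ * L ^ 4 / ε ^ 4⌉₊ : ℝ) := Nat.le_ceil _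
  have hT' : ∀ u, u ≤ τ → u * L ^ 4 / ε ^ 4 ≤ (⌈τ * L ^ 4 / ε ^ 4⌉₊ : ℝ) := fun u hu =>
    le_trans (by gcongr) hT
  refine ⟨by positivity, ?_, fun _ _ => ?_, by positivity, ?_, ?_, by positivity, ?_, ?_,
    fun _ _ => hK1, fun _ _ => hKe, ?_, ?_, ?_⟩
  · rw [div_le_one₀ (by positivity)]
    have h0 : 0 ≤ b * a ^ 2 * L ^ 2 := by positivity
    rw [hcγ]
    linarith
  · rw [div_mul_eq_mul_div, div_le_iff₀ (by positivity)]
    refine mul_le_mul_of_nonneg_left ?_ (sq_nonneg ε)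
    rw [hcγ]
    linarith [sq_nonneg L]
  · rw [div_mul_eq_mul_div, div_le_iff₀ (by positivity)]
    have h1 := mul_le_mul_of_nonneg_left hcx1 (sq_nonneg ε)
    have h2 := mul_le_mul_of_nonneg_left hL2 (by positivity : 0 ≤ ε ^ 2 * (cy * c.lam))
    linarith
  · rw [div_mul_eq_mul_div, div_le_div_iff₀ (by positivity) (by positivity)]
    have h1 := mul_le_mul_of_nonneg_left hcx2 (by positivity : 0 ≤ ε ^ 2 * L ^ 2)
    linarith
  · have h1 := mul_le_mul_of_nonneg_left hcy1 (sq_nonneg ε)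
    linarith
  · have h1 : cy * c.Lgy ^ 2 * ε ^ 2 ≤ cy * c.Lgy ^ 2 * 1 :=
      mul_le_mul_of_nonneg_left (by linarith) (by positivity)
    linarith
  · refine le_trans ?_ (hT' (80 * |ΔF| / cx) (by linarith))
    have e : 80 * |ΔF| / cx * L ^ 4 / ε ^ 4
        = 20 * (|ΔF| * (4 * L ^ 4)) / (cx * ε ^ 4) := by field_simp; ring
    have e' : 20 * ΔF / (cx * ε ^ 2 / L ^ 2 * ε ^ 2) = 20 * (ΔF * L ^ 2) / (cx * ε ^ 4) := by
      field_simp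
    rw [e, e']
    have h1 : ΔF * L ^ 2 ≤ |ΔF| * (4 * L ^ 4) :=
      mul_le_mul (le_abs_self _) hL4 (by positivity) (abs_nonneg _)
    gcongr
  · refine le_trans ?_ (hT' (20 * cγ * w) (by linarith))
    have e' : 20 * Δz0 / (ε ^ 2 / (cγ * L ^ 2) * ε ^ 2) = 20 * cγ * (Δz0 * L ^ 2) / ε ^ 4 := by
      field_simp
    have h1 : Δz0 ≤ w * L ^ 2 := by
      have h2 := mul_le_mul_of_nonneg_left hL2 (by positivity : 0 ≤ 2 * (c.C0 * Dp))
      rw [hw]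
      linarith
    have h2 : Δz0 * L ^ 2 ≤ w * L ^ 4 := by
      have := mul_le_mul_of_nonneg_right h1 (sq_nonneg L)
      linarith
    have h3 := mul_le_mul_of_nonneg_left h2 (by positivity : 0 ≤ 20 * cγ)
    rw [e', div_le_div_iff_of_pos_right (by positivity)]
    linarith
  · refine le_trans ?_ (hT' (16 * (320 * c.C0 * Dp / (cy * c.lam))) (by linarith))
    have e : 16 * (320 * c.C0 * Dp / (cy * c.lam)) * L ^ 4 / ε ^ 4
        = 320 * (c.C0 * Dp * (16 * L ^ 4)) / (cy * c.lam * ε ^ 4) := by field_simp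
    have e' : 320 * c.C0 * δ0 / (cy * ε ^ 2 * c.lam * ε ^ 2)
        = 320 * (c.C0 * δ0) / (cy * c.lam * ε ^ 4) := by
      congr 1 <;> ring
    rw [e, e']
    have h1 : c.C0 * δ0 ≤ c.C0 * Dp * (16 * L ^ 4) := by
      have h2 : 1 ≤ 16 * L ^ 4 := by linarith
      have := mul_le_mul_of_nonneg_left h2 (by positivity : 0 ≤ c.C0 * Dp)
      linarith
    gcongr

namespace BilevelProblem

theorem calls_le {d d' : ℕ} {Ξ : Type u} {Ω : Type v} {S : BilevelProblem d d' Ξ}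
    {c : BilevelConst} {R : SMBRun d d' Ξ Ω} {ω : Ω} {K : ℕ} (hp : ∀ r, R.p r ω ≤ K)
    (t : ℕ) : (S.smb c R ω t).calls ≤ (t + 1) * (4 + K) := by
  induction t with
  | zero =>
    have := hp 0
    change 3 + R.p 0 ω ≤ _
    omega
  | succ t ih =>
    have := hp (t + 1)
    change (S.smb c R ω t).calls + (3 + R.p (t + 1) ω) + 1 ≤ _
    rw [add_one_mul (t + 1)]
    omega

variable {d d' : ℕ} {Ξ : Type u} {Ω : Type v} [MeasurableSpace Ξ] {S : BilevelProblem d d' Ξ}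
  {P : Measure Ξ} {c : BilevelConst} {R : SMBRun d d' Ξ Ω} [MeasurableSpace Ω] {μ : Measure Ω}
  [IsProbabilityMeasure μ]

/-- The initial estimator error: a convex combination of two independent stochastic hypergradients
at `(x₀, y₀)`, both computed with `k 0` samples. -/
theorem Assumptions.integral_estErr_zero_le [IsProbabilityMeasure P] (h : S.Assumptions P c)
    (hc : c.Valid) (hR : R.IsRandom P μ) {b : ℝ} (hk : 1 ≤ R.k 0) (hγ : 0 < R.γ) (hγ1 : R.γ ≤ 1)
    (hb : ∀ x y, ‖S.hyperGrad x y - S.meanGrad c (R.k 0) x y‖ ^ 2 ≤ b) :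
    ∫ ω, S.estErr c R 0 ω ∂μ
      ≤ c.C1 (R.k 0) + 2 * c.C0 * ‖R.y0 - S.yStar R.x0‖ ^ 2 + 2 * b := by
  set v := gradient S.F R.x0 with hv
  have hm := h.norm_meanGrad_sub_gradient_sq_le hc hb R.x0 R.y0
  have key : ∀ r, roundK R.k r = R.k 0 →
      Integrable (fun ω => ‖S.gradEst c R ω r R.x0 R.y0 - v‖ ^ 2) μ ∧
      ∫ ω, ‖S.gradEst c R ω r R.x0 R.y0 - v‖ ^ 2 ∂μ
        ≤ c.C1 (R.k 0) + 2 * c.C0 * ‖R.y0 - S.yStar R.x0‖ ^ 2 + 2 * b := fun r hr => by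
    have h1 := h.integral_sq_norm_add_smul_gradEst_le hc hR (hr.symm ▸ hk) R.x0 R.y0 1 (-v)
    rw [hr] at h1
    simp only [one_smul, neg_add_eq_sub, one_pow, one_mul] at h1
    exact ⟨h1.1, by linarith [h1.2]⟩
  obtain ⟨i0, l0⟩ := key 0 rfl
  obtain ⟨i1, l1⟩ := key 1 rfl
  have h1 : ∫ ω, S.estErr c R 0 ω ∂μ ≤ ∫ ω, ((1 - R.γ) * ‖S.gradEst c R ω 0 R.x0 R.y0 - v‖ ^ 2
      + R.γ * ‖S.gradEst c R ω 1 R.x0 R.y0 - v‖ ^ 2) ∂μ := by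
    refine integral_mono_of_nonneg (Filter.Eventually.of_forall fun ω => sq_nonneg _)
      ((i0.const_mul _).add (i1.const_mul _)) (Filter.Eventually.of_forall fun ω => ?_)
    have e : (S.smb c R ω 1).z - gradient S.F (S.smb c R ω 0).x
        = (1 - R.γ) • (S.gradEst c R ω 0 R.x0 R.y0 - v)
          + R.γ • (S.gradEst c R ω 1 R.x0 R.y0 - v) := by
      change (1 - R.γ) • S.gradEst c R ω 0 R.x0 R.y0 + R.γ • S.gradEst c R ω 1 R.x0 R.y0 - v = _
      module
    have h2 := sq_norm_convex_add_le hγ hγ1 (S.gradEst c R ω 0 R.x0 R.y0 - v)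
      (R.γ • (S.gradEst c R ω 1 R.x0 R.y0 - v))
    rw [← e, norm_smul, mul_pow, Real.norm_eq_abs, sq_abs] at h2
    refine h2.trans (le_of_eq ?_)
    field_simp
  rw [integral_add (i0.const_mul _) (i1.const_mul _), integral_const_mul, integral_const_mul] at h1
  have := mul_le_mul_of_nonneg_left l0 (sub_nonneg.2 hγ1)
  have := mul_le_mul_of_nonneg_left l1 hγ.le
  linarith

/-- The number of oracle calls, when every round uses `K` as the range of its random length. -/
theorem ae_calls_le (hR : R.IsRandom P μ) {K : ℕ} (hK : 1 ≤ K) (hk : ∀ t, R.k t = K) (t : ℕ) :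
    ∀ᵐ ω ∂μ, (S.smb c R ω t).calls ≤ (t + 1) * (4 + K) := by
  have hr : ∀ r, roundK R.k r = K := fun r => by
    cases r <;> exact hk _
  have h1 : ∀ᵐ ω ∂μ, ∀ r, R.p r ω < K := by
    rw [ae_all_iff]
    intro r
    have := hR.ae_p_lt r (by rw [hr]; exact hK)
    rwa [hr] at this
  filter_upwards [h1] with ω hω
  exact calls_le (fun r => (hω r).le) t

end BilevelProblem

end

/-- Part 1: accuracy of SMB for all parameters that satisfy the conditions. Part 2: for every
`ε ≤ 1/2` there is a choice of the parameters, depending on `ε` and the constants of the problem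
class only, that satisfies these conditions, with `k_t = O(log (1/ε))` and with a total number of
oracle calls that is `Õ(1/ε⁴)`. -/
theorem theorem5 (c : BilevelConst) (hc : c.Valid) (ΔF : ℝ) :
    (∀ (d d' : ℕ) (Ξ : Type u) [MeasurableSpace Ξ] (P : Measure Ξ) [IsProbabilityMeasure P]
        (Ω : Type v) [MeasurableSpace Ω] (μ : Measure Ω) [IsProbabilityMeasure μ]
        (S : BilevelProblem d d' Ξ) (R : SMBRun d d' Ξ Ω) (ε : ℝ) (T : ℕ),
        S.Assumptions P c → R.IsRandom P μ →
        BddBelow (Set.range S.F) → S.F R.x0 - (⨅ x, S.F x) ≤ ΔF →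
        0 < ε →
        ParamCond c ΔF (‖R.y0 - S.yStar R.x0‖ ^ 2) (∫ ω, S.estErr c R 0 ω ∂μ) ε
          R.γ R.ηx R.ηy R.k T →
        Differentiable ℝ S.F ∧ S.Accurate c R μ T ε) ∧
    (∀ D : ℝ, ∃ (A : ℝ) (m : ℕ), ∀ ε : ℝ, 0 < ε → ε ≤ 1 / 2 →
      ∃ (γ ηx ηy : ℝ) (k : ℕ → ℕ) (T : ℕ),
        (∀ t, (k t : ℝ) ≤ A * Real.log (1 / ε)) ∧
        (∑ t ∈ Finset.range (T + 1), (k t : ℝ)) ≤ A * Real.log (1 / ε) ^ m / ε ^ 4 ∧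
        ∀ (d d' : ℕ) (Ξ : Type u) [MeasurableSpace Ξ] (P : Measure Ξ) [IsProbabilityMeasure P]
          (Ω : Type v) [MeasurableSpace Ω] (μ : Measure Ω) [IsProbabilityMeasure μ]
          (S : BilevelProblem d d' Ξ) (R : SMBRun d d' Ξ Ω),
          S.Assumptions P c → R.IsRandom P μ →
          BddBelow (Set.range S.F) → S.F R.x0 - (⨅ x, S.F x) ≤ ΔF →
          ‖R.y0 - S.yStar R.x0‖ ^ 2 ≤ D →
          R.γ = γ → R.ηx = ηx → R.ηy = ηy → R.k = k →
          ParamCond c ΔF (‖R.y0 - S.yStar R.x0‖ ^ 2) (∫ ω, S.estErr c R 0 ω ∂μ) ε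
            γ ηx ηy k T ∧
          S.Accurate c R μ T ε ∧
          ∀ᵐ ω ∂μ, ((S.smb c R ω (T + 1)).calls : ℝ) ≤
            A * Real.log (1 / ε) ^ m / ε ^ 4) := by
  refine ⟨?_, fun D => ?_⟩
  · intro d d' Ξ _ P _ Ω _ μ _ S R ε T h hR hbdd hΔ hε hp
    exact ⟨h.differentiable_F hc, h.accurate hc hR hbdd hΔ hε hp⟩
  obtain ⟨A, hA⟩ := c.exists_paramCond hc ΔF D
  refine ⟨A, 5, fun ε hε hε2 => ?_⟩
  obtain ⟨γ, ηx, ηy, K, T, hK1, hKA, hTK, hpar⟩ := hA ε hε hε2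
  refine ⟨γ, ηx, ηy, fun _ => K, T, fun _ => hKA, ?_, ?_⟩
  · refine le_trans ?_ hTK
    rw [Finset.sum_const, Finset.card_range, nsmul_eq_mul]
    push_cast
    gcongr <;> linarith
  intro d d' Ξ _ P _ Ω _ μ _ S R h hR hbdd hΔ hD hRγ hRx hRy hRk
  have hk : ∀ t, R.k t = K := fun t => by rw [hRk]
  -- the conditions on `γ` and `k` do not involve `E[Δ₀]`, so they are available for bounding it
  have hp0 := hpar (‖R.y0 - S.yStar R.x0‖ ^ 2)
    (c.C1 K + 2 * c.C0 * ‖R.y0 - S.yStar R.x0‖ ^ 2 + ε ^ 2 / 32) hD le_rfl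
  have hΔ0 := h.integral_estErr_zero_le hc hR (b := ε ^ 2 / 64) (by rw [hk]; exact hK1)
    (by rw [hRγ]; exact hp0.γ_pos) (by rw [hRγ]; exact hp0.γ_le_one)
    (fun x y => h.sq_norm_hyperGrad_sub_meanGrad_le hc hε
      (by rw [hk]; exact hp0.k_ge 0 (Nat.zero_le T)) x y)
  rw [hk] at hΔ0
  have hp := hpar (‖R.y0 - S.yStar R.x0‖ ^ 2) (∫ ω, S.estErr c R 0 ω ∂μ) hD (by linarith)
  refine ⟨hp, ?_, ?_⟩
  · subst hRγ hRx hRy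
    rw [← hRk] at hp
    exact h.accurate hc hR hbdd hΔ hε hp
  · filter_upwards [BilevelProblem.ae_calls_le (S := S) (c := c) hR hK1 hk (T + 1)] with ω hω
    refine le_trans ?_ hTK
    have : ((S.smb c R ω (T + 1)).calls : ℝ) ≤ (((T + 1 + 1) * (4 + K) : ℕ) : ℝ) :=
      Nat.cast_le.2 hω
    refine this.trans (le_of_eq ?_)
    push_cast
    ring
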